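/- Let $d,m\in\mathbb N$ with $d\ge 1$, let $0<s<m$ be real, and let $\mathbb T=\mathbb R/\mathbb Z$. **Wavelets.** Let $\varphi,\psi\in L_2(\mathbb R)$ be real-valued. For $j\in\mathbb Z$ let $V_j$ be the closed linear span in $L_2(\mathbb R)$ of $\{\varphi(2^j\cdot-k):k\in\mathbb Z\}$, and let $W_j$ be the orthogonal complement of $V_j$ in $V_{j+1}$. Assume that $V_j\subset V_{j+1}$ for all $j$, that $L_2(\mathbb R)=V_0\oplus W_0\oplus W_1\oplus\cdots$, that for every $j\ge 0$ the space $W_j$ is the closed linear span of the functions $\psi_{j,k}=2^{j/2}\psi(2^j\cdot-k)$, $k\in\mathbb Z$, and that $\sum_{\ell\in\mathbb Z}\varphi(x+\ell)=1$ for almost every $x$. Put $\psi_{-1,k}=\varphi(\cdot-k)$, $\psi^{\mathrm{per}}_{j,k}(x)=\sum_{\ell\in\mathbb Z}\psi_{j,k}(x+\ell)$, $\mathcal I_j=\{0,\dots,2^j-1\}$ for $j\ge 0$, and $\mathcal I_{-1}=\{0\}$. Assume further: * $\psi$ vanishes outside $[0,S]$ for some real $S$; * $\int_{\mathbb R}\psi(x)x^\beta\,dx=0$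 for $\beta=0,\dots,m-1$; * there are real constants $\gamma>0$ and $\delta$ such that for all $j\ge 0$ and all complex numbers $c_k$ $$\gamma\sum_{k\in\mathcal I_j}|c_k|^2\le\Big\|\sum_{k\in\mathcal I_j}c_k\psi^{\mathrm{per}}_{j,k}\Big\|_{L_2(\mathbb T)}^2\le\delta\sum_{k\in\mathcal I_j}|c_k|^2 .$$ Let $\psi^{\mathrm{per}*}_{j,k}\in L_2(\mathbb T)$ ($j\ge -1$, $k\in\mathcal I_j$) be the dual system, i.e. $\langle\psi^{\mathrm{per}}_{j,k},\psi^{\mathrm{per}*}_{i,l}\rangle=\delta_{i,j}\delta_{k,l}$. **Projection.** For $\boldsymbol j\in\mathbb Z^d$ with $j_i\ge-1$ for all $i$, put $|\boldsymbol j|_1=\sum_{i:\,j_i\ge 0}j_i$ and $\mathcal I_{\boldsymbol j}=\prod_{i=1}^d\mathcal I_{j_i}$. For $\boldsymbol k\in\mathcal I_{\boldsymbol j}$ put $\psi^{\mathrm{per}}_{\boldsymbol j,\boldsymbol k}(\boldsymbol x)=\prod_{i=1}^d\psi^{\mathrm{per}}_{j_i,k_i}(x_i)$ and $\psi^{\mathrm{per}*}_{\boldsymbol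 j,\boldsymbol k}(\boldsymbol x)=\prod_{i=1}^d\psi^{\mathrm{per}*}_{j_i,k_i}(x_i)$. For $n\in\mathbb N_0$ and $f\in L_2(\mathbb T^d)$ define $$P_nf=\sum_{\boldsymbol j\ge-\boldsymbol 1,\ |\boldsymbol j|_1\le n}\ \sum_{\boldsymbol k\in\mathcal I_{\boldsymbol j}}\langle f,\psi^{\mathrm{per}*}_{\boldsymbol j,\boldsymbol k}\rangle\,\psi^{\mathrm{per}}_{\boldsymbol j,\boldsymbol k},\qquad N=\operatorname{rank}P_n .$$ **Smoothness space.** $H^s_{\mathrm{mix}}(\mathbb T^d)$ is the set of all $f\in L_2(\mathbb T^d)$ with $$\|f\|_{H^s_{\mathrm{mix}}}^2=\sum_{\boldsymbol k\in\mathbb Z^d}|c_{\boldsymbol k}(f)|^2\prod_{i=1}^d(1+|k_i|^2)^s<\infty ,$$ where $c_{\boldsymbol k}(f)$ are the Fourier coefficients of $f$. **Claim.** There is a constant $C$, which depends only on $d$, $m$, $s$ and the wavelet system and not on $n$ or $f$, such that for all $n\in\mathbb N_0$ and all $f\in H^s_{\mathrm{mix}}(\mathbb T^d)$ $$\|f-P_nf\|_{L_2(\mathbb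 T^d)}\le C\,N^{-s}(\log N)^{s(d-1)}\,\|f\|_{H^s_{\mathrm{mix}}(\mathbb T^d)} .$$ -/

import Mathlib

open MeasureTheory

namespace HypWavelet

/-! ### Square integrable functions -/

open Classical in
/-- The class in `L₂(μ)` of a function `g` (with the value `0` if `g` is not square integrable;
all functions to which this is applied below are square integrable). -/
noncomputable def toL2 {α : Type*} [MeasurableSpace α] (μ : Measure α) (g : α → ℂ) : Lp ℂ 2 μ :=
  if h : MemLp g 2 μ then h.toLp g else 0

/-- `L₂(ℝ)`. -/
abbrev L2R : Type := Lp ℂ 2 (volume : Measure ℝ)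

/-- `L₂(𝕋)`, where `𝕋 = ℝ / ℤ` carries the Lebesgue measure of total mass one. -/
abbrev L2T : Type := Lp ℂ 2 (AddCircle.haarAddCircle : Measure UnitAddCircle)

/-- The Lebesgue measure on `𝕋ᵈ`, of total mass one. -/
noncomputable abbrev torusMeasure (d : ℕ) : Measure (UnitAddTorus (Fin d)) :=
  Measure.pi fun _ => AddCircle.haarAddCircle

/-- `L₂(𝕋ᵈ)`. -/
abbrev L2Td (d : ℕ) : Type := Lp ℂ 2 (torusMeasure d)

/-! ### Scaling function and wavelet on the line -/

/-- `V_j`: the closed linear span in `L₂(ℝ)` of the functions `φ(2^j · - k)`, `k ∈ ℤ`. -/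
noncomputable def scalingSpace (φ : ℝ → ℝ) (j : ℤ) : Submodule ℂ L2R :=
  (Submodule.span ℂ (Set.range fun k : ℤ =>
    toL2 volume fun x : ℝ => ((φ ((2 : ℝ) ^ j * x - k) : ℝ) : ℂ))).topologicalClosure

/-- `W_j`: the orthogonal complement of `V_j` in `V_{j+1}`. -/
noncomputable def waveletSpace (φ : ℝ → ℝ) (j : ℤ) : Submodule ℂ L2R :=
  (scalingSpace φ j)ᗮ ⊓ scalingSpace φ (j + 1)

/-- The functions `ψ_{j,k}` on the line: `ψ_{-1,k} = φ(· - k)` and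
`ψ_{j,k} = 2^{j/2} ψ(2^j · - k)` for `j ≥ 0`. -/
noncomputable def waveletLine (φ ψ : ℝ → ℝ) (j k : ℤ) (x : ℝ) : ℝ :=
  if j = -1 then φ (x - k) else (2 : ℝ) ^ ((j : ℝ) / 2) * ψ ((2 : ℝ) ^ j * x - k)

/-- `ψ` is a (semi-orthogonal) wavelet with scaling function `φ`: the spaces `V_j` are nested,
`L₂(ℝ) = V_0 ⊕ W_0 ⊕ W_1 ⊕ ⋯`, every `W_j` is the closed linear span of the `ψ_{j,k}`, `k ∈ ℤ`,
and the `1`-periodization of `φ` is the constant function `1`. -/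
structure IsWavelet (φ ψ : ℝ → ℝ) : Prop where
  memLp_scaling : MemLp φ 2 volume
  memLp_wavelet : MemLp ψ 2 volume
  nested : ∀ j : ℤ, scalingSpace φ j ≤ scalingSpace φ (j + 1)
  decomposition :
    (scalingSpace φ 0 ⊔ ⨆ j : ℕ, waveletSpace φ (j : ℤ)).topologicalClosure = ⊤
  generates : ∀ j : ℕ, waveletSpace φ (j : ℤ) =
    (Submodule.span ℂ (Set.range fun k : ℤ =>
      toL2 volume fun x : ℝ => ((waveletLine φ ψ (j : ℤ) k x : ℝ) : ℂ))).topologicalClosure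
  periodization : ∀ᵐ x : ℝ, HasSum (fun l : ℤ => φ (x + l)) 1

/-- Compact support: `ψ` vanishes outside some `[0, S]`. -/
def HasCompactSupp (ψ : ℝ → ℝ) : Prop :=
  ∃ S : ℝ, Function.support ψ ⊆ Set.Icc 0 S

/-- Vanishing moments of order `m`. -/
def HasVanishingMoments (ψ : ℝ → ℝ) (m : ℕ) : Prop :=
  ∀ β : ℕ, β < m → ∫ x : ℝ, ψ x * x ^ β = 0

/-! ### Periodized wavelets -/

/-- The `1`-periodization of `g`, as a function on the torus, which is identified
with `[-1/2, 1/2)`. -/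
noncomputable def periodize (g : ℝ → ℝ) (x : UnitAddCircle) : ℝ :=
  ∑' l : ℤ, g ((AddCircle.equivIco (1 : ℝ) (-(1 / 2)) x : ℝ) + l)

/-- The periodized wavelet `ψ^per_{j,k}` as an element of `L₂(𝕋)`. -/
noncomputable def waveletPer (φ ψ : ℝ → ℝ) (j k : ℤ) : L2T :=
  toL2 AddCircle.haarAddCircle fun x => ((periodize (waveletLine φ ψ j k) x : ℝ) : ℂ)

/-- The translation indices on level `j`: `{0, …, 2^j - 1}` if `j ≥ 0`, and `{0}` if `j = -1`. -/
noncomputable def shifts (j : ℤ) : Finset ℤ :=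
  if 0 ≤ j then Finset.Ico 0 (2 ^ j.toNat) else {0}

/-- The periodized wavelets form a Riesz basis on every level, with constants that do not
depend on the level. -/
def IsLevelwiseRiesz (φ ψ : ℝ → ℝ) : Prop :=
  ∃ γ δ : ℝ, 0 < γ ∧ ∀ (j : ℕ) (c : ℤ → ℂ),
    γ * ∑ k ∈ shifts j, ‖c k‖ ^ 2 ≤ ‖∑ k ∈ shifts j, c k • waveletPer φ ψ j k‖ ^ 2 ∧
    ‖∑ k ∈ shifts j, c k • waveletPer φ ψ j k‖ ^ 2 ≤ δ * ∑ k ∈ shifts j, ‖c k‖ ^ 2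

/-- `ψs` is the dual system of the periodized wavelets:
`⟨ψ^per_{j,k}, ψs_{i,l}⟩ = δ_{i,j} δ_{k,l}`. -/
def IsDualSystem (φ ψ : ℝ → ℝ) (ψs : ℤ → ℤ → L2T) : Prop :=
  ∀ j ≥ (-1 : ℤ), ∀ k ∈ shifts j, ∀ i ≥ (-1 : ℤ), ∀ l ∈ shifts i,
    inner ℂ (ψs i l) (waveletPer φ ψ j k) = if j = i ∧ k = l then 1 else 0

/-! ### Hyperbolic wavelet projection -/

/-- The tensor product `x ↦ ∏ᵢ uᵢ(xᵢ)` of functions on the torus. -/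
noncomputable def tensorL2 {d : ℕ} (u : Fin d → L2T) : L2Td d :=
  toL2 (torusMeasure d) fun x => ∏ i, u i (x i)

/-- `𝒥_n`: the level multi-indices `j ≥ -1` with `|j|₁ ≤ n`, where `|j|₁` is the sum of the
non-negative entries of `j`. -/
noncomputable def levels (d n : ℕ) : Finset (Fin d → ℤ) :=
  (Fintype.piFinset fun _ => Finset.Icc (-1 : ℤ) n).filter fun j => ∑ i, max (j i) 0 ≤ (n : ℤ)

theorem mem_levels {d n : ℕ} {j : Fin d → ℤ} :
    j ∈ levels d n ↔ (∀ i, -1 ≤ j i) ∧ ∑ i, max (j i) 0 ≤ (n : ℤ) := by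
  simp only [levels, Finset.mem_filter, Fintype.mem_piFinset, Finset.mem_Icc]
  refine ⟨fun h => ⟨fun i => (h.1 i).1, h.2⟩, fun h => ⟨fun i => ⟨h.1 i, ?_⟩, h.2⟩⟩
  have h1 : max (j i) 0 ≤ ∑ i, max (j i) 0 :=
    Finset.single_le_sum (f := fun i => max (j i) 0) (fun i _ => le_max_right _ _)
      (Finset.mem_univ i)
  exact (le_max_left _ _).trans (h1.trans h.2)

/-- `ℐ_j`: the translation multi-indices belonging to the level multi-index `j`. -/
noncomputable def shiftsMulti {d : ℕ} (j : Fin d → ℤ) : Finset (Fin d → ℤ) :=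
  Fintype.piFinset fun i => shifts (j i)

/-- The operator
`P_n f = ∑_{j ∈ 𝒥_n} ∑_{k ∈ ℐ_j} ⟨f, ψ^{per*}_{j,k}⟩ ψ^per_{j,k}` on `L₂(𝕋ᵈ)`. -/
noncomputable def hypProj (φ ψ : ℝ → ℝ) (ψs : ℤ → ℤ → L2T) (d n : ℕ) : L2Td d →L[ℂ] L2Td d :=
  ∑ j ∈ levels d n, ∑ k ∈ shiftsMulti j,
    (innerSL ℂ (tensorL2 fun i => ψs (j i) (k i))).smulRight
      (tensorL2 fun i => waveletPer φ ψ (j i) (k i))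

theorem hypProj_apply (φ ψ : ℝ → ℝ) (ψs : ℤ → ℤ → L2T) (d n : ℕ) (f : L2Td d) :
    hypProj φ ψ ψs d n f = ∑ j ∈ levels d n, ∑ k ∈ shiftsMulti j,
      inner ℂ (tensorL2 fun i => ψs (j i) (k i)) f •
        tensorL2 fun i => waveletPer φ ψ (j i) (k i) := by
  simp [hypProj]

/-- `N = rank P_n`. -/
noncomputable def hypRank (φ ψ : ℝ → ℝ) (ψs : ℤ → ℤ → L2T) (d n : ℕ) : ℕ :=
  Module.finrank ℂ (LinearMap.range (hypProj φ ψ ψs d n : L2Td d →ₗ[ℂ] L2Td d))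

/-! ### Sobolev spaces of dominating mixed smoothness -/

/-- The terms `|c_k(f)|² ∏ᵢ (1 + |kᵢ|²)^s` of the squared norm of `H^s_mix(𝕋ᵈ)`. -/
noncomputable def mixTerm {d : ℕ} (s : ℝ) (f : L2Td d) (k : Fin d → ℤ) : ℝ :=
  ‖UnitAddTorus.mFourierCoeff f k‖ ^ 2 * ∏ i, (1 + |(k i : ℝ)| ^ 2) ^ s

/-- `f ∈ H^s_mix(𝕋ᵈ)`. -/
def MemHmix {d : ℕ} (s : ℝ) (f : L2Td d) : Prop := Summable (mixTerm s f)

/-- The norm of `H^s_mix(𝕋ᵈ)`. -/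
noncomputable def normHmix {d : ℕ} (s : ℝ) (f : L2Td d) : ℝ :=
  Real.sqrt (∑' k, mixTerm s f k)

end HypWavelet

/-! The level spaces of the periodized system (constants on level `-1`, the span of the `waveletPer
φ ψ j k` on level `j ≥ 0`) are mutually orthogonal, because periodization turns an inner product on
the torus into a finite sum of inner products on the line. Choosing an orthonormal basis in each
level (`adaptedBasis`) and taking tensor products gives an orthonormal basis of `L2Td d`. By
biorthogonality `hypProj` fixes a basis element of levels `j` if `|j|₁ ≤ n` and kills it otherwise
(`hypProj_tensor`). The error is therefore the tail of an orthonormal expansion, and a bound on the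
coefficients weighted by `4 ^ (s |j|₁)` yields `‖f - P_n f‖ ≤ C 2^{-sn} ‖f‖`.

The weighted bound is first proved in one variable (`exists_direct_estimate`). On level `j`,
frequencies below `2^j / 2` are handled by an exact discrete Parseval identity together with
`|ψ̂(ξ)| ≤ C |ξ|^m`, which comes from the vanishing moments; higher frequencies are handled by
Bessel's inequality. Since `0 < s < m`, the sum over the levels is geometric on both sides of the
level that matches the frequency. The lower Riesz bound passes to the adapted basis, and
`tensor_power_bound` passes to `d` variables.

Completeness of the periodized system is the other main point (`eq_zero_of_orthogonal_waveletPer`).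
Suppose a unit vector `g` is orthogonal to the constants and to all periodized wavelets. Cut both
`1` and `g` to a window of `R` cells of the line. Only wavelets near the two ends of the window see
them, so by the Riesz bounds on the line both windows stay within a distance of `V_0` that does not
depend on `R`. But `V_0` is generated by the shifts of a single function, so after a discrete
Fourier transform over the cells it offers only one direction per frequency, and the squared
distances of two orthonormal windows add up to at least `R`. For large `R` this is a contradiction.

Finally the rank equals the number of indices (`hypRank_eq`), which lies between `2^n + 1` and `(n +
2)^{d-1} 2^{n+1}`; this converts `2^{-sn}` into the stated bound in `N`. -/

namespace HypWavelet

/-! ### Fundamental domains of the torus -/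

/-- The representative of `x : 𝕋` in `[l - 1/2, l + 1/2)`. -/
noncomputable def rep (l : ℤ) (x : UnitAddCircle) : ℝ :=
  (AddCircle.equivIco (1 : ℝ) (-(1 / 2)) x : ℝ) + l

theorem rep_add (l k : ℤ) (x : UnitAddCircle) : rep (l + k) x = rep l x + k := by
  simp [rep, add_assoc]

theorem rep_sub (l k : ℤ) (x : UnitAddCircle) : rep (l - k) x = rep l x - k := by
  simp [rep]; ring

theorem periodize_eq_tsum_rep (g : ℝ → ℝ) (x : UnitAddCircle) :
    periodize g x = ∑' l : ℤ, g (rep l x) := rfl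

theorem coe_int (l : ℤ) : ((l : ℝ) : UnitAddCircle) = 0 := by
  rw [AddCircle.coe_eq_zero_iff]; exact ⟨l, by simp⟩

theorem coe_rep (l : ℤ) (x : UnitAddCircle) : ((rep l x : ℝ) : UnitAddCircle) = x := by
  unfold rep
  rw [AddCircle.coe_add, coe_int, add_zero]
  exact AddCircle.coe_equivIco

theorem rep_mem (l : ℤ) (x : UnitAddCircle) :
    rep l x ∈ Set.Ico ((l : ℝ) - 1 / 2) (l + 1 / 2) := by
  have h := (AddCircle.equivIco (1 : ℝ) (-(1 / 2)) x).2
  unfold rep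
  constructor
  · have := h.1; linarith
  · have := h.2; linarith

theorem rep_coe {l : ℤ} {y : ℝ} (hy : y ∈ Set.Ico ((l : ℝ) - 1 / 2) (l + 1 / 2)) :
    rep l (y : UnitAddCircle) = y := by
  have h1 : (y : UnitAddCircle) = ((y - l : ℝ) : UnitAddCircle) := by
    rw [AddCircle.coe_sub, coe_int, sub_zero]
  unfold rep
  rw [h1, AddCircle.equivIco_coe_eq]
  · simp
  · constructor
    · linarith [hy.1]
    · linarith [hy.2]

theorem measurable_rep (l : ℤ) : Measurable (rep l) :=
  (measurable_subtype_coe.comp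
    (AddCircle.measurableEquivIco (1 : ℝ) (-(1 / 2))).measurable).add_const _

theorem measurableEmbedding_rep (l : ℤ) : MeasurableEmbedding (rep l) :=
  (measurableEmbedding_addRight (l : ℝ)).comp
    ((MeasurableEmbedding.subtype_coe measurableSet_Ico).comp
      (AddCircle.measurableEquivIco (1 : ℝ) (-(1 / 2))).measurableEmbedding)

theorem haar_eq_volume : (AddCircle.haarAddCircle : Measure UnitAddCircle) = volume := by
  rw [AddCircle.volume_eq_smul_haarAddCircle]; simp

theorem measurePreserving_coe (l : ℤ) :
    MeasurePreserving ((↑) : ℝ → UnitAddCircle)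
      (volume.restrict (Set.Ico ((l : ℝ) - 1 / 2) (l + 1 / 2))) AddCircle.haarAddCircle := by
  have h := UnitAddCircle.measurePreserving_mk ((l : ℝ) - 1 / 2)
  rw [← haar_eq_volume, ← restrict_Ico_eq_restrict_Ioc,
    show (l : ℝ) - 1 / 2 + 1 = l + 1 / 2 by ring] at h
  exact h

theorem measurePreserving_rep (l : ℤ) :
    MeasurePreserving (rep l) AddCircle.haarAddCircle
      (volume.restrict (Set.Ico ((l : ℝ) - 1 / 2) (l + 1 / 2))) := by
  refine ⟨measurable_rep l, ?_⟩
  have h := measurePreserving_coe l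
  rw [← h.map_eq, Measure.map_map (measurable_rep l) h.measurable]
  conv_rhs => rw [← Measure.map_id (μ := volume.restrict _)]
  refine Measure.map_congr ?_
  filter_upwards [ae_restrict_mem measurableSet_Ico] with y hy
  exact rep_coe hy

theorem integral_comp_rep {E : Type*} [NormedAddCommGroup E] [NormedSpace ℝ E] (l : ℤ)
    (F : ℝ → E) :
    ∫ x, F (rep l x) ∂AddCircle.haarAddCircle =
      ∫ y in Set.Ico ((l : ℝ) - 1 / 2) (l + 1 / 2), F y :=
  (measurePreserving_rep l).integral_comp (measurableEmbedding_rep l) F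

theorem integrable_comp_rep {E : Type*} [NormedAddCommGroup E] {F : ℝ → E}
    (hF : Integrable F volume) (l : ℤ) :
    Integrable (fun x => F (rep l x)) (AddCircle.haarAddCircle : Measure UnitAddCircle) :=
  (measurePreserving_rep l).integrable_comp_of_integrable hF.integrableOn

theorem iUnion_Ico_half : ⋃ l : ℤ, Set.Ico ((l : ℝ) - 1 / 2) (l + 1 / 2) = Set.univ := by
  rw [← iUnion_Ico_add_intCast (-(1 / 2) : ℝ)]
  refine Set.iUnion_congr fun l => ?_
  congr 1 <;> ring

theorem pairwise_disjoint_Ico_half :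
    Pairwise (Function.onFun Disjoint
      fun l : ℤ => Set.Ico ((l : ℝ) - 1 / 2) (l + 1 / 2)) := by
  have h := Set.pairwise_disjoint_Ico_add_intCast (-(1 / 2) : ℝ)
  have e : (fun l : ℤ => Set.Ico ((l : ℝ) - 1 / 2) (l + 1 / 2)) =
      fun l : ℤ => Set.Ico (-(1 / 2) + (l : ℝ)) (-(1 / 2) + l + 1) := by
    funext l
    congr 1 <;> ring
  rwa [e]

theorem hasSum_integral_rep {E : Type*} [NormedAddCommGroup E] [NormedSpace ℝ E]
    {F : ℝ → E} (hF : Integrable F volume) :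
    HasSum (fun l : ℤ => ∫ x, F (rep l x) ∂AddCircle.haarAddCircle) (∫ y, F y) := by
  simp_rw [integral_comp_rep]
  have h := hasSum_integral_iUnion (μ := volume) (f := F)
    (s := fun l : ℤ => Set.Ico ((l : ℝ) - 1 / 2) (l + 1 / 2))
    (fun _ => measurableSet_Ico) pairwise_disjoint_Ico_half
    (by rw [iUnion_Ico_half]; exact hF.integrableOn)
  rwa [iUnion_Ico_half, setIntegral_univ] at h

theorem memLp_comp_rep {F : ℝ → ℂ} (hF : MemLp F 2 volume) (l : ℤ) :
    MemLp (fun x => F (rep l x)) 2 (AddCircle.haarAddCircle : Measure UnitAddCircle) :=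
  (hF.restrict _).comp_measurePreserving (measurePreserving_rep l)

/-! ### Classes of square integrable functions -/

section toL2

variable {α : Type*} [MeasurableSpace α] {μ : Measure α}

theorem toL2_eq {g : α → ℂ} (h : MemLp g 2 μ) : toL2 μ g = h.toLp g := by
  simp [toL2, h]

theorem coeFn_toL2 {g : α → ℂ} (h : MemLp g 2 μ) : toL2 μ g =ᵐ[μ] g := by
  rw [toL2_eq h]; exact h.coeFn_toLp

theorem toL2_coeFn (f : Lp ℂ 2 μ) : toL2 μ f = f := by
  rw [toL2_eq (Lp.memLp f)]; exact Lp.toLp_coeFn f _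

theorem toL2_congr {g h : α → ℂ} (e : g =ᵐ[μ] h) : toL2 μ g = toL2 μ h := by
  by_cases hg : MemLp g 2 μ
  · rw [toL2_eq hg, toL2_eq (hg.ae_eq e)]
    exact MemLp.toLp_congr _ _ e
  · have hh : ¬ MemLp h 2 μ := fun H => hg (H.ae_eq e.symm)
    simp [toL2, hg, hh]

theorem toL2_add {g h : α → ℂ} (hg : MemLp g 2 μ) (hh : MemLp h 2 μ) :
    toL2 μ (fun x => g x + h x) = toL2 μ g + toL2 μ h := by
  rw [toL2_eq hg, toL2_eq hh]; exact toL2_eq (hg.add hh)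

theorem toL2_sub {g h : α → ℂ} (hg : MemLp g 2 μ) (hh : MemLp h 2 μ) :
    toL2 μ (fun x => g x - h x) = toL2 μ g - toL2 μ h := by
  rw [toL2_eq hg, toL2_eq hh]; exact toL2_eq (hg.sub hh)

theorem toL2_smul {g : α → ℂ} (hg : MemLp g 2 μ) (c : ℂ) :
    toL2 μ (fun x => c * g x) = c • toL2 μ g := by
  rw [toL2_eq hg, toL2_eq (hg.const_mul c)]; rfl

theorem toL2_zero : toL2 μ (fun _ => 0) = 0 := by
  exact toL2_eq MemLp.zero

theorem memLp_sum_smul {ι : Type*} (s : Finset ι) {g : ι → α → ℂ}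
    (hg : ∀ i ∈ s, MemLp (g i) 2 μ) (c : ι → ℂ) :
    MemLp (fun x => ∑ i ∈ s, c i * g i x) 2 μ :=
  memLp_finsetSum s fun i hi => (hg i hi).const_mul (c i)

theorem toL2_sum {ι : Type*} (s : Finset ι) {g : ι → α → ℂ}
    (hg : ∀ i ∈ s, MemLp (g i) 2 μ) :
    toL2 μ (fun x => ∑ i ∈ s, g i x) = ∑ i ∈ s, toL2 μ (g i) := by
  classical
  induction s using Finset.induction_on with
  | empty => simpa using toL2_zero
  | insert a s ha ih =>
    simp only [Finset.sum_insert ha]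
    rw [toL2_add (hg a (Finset.mem_insert_self _ _))
      (memLp_finsetSum s fun i hi => hg i (Finset.mem_insert_of_mem hi)),
      ih fun i hi => hg i (Finset.mem_insert_of_mem hi)]

theorem toL2_sum_smul {ι : Type*} (s : Finset ι) {g : ι → α → ℂ}
    (hg : ∀ i ∈ s, MemLp (g i) 2 μ) (c : ι → ℂ) :
    toL2 μ (fun x => ∑ i ∈ s, c i * g i x) = ∑ i ∈ s, c i • toL2 μ (g i) := by
  rw [toL2_sum s fun i hi => (hg i hi).const_mul (c i)]
  exact Finset.sum_congr rfl fun i hi => toL2_smul (hg i hi) (c i)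

theorem inner_toL2 {g : α → ℂ} (hg : MemLp g 2 μ) (f : Lp ℂ 2 μ) :
    inner ℂ (toL2 μ g) f = ∫ x, (starRingEnd ℂ) (g x) * f x ∂μ := by
  rw [L2.inner_def]
  refine integral_congr_ae ?_
  filter_upwards [coeFn_toL2 hg] with x hx
  rw [hx, RCLike.inner_apply, mul_comm]

theorem inner_toL2_toL2 {g h : α → ℂ} (hg : MemLp g 2 μ) (hh : MemLp h 2 μ) :
    inner ℂ (toL2 μ g) (toL2 μ h) = ∫ x, (starRingEnd ℂ) (g x) * h x ∂μ := by
  rw [inner_toL2 hg]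
  refine integral_congr_ae ?_
  filter_upwards [coeFn_toL2 hh] with x hx
  rw [hx]

theorem norm_sq_eq_integral (f : Lp ℂ 2 μ) : ‖f‖ ^ 2 = ∫ x, ‖f x‖ ^ 2 ∂μ := by
  rw [← inner_self_eq_norm_sq (𝕜 := ℂ), L2.inner_def, ← integral_re (L2.integrable_inner f f)]
  simp only [inner_self_eq_norm_sq]

theorem norm_sq_toL2 {g : α → ℂ} (hg : MemLp g 2 μ) :
    ‖toL2 μ g‖ ^ 2 = ∫ x, ‖g x‖ ^ 2 ∂μ := by
  rw [norm_sq_eq_integral]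
  refine integral_congr_ae ?_
  filter_upwards [coeFn_toL2 hg] with x hx
  rw [hx]

theorem integrable_norm_sq {g : α → ℂ} (hg : MemLp g 2 μ) :
    Integrable (fun x => ‖g x‖ ^ 2) μ :=
  (memLp_two_iff_integrable_sq_norm hg.1).1 hg

end toL2

/-! ### Riesz sequences -/

section Riesz

variable {E ι : Type*} [NormedAddCommGroup E] [InnerProductSpace ℂ E]

/-- The upper Riesz bound implies Bessel's inequality. -/
theorem bessel_of_upper_bound {s : Finset ι} {v : ι → E} {δ : ℝ} (hδ : 0 ≤ δ)
    (h : ∀ c : ι → ℂ, ‖∑ i ∈ s, c i • v i‖ ^ 2 ≤ δ * ∑ i ∈ s, ‖c i‖ ^ 2) (f : E) :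
    ∑ i ∈ s, ‖inner ℂ (v i) f‖ ^ 2 ≤ δ * ‖f‖ ^ 2 := by
  -- Testing the upper bound with the coefficients of `f` itself gives `A ≤ ‖∑ c i • v i‖ ‖f‖`,
  -- hence `A² ≤ δ A ‖f‖²`.
  set c : ι → ℂ := fun i => inner ℂ (v i) f
  have hc := h c
  set A := ∑ i ∈ s, ‖c i‖ ^ 2 with hA
  have hA0 : 0 ≤ A := Finset.sum_nonneg fun _ _ => by positivity
  have h1 : inner ℂ (∑ i ∈ s, c i • v i) f = (A : ℂ) := by
    rw [sum_inner, hA]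
    push_cast
    refine Finset.sum_congr rfl fun i _ => ?_
    rw [inner_smul_left, ← Complex.conj_mul']
  have h2 : A ≤ ‖∑ i ∈ s, c i • v i‖ * ‖f‖ := by
    have := norm_inner_le_norm (𝕜 := ℂ) (∑ i ∈ s, c i • v i) f
    rwa [h1, Complex.norm_real, Real.norm_of_nonneg hA0] at this
  rcases hA0.eq_or_lt with h0 | h0
  · rw [← h0]; positivity
  · have h4 : A ^ 2 ≤ (δ * A) * ‖f‖ ^ 2 := by
      calc A ^ 2 ≤ (‖∑ i ∈ s, c i • v i‖ * ‖f‖) ^ 2 := by gcongr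
        _ = ‖∑ i ∈ s, c i • v i‖ ^ 2 * ‖f‖ ^ 2 := by ring
        _ ≤ _ := by gcongr
    refine le_of_mul_le_mul_right ?_ h0
    linarith

end Riesz

end HypWavelet

namespace HypWavelet

/-! ### Periodization of compactly supported functions -/

section Periodize

variable {g : ℝ → ℝ} {M : ℕ}

theorem apply_rep_eq_zero (hg : ∀ x, g x ≠ 0 → |x| ≤ M) {l : ℤ}
    (hl : l ∉ Finset.Icc (-(M + 1 : ℤ)) (M + 1)) (x : UnitAddCircle) : g (rep l x) = 0 := by
  by_contra h
  have h1 := abs_le.1 (hg _ h)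
  have h2 := rep_mem l x
  apply hl
  rw [Finset.mem_Icc]
  constructor
  · have h3 : (-(M + 1 : ℤ) : ℝ) ≤ (l : ℝ) := by push_cast; linarith [h1.1, h2.2]
    exact_mod_cast h3
  · have h3 : (l : ℝ) ≤ ((M + 1 : ℤ) : ℝ) := by push_cast; linarith [h1.2, h2.1]
    exact_mod_cast h3

theorem periodize_eq_sum (hg : ∀ x, g x ≠ 0 → |x| ≤ M) (x : UnitAddCircle) :
    periodize g x = ∑ l ∈ Finset.Icc (-(M + 1 : ℤ)) (M + 1), g (rep l x) :=
  tsum_eq_sum fun _ hl => apply_rep_eq_zero hg hl x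

theorem periodize_coe (y : ℝ) : periodize g (y : UnitAddCircle) = ∑' b : ℤ, g (y + b) := by
  have hy : y ∈ ⋃ l : ℤ, Set.Ico ((l : ℝ) - 1 / 2) (l + 1 / 2) := by
    rw [iUnion_Ico_half]; trivial
  obtain ⟨l, hl⟩ := Set.mem_iUnion.1 hy
  rw [periodize_eq_tsum_rep, ← (Equiv.addRight l).tsum_eq]
  refine tsum_congr fun b => ?_
  rw [show Equiv.addRight l b = l + b from add_comm b l, rep_add, rep_coe hl]

theorem memLp_periodize (hg : ∀ x, g x ≠ 0 → |x| ≤ M)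
    (h2 : MemLp (fun x => (g x : ℂ)) 2 volume) :
    MemLp (fun x => (periodize g x : ℂ)) 2 (AddCircle.haarAddCircle : Measure UnitAddCircle) := by
  simp_rw [periodize_eq_sum hg, Complex.ofReal_sum]
  exact memLp_finsetSum _ fun l _ => memLp_comp_rep h2 l

/-- The periodic extension of `h` is only locally square integrable on the line; it suffices that
finitely many unit cells meet the support of `g`. -/
theorem integrable_mul_coe (hg : ∀ x, g x ≠ 0 → |x| ≤ M)
    (h2 : MemLp (fun x => (g x : ℂ)) 2 volume) (h : L2T) :
    Integrable (fun y : ℝ => (g y : ℂ) * h (y : UnitAddCircle)) volume := by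
  have h3 : ∀ l : ℤ, IntegrableOn (fun y : ℝ => (g y : ℂ) * h (y : UnitAddCircle))
      (Set.Ico ((l : ℝ) - 1 / 2) (l + 1 / 2)) volume := fun l =>
    MemLp.integrable_mul (p := 2) (q := 2) (h2.restrict _)
      ((Lp.memLp h).comp_measurePreserving (measurePreserving_coe l))
  have h4 : IntegrableOn (fun y : ℝ => (g y : ℂ) * h (y : UnitAddCircle))
      (⋃ l ∈ Finset.Icc (-(M + 1 : ℤ)) (M + 1), Set.Ico ((l : ℝ) - 1 / 2) (l + 1 / 2)) volume :=
    integrableOn_finset_iUnion.2 fun l _ => h3 l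
  refine (integrableOn_iff_integrable_of_support_subset fun y hy => ?_).1 h4
  have hy' : y ∈ ⋃ l : ℤ, Set.Ico ((l : ℝ) - 1 / 2) (l + 1 / 2) := by
    rw [iUnion_Ico_half]; trivial
  obtain ⟨l, hl⟩ := Set.mem_iUnion.1 hy'
  simp only [Set.mem_iUnion]
  refine ⟨l, ?_, hl⟩
  by_contra hl'
  apply hy
  have := apply_rep_eq_zero hg hl' (y : UnitAddCircle)
  rw [rep_coe hl] at this
  simp [this]

/-- Unfolding: the inner product with a periodization is an integral over the line. -/
theorem inner_periodize (hg : ∀ x, g x ≠ 0 → |x| ≤ M)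
    (h2 : MemLp (fun x => (g x : ℂ)) 2 volume) (h : L2T) :
    inner ℂ (toL2 AddCircle.haarAddCircle fun x => (periodize g x : ℂ)) h =
      ∫ y : ℝ, (g y : ℂ) * h (y : UnitAddCircle) := by
  rw [inner_toL2 (memLp_periodize hg h2),
    ← (hasSum_integral_rep (integrable_mul_coe hg h2 h)).tsum_eq]
  simp_rw [coe_rep]
  rw [tsum_eq_sum (s := Finset.Icc (-(M + 1 : ℤ)) (M + 1)), ← integral_finsetSum]
  · refine integral_congr_ae (Filter.Eventually.of_forall fun x => ?_)
    simp only [Complex.conj_ofReal]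
    rw [periodize_eq_sum hg, Complex.ofReal_sum, Finset.sum_mul]
  · intro l _
    have := integrable_comp_rep (integrable_mul_coe hg h2 h) l
    simpa only [coe_rep] using this
  · intro l hl
    simp [apply_rep_eq_zero hg hl]

end Periodize

/-! ### Wavelets on the line -/

theorem memLp_comp_affine {f : ℝ → ℂ} (hf : MemLp f 2 volume) {a : ℝ} (ha : a ≠ 0) (b : ℝ) :
    MemLp (fun x => f (a * x - b)) 2 volume := by
  have h1 : MemLp (fun x => f (x - b)) 2 volume :=
    hf.comp_measurePreserving (measurePreserving_sub_right volume b)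
  have h2 : AEStronglyMeasurable (fun x => f (a * x - b)) volume := by
    have h3 : AEStronglyMeasurable (fun x => f (x - b)) (Measure.map (a * ·) volume) := by
      rw [Real.map_volume_mul_left ha]
      exact h1.1.mono_ac Measure.smul_absolutelyContinuous
    exact h3.comp_measurable (measurable_const_mul a)
  rw [memLp_two_iff_integrable_sq_norm h2]
  have h4 := (memLp_two_iff_integrable_sq_norm h1.1).1 h1
  exact h4.comp_mul_left' ha

variable {φ ψ : ℝ → ℝ}

theorem waveletLine_nat (φ ψ : ℝ → ℝ) (j : ℕ) (k : ℤ) (x : ℝ) :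
    waveletLine φ ψ j k x = (2 : ℝ) ^ ((j : ℝ) / 2) * ψ ((2 : ℝ) ^ j * x - k) := by
  have h : (j : ℤ) ≠ -1 := by omega
  simp [waveletLine, h]

theorem two_rpow_half_sq (j : ℕ) : ((2 : ℝ) ^ ((j : ℝ) / 2)) ^ 2 = 2 ^ j := by
  rw [← Real.rpow_natCast, ← Real.rpow_mul (by norm_num)]
  rw [show (j : ℝ) / 2 * ((2 : ℕ) : ℝ) = j by push_cast; ring, Real.rpow_natCast]

theorem memLp_waveletLine (hψ : MemLp ψ 2 volume) (j : ℕ) (k : ℤ) :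
    MemLp (fun x => (waveletLine φ ψ j k x : ℂ)) 2 volume := by
  simp_rw [waveletLine_nat, Complex.ofReal_mul]
  exact (memLp_comp_affine hψ.ofReal (by positivity) _).const_mul _

theorem exists_nat_support (h : HasCompactSupp ψ) :
    ∃ S : ℕ, ∀ x, ψ x ≠ 0 → 0 ≤ x ∧ x ≤ S := by
  obtain ⟨S, hS⟩ := h
  obtain ⟨n, hn⟩ := exists_nat_ge S
  exact ⟨n, fun x hx => ⟨(hS hx).1, (hS hx).2.trans hn⟩⟩

theorem waveletLine_support {S : ℕ} (hS : ∀ x, ψ x ≠ 0 → 0 ≤ x ∧ x ≤ S) {j : ℕ} {k : ℤ} {x : ℝ}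
    (hx : waveletLine φ ψ j k x ≠ 0) : (k : ℝ) ≤ 2 ^ j * x ∧ 2 ^ j * x ≤ k + S := by
  rw [waveletLine_nat] at hx
  have := hS _ (right_ne_zero_of_mul hx)
  constructor <;> linarith [this.1, this.2]

theorem waveletLine_abs_le {S : ℕ} (hS : ∀ x, ψ x ≠ 0 → 0 ≤ x ∧ x ≤ S) {j : ℕ} {k : ℤ} (x : ℝ)
    (hx : waveletLine φ ψ j k x ≠ 0) : |x| ≤ (k.natAbs + S : ℕ) := by
  obtain ⟨h1, h2⟩ := waveletLine_support hS hx
  have h3 : (1 : ℝ) ≤ 2 ^ j := one_le_pow₀ (by norm_num)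
  have h4 : |2 ^ j * x| ≤ (k.natAbs + S : ℕ) := by
    push_cast [Nat.cast_natAbs]
    rw [abs_le]
    constructor
    · linarith [neg_abs_le (k : ℝ), Nat.cast_nonneg (α := ℝ) S]
    · linarith [le_abs_self (k : ℝ)]
  rw [abs_mul, abs_of_nonneg (by positivity : (0 : ℝ) ≤ 2 ^ j)] at h4
  nlinarith [abs_nonneg x]

theorem waveletLine_add_int (j : ℕ) (k b : ℤ) (x : ℝ) :
    waveletLine φ ψ j k (x + b) = waveletLine φ ψ j (k - 2 ^ j * b) x := by
  simp only [waveletLine_nat]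
  congr 2
  push_cast
  ring

theorem periodize_waveletLine_shift (j : ℕ) (k a : ℤ) :
    periodize (waveletLine φ ψ j (k + 2 ^ j * a)) = periodize (waveletLine φ ψ j k) := by
  funext x
  rw [periodize_eq_tsum_rep, periodize_eq_tsum_rep, ← (Equiv.addRight a).tsum_eq]
  refine tsum_congr fun l => ?_
  rw [Equiv.coe_addRight, rep_add, waveletLine_add_int]
  congr 1
  ring

theorem waveletPer_shift (j : ℕ) (k a : ℤ) :
    waveletPer φ ψ j (k + 2 ^ j * a) = waveletPer φ ψ j k := by
  simp only [waveletPer, periodize_waveletLine_shift]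

theorem exists_shift (j : ℕ) (k : ℤ) : ∃ k' ∈ shifts j, waveletPer φ ψ j k = waveletPer φ ψ j k' := by
  refine ⟨k % 2 ^ j, ?_, ?_⟩
  · simp only [shifts, Nat.cast_nonneg, if_true, Int.toNat_natCast, Finset.mem_Ico]
    exact ⟨Int.emod_nonneg _ (by positivity), Int.emod_lt_of_pos _ (by positivity)⟩
  · conv_lhs => rw [← Int.emod_add_mul_ediv k (2 ^ j)]
    exact waveletPer_shift _ _ _

theorem memLp_periodize_waveletLine {S : ℕ} (hψ : MemLp ψ 2 volume)
    (hS : ∀ x, ψ x ≠ 0 → 0 ≤ x ∧ x ≤ S) (j : ℕ) (k : ℤ) :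
    MemLp (fun x => (periodize (waveletLine φ ψ j k) x : ℂ)) 2
      (AddCircle.haarAddCircle : Measure UnitAddCircle) :=
  memLp_periodize (waveletLine_abs_le hS) (memLp_waveletLine hψ j k)

theorem inner_waveletPer {S : ℕ} (hψ : MemLp ψ 2 volume)
    (hS : ∀ x, ψ x ≠ 0 → 0 ≤ x ∧ x ≤ S) (j : ℕ) (k : ℤ) (h : L2T) :
    inner ℂ (waveletPer φ ψ j k) h =
      ∫ y : ℝ, (waveletLine φ ψ j k y : ℂ) * h (y : UnitAddCircle) :=
  inner_periodize (waveletLine_abs_le hS) (memLp_waveletLine hψ j k) h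

/-- A null set of the torus lifts to a null set in each of the countably many cells, so the class
`h` may be replaced by an explicit function such as a character or a periodization. -/
theorem integral_waveletLine_mul_of_ae {S : ℕ} (hψ : MemLp ψ 2 volume)
    (hS : ∀ x, ψ x ≠ 0 → 0 ≤ x ∧ x ≤ S) (j : ℕ) (k : ℤ) {h : L2T} {h' : UnitAddCircle → ℂ}
    (e : h =ᵐ[AddCircle.haarAddCircle] h') :
    inner ℂ (waveletPer φ ψ j k) h =
      ∫ y : ℝ, (waveletLine φ ψ j k y : ℂ) * h' (y : UnitAddCircle) := by
  rw [inner_waveletPer hψ hS]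
  refine integral_congr_ae ?_
  have h1 : ∀ᵐ y : ℝ ∂(volume.restrict
      (⋃ l : ℤ, Set.Ico ((l : ℝ) - 1 / 2) (l + 1 / 2))), h (y : UnitAddCircle) = h' y := by
    rw [ae_restrict_iUnion_iff]
    exact fun l => (measurePreserving_coe l).quasiMeasurePreserving.ae e
  rw [iUnion_Ico_half, Measure.restrict_univ] at h1
  filter_upwards [h1] with y hy
  rw [hy]

/-- Only one factor has to be unfolded to the line; the periodization of the other becomes a sum
over integer translates, and these are wavelets of the same level with shift `l - 2 ^ i * b`. This
carries orthogonality between levels from the line to the torus. -/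
theorem inner_waveletPer_waveletPer {S : ℕ} (hψ : MemLp ψ 2 volume)
    (hS : ∀ x, ψ x ≠ 0 → 0 ≤ x ∧ x ≤ S) (j i : ℕ) (k l : ℤ) :
    ∃ B : Finset ℤ, inner ℂ (waveletPer φ ψ j k) (waveletPer φ ψ i l) =
      ∑ b ∈ B, inner ℂ (toL2 volume fun x : ℝ => (waveletLine φ ψ j k x : ℂ))
        (toL2 volume fun x : ℝ => (waveletLine φ ψ i (l - 2 ^ i * b) x : ℂ)) := by
  -- The two supports lie in balls of radius `k.natAbs + S` and `l.natAbs + S`, so translates by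
  -- more than the sum of the radii do not meet.
  set N : ℕ := (k.natAbs + S) + (l.natAbs + S)
  refine ⟨Finset.Icc (-(N : ℤ)) N, ?_⟩
  rw [integral_waveletLine_mul_of_ae hψ hS j k (h := waveletPer φ ψ i l)
    (coeFn_toL2 (memLp_periodize_waveletLine (φ := φ) hψ hS i l))]
  simp_rw [inner_toL2_toL2 (memLp_waveletLine hψ j k) (memLp_waveletLine hψ i _)]
  rw [← integral_finsetSum]
  · refine integral_congr_ae (Filter.Eventually.of_forall fun y => ?_)
    simp only [Complex.conj_ofReal]
    rw [← Finset.mul_sum]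
    by_cases hy : waveletLine φ ψ j k y = 0
    · simp [hy]
    rw [periodize_coe, tsum_eq_sum (s := Finset.Icc (-(N : ℤ)) N)]
    · push_cast
      simp_rw [waveletLine_add_int]
    · intro b hb
      by_contra hb'
      apply hb
      have h1 := abs_le.1 (waveletLine_abs_le hS _ hy)
      have h2 := abs_le.1 (waveletLine_abs_le hS _ hb')
      rw [Finset.mem_Icc]
      simp only [Nat.cast_add, Nat.cast_natAbs, Int.cast_abs] at h1 h2
      constructor
      · have : ((-N : ℤ) : ℝ) ≤ b := by simp only [N]; push_cast; linarith [h1.2, h2.1]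
        exact_mod_cast this
      · have : (b : ℝ) ≤ ((N : ℤ) : ℝ) := by simp only [N]; push_cast; linarith [h1.1, h2.2]
        exact_mod_cast this
  · intro b _
    exact MemLp.integrable_mul (p := 2) (q := 2) (memLp_waveletLine hψ j k).star
      (memLp_waveletLine hψ i _)

/-! ### Orthogonality between different levels -/

theorem waveletLine_mem (h : IsWavelet φ ψ) (j : ℕ) (k : ℤ) :
    (toL2 volume fun x : ℝ => (waveletLine φ ψ j k x : ℂ)) ∈ waveletSpace φ j := by
  rw [h.generates]
  exact Submodule.le_topologicalClosure _ (Submodule.subset_span ⟨k, rfl⟩)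

theorem scalingSpace_mono (h : IsWavelet φ ψ) : Monotone (scalingSpace φ) :=
  monotone_int_of_le_succ h.nested

theorem waveletSpace_orthogonal (h : IsWavelet φ ψ) {i j : ℤ} (hij : i < j) {x y : L2R}
    (hx : x ∈ waveletSpace φ i) (hy : y ∈ waveletSpace φ j) : inner ℂ x y = 0 :=
  hy.1 x (scalingSpace_mono h (by omega : i + 1 ≤ j) hx.2)

theorem inner_waveletLine_of_ne (h : IsWavelet φ ψ) {i j : ℕ} (hij : i ≠ j) (k l : ℤ) :
    inner ℂ (toL2 volume fun x : ℝ => (waveletLine φ ψ i k x : ℂ))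
      (toL2 volume fun x : ℝ => (waveletLine φ ψ j l x : ℂ)) = 0 := by
  rcases lt_or_gt_of_ne hij with hlt | hlt
  · exact waveletSpace_orthogonal h (by exact_mod_cast hlt) (waveletLine_mem h i k)
      (waveletLine_mem h j l)
  · rw [← inner_conj_symm, waveletSpace_orthogonal h (by exact_mod_cast hlt)
      (waveletLine_mem h j l) (waveletLine_mem h i k), map_zero]

theorem inner_waveletPer_of_ne (h : IsWavelet φ ψ) (hsupp : HasCompactSupp ψ) {i j : ℕ}
    (hij : i ≠ j) (k l : ℤ) :
    inner ℂ (waveletPer φ ψ i k) (waveletPer φ ψ j l) = 0 := by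
  obtain ⟨S, hS⟩ := exists_nat_support hsupp
  obtain ⟨B, hB⟩ := inner_waveletPer_waveletPer (φ := φ) h.memLp_wavelet hS i j k l
  rw [hB]
  exact Finset.sum_eq_zero fun b _ => inner_waveletLine_of_ne h hij _ _

theorem waveletPer_neg_one (h : IsWavelet φ ψ) :
    waveletPer φ ψ (-1) 0 = toL2 AddCircle.haarAddCircle fun _ => 1 := by
  refine toL2_congr ?_
  have h1 := (measurePreserving_rep 0).quasiMeasurePreserving.ae
    (ae_restrict_of_ae h.periodization)
  filter_upwards [h1] with x hx
  have : periodize (waveletLine φ ψ (-1) 0) x = 1 := by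
    rw [periodize_eq_tsum_rep, ← hx.tsum_eq]
    refine tsum_congr fun l => ?_
    rw [← zero_add l, rep_add]
    simp [waveletLine]
  rw [this]; simp

theorem waveletPer_neg_one_fourier (h : IsWavelet φ ψ) :
    waveletPer φ ψ (-1) 0 = fourierLp 2 0 := by
  rw [waveletPer_neg_one h, ← toL2_coeFn (fourierLp 2 0)]
  refine toL2_congr ?_
  filter_upwards [coeFn_fourierLp (T := 1) 2 0] with x hx
  rw [hx]; simp

theorem integral_waveletLine (j : ℕ) (k : ℤ) (h0 : ∫ x, ψ x = 0) :
    ∫ x, (waveletLine φ ψ j k x : ℂ) = 0 := by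
  rw [integral_complex_ofReal]
  simp_rw [waveletLine_nat]
  rw [integral_const_mul, Measure.integral_comp_mul_left (fun x => ψ (x - k)),
    integral_sub_right_eq_self, h0]
  simp

theorem inner_waveletPer_neg_one (h : IsWavelet φ ψ) (hsupp : HasCompactSupp ψ)
    (h0 : ∫ x, ψ x = 0) (j : ℕ) (k : ℤ) :
    inner ℂ (waveletPer φ ψ j k) (waveletPer φ ψ (-1) 0) = 0 := by
  obtain ⟨S, hS⟩ := exists_nat_support hsupp
  rw [waveletPer_neg_one h, integral_waveletLine_mul_of_ae h.memLp_wavelet hS j k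
    (coeFn_toL2 (memLp_const 1))]
  simpa using integral_waveletLine j k h0

end HypWavelet

namespace HypWavelet

/-! ### Discrete Fourier transform -/

theorem sum_Ico_zero_int {E : Type*} [AddCommMonoid E] (q : ℕ) (f : ℤ → E) :
    ∑ k ∈ Finset.Ico (0 : ℤ) q, f k = ∑ k ∈ Finset.range q, f k := by
  refine Finset.sum_nbij' Int.toNat (fun k => (k : ℤ)) ?_ ?_ ?_ ?_ ?_
  · intro k hk; simp only [Finset.mem_Ico, Finset.mem_range] at hk ⊢; omega
  · intro k hk; simp only [Finset.mem_Ico, Finset.mem_range] at hk ⊢; omega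
  · intro k hk; simp only [Finset.mem_Ico] at hk; omega
  · intro k _; simp
  · intro k hk
    simp only [Finset.mem_Ico] at hk
    rw [Int.toNat_of_nonneg hk.1]

theorem sum_fourier_div (q : ℕ) (hq : 0 < q) (m : ℤ) (hm : ¬ (q : ℤ) ∣ m) :
    ∑ k ∈ Finset.Ico (0 : ℤ) q, fourier m (((k : ℝ) / q : ℝ) : UnitAddCircle) = 0 := by
  rw [sum_Ico_zero_int]
  set w : ℂ := Complex.exp (2 * Real.pi * Complex.I * m / q) with hw
  have hq' : (q : ℂ) ≠ 0 := by exact_mod_cast hq.ne'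
  have h1 : ∀ k : ℕ, fourier m ((((k : ℤ) : ℝ) / q : ℝ) : UnitAddCircle) = w ^ k := by
    intro k
    rw [fourier_coe_apply, hw, ← Complex.exp_nat_mul]
    congr 1
    push_cast
    field_simp
  simp_rw [h1]
  have h2 : w ^ q = 1 := by
    rw [hw, ← Complex.exp_nat_mul, Complex.exp_eq_one_iff]
    exact ⟨m, by field_simp⟩
  have h3 : w ≠ 1 := by
    intro h
    rw [hw, Complex.exp_eq_one_iff] at h
    obtain ⟨n, hn⟩ := h
    apply hm
    refine ⟨n, ?_⟩
    have hpi := Complex.two_pi_I_ne_zero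
    have h4 : (m : ℂ) = q * n := by
      field_simp at hn
      linear_combination hn
    exact_mod_cast h4
  have h4 := geom_sum_mul w q
  rw [h2, sub_self] at h4
  exact (mul_eq_zero.1 h4).resolve_right (sub_ne_zero.2 h3)

/-- Parseval's identity for the discrete Fourier transform. -/
theorem sum_norm_sq_dft {E : Type*} [NormedAddCommGroup E] [InnerProductSpace ℂ E] (q : ℕ)
    (hq : 0 < q) (K : Finset ℤ) (hK : ∀ n ∈ K, ∀ n' ∈ K, (q : ℤ) ∣ n' - n → n = n') (d : ℤ → E) :
    ∑ k ∈ Finset.Ico (0 : ℤ) q,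
      ‖∑ n ∈ K, fourier n (((k : ℝ) / q : ℝ) : UnitAddCircle) • d n‖ ^ 2 =
      q * ∑ n ∈ K, ‖d n‖ ^ 2 := by
  have key : (∑ k ∈ Finset.Ico (0 : ℤ) q,
      inner ℂ (∑ n ∈ K, fourier n (((k : ℝ) / q : ℝ) : UnitAddCircle) • d n)
        (∑ n ∈ K, fourier n (((k : ℝ) / q : ℝ) : UnitAddCircle) • d n)) =
      (q : ℂ) * ∑ n ∈ K, inner ℂ (d n) (d n) := by
    simp_rw [sum_inner, inner_sum, inner_smul_left, inner_smul_right, ← fourier_neg]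
    rw [Finset.sum_comm, Finset.mul_sum]
    refine Finset.sum_congr rfl fun n hn => ?_
    rw [Finset.sum_comm, Finset.sum_eq_single n]
    · have : ∀ k : ℤ, fourier (-n) (((k : ℝ) / q : ℝ) : UnitAddCircle) *
          (fourier n (((k : ℝ) / q : ℝ) : UnitAddCircle) * inner ℂ (d n) (d n)) =
          inner ℂ (d n) (d n) := by
        intro k
        rw [← mul_assoc, ← fourier_add, neg_add_cancel, fourier_zero, one_mul]
      simp_rw [this]
      simp
    · intro n' hn' hne
      have : ∀ k : ℤ, fourier (-n) (((k : ℝ) / q : ℝ) : UnitAddCircle) *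
          (fourier n' (((k : ℝ) / q : ℝ) : UnitAddCircle) * inner ℂ (d n) (d n')) =
          fourier (n' - n) (((k : ℝ) / q : ℝ) : UnitAddCircle) * inner ℂ (d n) (d n') := by
        intro k
        rw [← mul_assoc, ← fourier_add, neg_add_eq_sub]
      simp_rw [this]
      rw [← Finset.sum_mul, sum_fourier_div q hq _ fun h => hne (hK n hn n' hn' h).symm, zero_mul]
    · intro h; exact absurd hn h
  have hsq : ∀ x : E, inner ℂ x x = ((‖x‖ ^ 2 : ℝ) : ℂ) := by
    intro x
    rw [inner_self_eq_norm_sq_to_K]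
    norm_cast
  simp only [hsq, ← Complex.ofReal_sum, ← Complex.ofReal_natCast, ← Complex.ofReal_mul] at key
  exact Complex.ofReal_injective key

/-! ### Fourier coefficients of wavelets -/

variable {φ ψ : ℝ → ℝ}

/-- The Fourier transform of `ψ`. -/
noncomputable def waveletFourier (ψ : ℝ → ℝ) (ξ : ℝ) : ℂ :=
  ∫ y : ℝ, (ψ y : ℂ) * Complex.exp (2 * Real.pi * Complex.I * ξ * y)

/-- Unfolding and the substitution `y ↦ 2 ^ j * y - k` leave `k` only in the character at `k / 2 ^
j`. For fixed `j` the coefficients of a trigonometric polynomial are thus a discrete Fourier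
transform in `k`. The factor `2^{-j/2}` is the Jacobian `2^{-j}` times the normalization `2^{j/2}`.
-/
theorem inner_waveletPer_fourier {S : ℕ} (hψ : MemLp ψ 2 volume)
    (hS : ∀ x, ψ x ≠ 0 → 0 ≤ x ∧ x ≤ S) (j : ℕ) (k n : ℤ) :
    inner ℂ (waveletPer φ ψ j k) (fourierLp 2 n) =
      fourier n (((k : ℝ) / (2 ^ j : ℕ) : ℝ) : UnitAddCircle) *
        ((((2 : ℝ) ^ ((j : ℝ) / 2))⁻¹ : ℝ) * waveletFourier ψ (n / 2 ^ j)) := by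
  rw [integral_waveletLine_mul_of_ae hψ hS j k (coeFn_fourierLp 2 n)]
  set F : ℝ → ℂ := fun y => ((2 : ℝ) ^ ((j : ℝ) / 2) : ℝ) * ((ψ y : ℂ) *
    fourier n (((y + k) / 2 ^ j : ℝ) : UnitAddCircle)) with hF
  have h1 : ∀ y : ℝ, (waveletLine φ ψ j k y : ℂ) * fourier n (y : UnitAddCircle) =
      F (2 ^ j * y - k) := by
    intro y
    have : (2 ^ j * y - k + k) / 2 ^ j = y := by field_simp; ring
    simp only [hF, waveletLine_nat, this]
    push_cast
    ring
  simp_rw [h1]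
  rw [Measure.integral_comp_mul_left (fun x => F (x - k)), integral_sub_right_eq_self, hF,
    integral_const_mul, waveletFourier, ← integral_const_mul, ← integral_const_mul,
    ← integral_const_mul, ← integral_smul]
  refine integral_congr_ae (Filter.Eventually.of_forall fun y => ?_)
  simp only [fourier_coe_apply, Complex.real_smul]
  have h2 : Complex.exp (2 * Real.pi * Complex.I * n * ((y + k) / 2 ^ j : ℝ) / (1 : ℝ)) =
      Complex.exp (2 * Real.pi * Complex.I * n * (k / (2 ^ j : ℕ) : ℝ) / (1 : ℝ)) *
        Complex.exp (2 * Real.pi * Complex.I * (n / 2 ^ j : ℝ) * y) := by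
    rw [← Complex.exp_add]
    congr 1
    push_cast
    ring
  rw [h2]
  have h3 : (|((2 : ℝ) ^ j)⁻¹| : ℝ) * ((2 : ℝ) ^ ((j : ℝ) / 2)) =
      ((2 : ℝ) ^ ((j : ℝ) / 2))⁻¹ := by
    rw [abs_of_pos (by positivity), ← two_rpow_half_sq]
    field_simp
  rw [← h3]
  push_cast
  ring

theorem integrable_wavelet {S : ℕ} (hψ : MemLp ψ 2 volume)
    (hS : ∀ x, ψ x ≠ 0 → 0 ≤ x ∧ x ≤ S) : Integrable ψ volume := by
  have h1 : IntegrableOn ψ (Set.Icc 0 S) volume :=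
    (hψ.restrict (Set.Icc (0 : ℝ) S)).integrable (by norm_num)
  exact (integrableOn_iff_integrable_of_support_subset fun x hx => hS x hx).1 h1

/-- The moments annihilate the Taylor polynomial of the exponential of degree below `m`; on the
bounded support of `ψ` the remainder is of order `|ξ| ^ m`. The restriction `|ξ| ≤ 1` keeps the
exponential factor of the remainder bounded. -/
theorem norm_waveletFourier_le {S m : ℕ} (hψ : MemLp ψ 2 volume)
    (hS : ∀ x, ψ x ≠ 0 → 0 ≤ x ∧ x ≤ S) (hmom : HasVanishingMoments ψ m) :
    ∃ C : ℝ, 0 ≤ C ∧ ∀ ξ : ℝ, |ξ| ≤ 1 → ‖waveletFourier ψ ξ‖ ≤ C * |ξ| ^ m := by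
  have hint := integrable_wavelet hψ hS
  set B : ℝ := (2 * Real.pi * S) ^ m * Real.exp (2 * Real.pi * S)
  refine ⟨(∫ y, |ψ y|) * B, by positivity, fun ξ hξ => ?_⟩
  have hpow : ∀ β : ℕ, Integrable (fun y : ℝ => ψ y * y ^ β) volume := by
    intro β
    refine (hint.abs.mul_const ((S : ℝ) ^ β)).mono
      (hint.1.mul (by fun_prop)) (Filter.Eventually.of_forall fun y => ?_)
    by_cases hy : ψ y = 0
    · simp [hy]
    · obtain ⟨h1, h2⟩ := hS y hy
      rw [norm_mul, norm_mul, norm_pow, norm_pow]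
      simp only [Real.norm_eq_abs, abs_abs, abs_of_nonneg h1, Nat.abs_cast]
      gcongr
  have hz : ∫ y : ℝ, (ψ y : ℂ) * ∑ β ∈ Finset.range m,
      (2 * Real.pi * Complex.I * ξ * y) ^ β / (β.factorial : ℂ) = 0 := by
    simp_rw [Finset.mul_sum]
    have e : ∀ (y : ℝ) (β : ℕ), (ψ y : ℂ) * ((2 * Real.pi * Complex.I * ξ * y) ^ β /
        (β.factorial : ℂ)) = (2 * Real.pi * Complex.I * ξ) ^ β / (β.factorial : ℂ) *
          ((ψ y * y ^ β : ℝ) : ℂ) := by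
      intro y β
      push_cast
      ring
    simp_rw [e]
    rw [integral_finsetSum]
    · refine Finset.sum_eq_zero fun β hβ => ?_
      rw [integral_const_mul, integral_complex_ofReal, hmom β (Finset.mem_range.1 hβ)]
      simp
    · intro β _
      exact (hpow β).ofReal.const_mul _
  have hi1 : Integrable (fun y : ℝ => (ψ y : ℂ) *
      Complex.exp (2 * Real.pi * Complex.I * ξ * y)) volume := by
    have hc : Integrable (fun y => (ψ y : ℂ)) volume := hint.ofReal
    refine hc.mono (hc.1.mul (by fun_prop)) (Filter.Eventually.of_forall fun y => ?_)
    have : Complex.exp (2 * Real.pi * Complex.I * ξ * y) =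
        Complex.exp ((2 * Real.pi * ξ * y : ℝ) * Complex.I) := by
      congr 1; push_cast; ring
    rw [norm_mul, this, Complex.norm_exp_ofReal_mul_I, mul_one]
  have hi2 : Integrable (fun y : ℝ => (ψ y : ℂ) * ∑ β ∈ Finset.range m,
      (2 * Real.pi * Complex.I * ξ * y) ^ β / (β.factorial : ℂ)) volume := by
    simp_rw [Finset.mul_sum]
    refine integrable_finsetSum _ fun β _ => ?_
    have e : ∀ (y : ℝ), (ψ y : ℂ) * ((2 * Real.pi * Complex.I * ξ * y) ^ β /
        (β.factorial : ℂ)) = (2 * Real.pi * Complex.I * ξ) ^ β / (β.factorial : ℂ) *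
          ((ψ y * y ^ β : ℝ) : ℂ) := by
      intro y
      push_cast
      ring
    simp_rw [e]
    exact (hpow β).ofReal.const_mul _
  have h1 : waveletFourier ψ ξ = ∫ y : ℝ, ((ψ y : ℂ) *
      Complex.exp (2 * Real.pi * Complex.I * ξ * y) - (ψ y : ℂ) * ∑ β ∈ Finset.range m,
      (2 * Real.pi * Complex.I * ξ * y) ^ β / (β.factorial : ℂ)) := by
    rw [integral_sub hi1 hi2, hz, sub_zero]; rfl
  rw [h1]
  have h2 : (∫ y, |ψ y|) * B * |ξ| ^ m = ∫ y, |ψ y| * (B * |ξ| ^ m) := by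
    rw [integral_mul_const]; ring
  rw [h2]
  refine norm_integral_le_of_norm_le (hint.abs.mul_const _)
    (Filter.Eventually.of_forall fun y => ?_)
  by_cases hy : ψ y = 0
  · simp [hy]
  obtain ⟨hy1, hy2⟩ := hS y hy
  rw [← mul_sub, norm_mul, Complex.norm_real, Real.norm_eq_abs]
  gcongr
  have h3 := Complex.norm_exp_sub_sum_le_norm_mul_exp (2 * Real.pi * Complex.I * ξ * y) m
  refine h3.trans ?_
  have h4 : ‖(2 * Real.pi * Complex.I * ξ * y : ℂ)‖ = 2 * Real.pi * |ξ| * y := by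
    simp [abs_of_nonneg Real.pi_pos.le, abs_of_nonneg hy1]
  rw [h4]
  have h5 : 2 * Real.pi * |ξ| * y ≤ 2 * Real.pi * S * |ξ| := by
    have : y * |ξ| ≤ S * |ξ| := by gcongr
    nlinarith [Real.pi_pos]
  have h6 : 2 * Real.pi * |ξ| * y ≤ 2 * Real.pi * S := by
    refine h5.trans ?_
    exact mul_le_of_le_one_right (by positivity) hξ
  calc (2 * Real.pi * |ξ| * y) ^ m * Real.exp (2 * Real.pi * |ξ| * y)
      ≤ (2 * Real.pi * S * |ξ|) ^ m * Real.exp (2 * Real.pi * S) := by gcongr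
    _ = B * |ξ| ^ m := by simp only [B, mul_pow]; ring

end HypWavelet

namespace HypWavelet

/-! ### The direct estimate in one variable -/

variable {φ ψ : ℝ → ℝ}

theorem shifts_natCast (j : ℕ) : shifts j = Finset.Ico (0 : ℤ) (2 ^ j : ℕ) := by
  simp [shifts]

theorem riesz_upper (h : IsLevelwiseRiesz φ ψ) : ∃ δ : ℝ, 0 ≤ δ ∧ ∀ (j : ℕ) (c : ℤ → ℂ),
    ‖∑ k ∈ shifts j, c k • waveletPer φ ψ j k‖ ^ 2 ≤ δ * ∑ k ∈ shifts j, ‖c k‖ ^ 2 := by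
  obtain ⟨γ, δ, -, h⟩ := h
  refine ⟨max δ 0, le_max_right _ _, fun j c => (h j c).2.trans ?_⟩
  gcongr
  exact le_max_left _ _

theorem norm_sq_sum_of_orthonormal {E ι : Type*} [NormedAddCommGroup E] [InnerProductSpace ℂ E]
    {v : ι → E} (hv : Orthonormal ℂ v) (s : Finset ι) (x : ι → ℂ) :
    ‖∑ i ∈ s, x i • v i‖ ^ 2 = ∑ i ∈ s, ‖x i‖ ^ 2 := by
  have h := hv.inner_sum x x s
  rw [inner_self_eq_norm_sq_to_K] at h
  simp_rw [Complex.conj_mul'] at h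
  apply Complex.ofReal_injective
  push_cast
  exact h

theorem norm_sq_sum_fourierLp (K : Finset ℤ) (x : ℤ → ℂ) :
    ‖∑ n ∈ K, x n • (fourierLp 2 n : L2T)‖ ^ 2 = ∑ n ∈ K, ‖x n‖ ^ 2 :=
  norm_sq_sum_of_orthonormal orthonormal_fourier K x

/-- Frequencies with `2|n| < 2 ^ j` are distinct modulo `2 ^ j`, so there is no aliasing and
Parseval is exact over the shifts. Its factor `2 ^ j` cancels the squared normalization, leaving
`|ψ̂(n / 2^j)|²`. -/
theorem sum_inner_low_freq {S m : ℕ} (hψ : MemLp ψ 2 volume)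
    (hS : ∀ x, ψ x ≠ 0 → 0 ≤ x ∧ x ≤ S) {C : ℝ}
    (hC : ∀ ξ : ℝ, |ξ| ≤ 1 → ‖waveletFourier ψ ξ‖ ≤ C * |ξ| ^ m)
    (j : ℕ) (K : Finset ℤ) (hK : ∀ n ∈ K, 2 * |(n : ℝ)| < 2 ^ j) (x : ℤ → ℂ) :
    ∑ k ∈ shifts j, ‖inner ℂ (waveletPer φ ψ j k) (∑ n ∈ K, x n • (fourierLp 2 n : L2T))‖ ^ 2 ≤
      C ^ 2 * ∑ n ∈ K, (|(n : ℝ)| / 2 ^ j) ^ (2 * m) * ‖x n‖ ^ 2 := by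
  set d : ℤ → ℂ := fun n =>
    x n * ((((2 : ℝ) ^ ((j : ℝ) / 2))⁻¹ : ℝ) * waveletFourier ψ (n / 2 ^ j)) with hd
  have h1 : ∀ k, inner ℂ (waveletPer φ ψ j k) (∑ n ∈ K, x n • (fourierLp 2 n : L2T)) =
      ∑ n ∈ K, fourier n (((k : ℝ) / (2 ^ j : ℕ) : ℝ) : UnitAddCircle) • d n := by
    intro k
    rw [inner_sum]
    refine Finset.sum_congr rfl fun n _ => ?_
    rw [inner_smul_right, inner_waveletPer_fourier hψ hS, hd, smul_eq_mul]
    ring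
  simp_rw [h1]
  rw [shifts_natCast, sum_norm_sq_dft (2 ^ j) (by positivity) K, Finset.mul_sum, Finset.mul_sum]
  · refine Finset.sum_le_sum fun n hn => ?_
    have h2 : |(n : ℝ) / 2 ^ j| = |(n : ℝ)| / 2 ^ j := by
      rw [abs_div, abs_of_pos (by positivity : (0 : ℝ) < 2 ^ j)]
    have h3 : |(n : ℝ) / 2 ^ j| ≤ 1 := by
      rw [h2, div_le_one (by positivity)]
      linarith [hK n hn, abs_nonneg (n : ℝ)]
    have h4 := hC _ h3
    rw [h2] at h4
    rw [hd]
    simp only [norm_mul, mul_pow, Complex.norm_real, norm_inv, inv_pow]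
    rw [Real.norm_eq_abs, sq_abs, two_rpow_half_sq]
    push_cast
    calc (2 : ℝ) ^ j * (‖x n‖ ^ 2 * ((2 ^ j)⁻¹ * ‖waveletFourier ψ (n / 2 ^ j)‖ ^ 2))
        = ‖x n‖ ^ 2 * ‖waveletFourier ψ (n / 2 ^ j)‖ ^ 2 := by field_simp
      _ ≤ ‖x n‖ ^ 2 * (C * (|(n : ℝ)| / 2 ^ j) ^ m) ^ 2 := by gcongr
      _ = _ := by rw [mul_pow, ← pow_mul, mul_comm m 2]; ring
  · intro n hn n' hn' hdvd
    by_contra hne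
    have h5 := Int.le_of_dvd (abs_pos.2 (sub_ne_zero.2 (Ne.symm hne))) ((dvd_abs _ _).2 hdvd)
    have h6 : ((2 : ℝ) ^ j) ≤ |(n' : ℝ) - n| := by exact_mod_cast h5
    have h7 := abs_sub (n' : ℝ) n
    linarith [hK n hn, hK n' hn']

open Classical in
/-- The weight of the frequency `n` in the estimate of level `j`. -/
noncomputable def freqWeight (m j : ℕ) (n : ℤ) : ℝ :=
  if 2 * |(n : ℝ)| < 2 ^ j then (|(n : ℝ)| / 2 ^ j) ^ (2 * m) else 1

/-- The polynomial is split at the aliasing threshold: the low part gains from the vanishing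
moments, the high part is bounded by Bessel's inequality with weight `1`. -/
theorem sum_inner_level {S m : ℕ} (hψ : MemLp ψ 2 volume)
    (hS : ∀ x, ψ x ≠ 0 → 0 ≤ x ∧ x ≤ S) (hmom : HasVanishingMoments ψ m)
    (hR : IsLevelwiseRiesz φ ψ) :
    ∃ C : ℝ, 0 ≤ C ∧ ∀ (j : ℕ) (K : Finset ℤ) (x : ℤ → ℂ),
    ∑ k ∈ shifts j, ‖inner ℂ (waveletPer φ ψ j k) (∑ n ∈ K, x n • (fourierLp 2 n : L2T))‖ ^ 2 ≤
      C * ∑ n ∈ K, freqWeight m j n * ‖x n‖ ^ 2 := by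
  classical
  obtain ⟨C, -, hC⟩ := norm_waveletFourier_le hψ hS hmom
  obtain ⟨δ, hδ, hup⟩ := riesz_upper hR
  refine ⟨2 * C ^ 2 + 2 * δ, by positivity, fun j K x => ?_⟩
  set K₁ := K.filter fun n : ℤ => 2 * |(n : ℝ)| < 2 ^ j
  set K₂ := K.filter fun n : ℤ => ¬ 2 * |(n : ℝ)| < 2 ^ j
  set f₁ : L2T := ∑ n ∈ K₁, x n • (fourierLp 2 n : L2T)
  set f₂ : L2T := ∑ n ∈ K₂, x n • (fourierLp 2 n : L2T)
  have hf : ∑ n ∈ K, x n • (fourierLp 2 n : L2T) = f₁ + f₂ :=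
    (Finset.sum_filter_add_sum_filter_not K _ _).symm
  have h1 := sum_inner_low_freq (φ := φ) hψ hS hC j K₁
    (fun n hn => (Finset.mem_filter.1 hn).2) x
  have h2 := bessel_of_upper_bound hδ (hup j) f₂
  rw [norm_sq_sum_fourierLp] at h2
  have h3 : ∑ n ∈ K, freqWeight m j n * ‖x n‖ ^ 2 =
      ∑ n ∈ K₁, (|(n : ℝ)| / 2 ^ j) ^ (2 * m) * ‖x n‖ ^ 2 + ∑ n ∈ K₂, ‖x n‖ ^ 2 := by
    rw [← Finset.sum_filter_add_sum_filter_not K (fun n : ℤ => 2 * |(n : ℝ)| < 2 ^ j)]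
    congr 1
    · refine Finset.sum_congr rfl fun n hn => ?_
      rw [freqWeight, if_pos (Finset.mem_filter.1 hn).2]
    · refine Finset.sum_congr rfl fun n hn => ?_
      rw [freqWeight, if_neg (Finset.mem_filter.1 hn).2, one_mul]
  have h4 : 0 ≤ ∑ n ∈ K₁, (|(n : ℝ)| / 2 ^ j) ^ (2 * m) * ‖x n‖ ^ 2 :=
    Finset.sum_nonneg fun _ _ => by positivity
  have h5 : 0 ≤ ∑ n ∈ K₂, ‖x n‖ ^ 2 := Finset.sum_nonneg fun _ _ => by positivity
  have h6 : ∑ k ∈ shifts j, ‖inner ℂ (waveletPer φ ψ j k) (f₁ + f₂)‖ ^ 2 ≤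
      2 * ∑ k ∈ shifts j, ‖inner ℂ (waveletPer φ ψ j k) f₁‖ ^ 2 +
      2 * ∑ k ∈ shifts j, ‖inner ℂ (waveletPer φ ψ j k) f₂‖ ^ 2 := by
    rw [Finset.mul_sum, Finset.mul_sum, ← Finset.sum_add_distrib]
    refine Finset.sum_le_sum fun k _ => ?_
    rw [inner_add_right]
    have := norm_add_le (inner ℂ (waveletPer φ ψ j k) f₁) (inner ℂ (waveletPer φ ψ j k) f₂)
    have h7 := sq_nonneg (‖inner ℂ (waveletPer φ ψ j k) f₁‖ - ‖inner ℂ (waveletPer φ ψ j k) f₂‖)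
    calc _ ≤ (‖inner ℂ (waveletPer φ ψ j k) f₁‖ + ‖inner ℂ (waveletPer φ ψ j k) f₂‖) ^ 2 := by
          gcongr
      _ ≤ _ := by nlinarith
  rw [hf, h3]
  refine h6.trans ?_
  have h8 : 0 ≤ C ^ 2 := sq_nonneg C
  nlinarith [mul_nonneg h8 h5, mul_nonneg hδ h4]

/-! ### Summation of the level estimates over all levels. -/

/-- With `2 ^ t ≤ 2|n| < 2 ^ (t + 1)`, the ratio of the left side to `4 ^ (s t)` is `4^{-s(t-j)}`
for `j ≤ t` and at most `4^{-(m-s)(j-t)}` for `j > t`. Hence the decay rate is the smaller of `s`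
and `m - s`. The factor `4 ^ s` comes from `4 ^ t ≤ 4 n²`. -/
theorem four_rpow_mul_freqWeight_le {m : ℕ} {s : ℝ} (hs : 0 < s) (j : ℕ) {n : ℤ}
    (hn : n ≠ 0) :
    (4 : ℝ) ^ (s * j) * freqWeight m j n ≤ (4 : ℝ) ^ s * (1 + |(n : ℝ)| ^ 2) ^ s *
      ((4 : ℝ) ^ (-min s (m - s))) ^ ((j : ℤ) - (Nat.log 2 (2 * n.natAbs) : ℕ)).natAbs := by
  set a : ℕ := n.natAbs with ha
  have ha1 : 1 ≤ a := Int.natAbs_pos.2 hn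
  have han : |(n : ℝ)| = a := by rw [ha, Nat.cast_natAbs, Int.cast_abs]
  set t := Nat.log 2 (2 * a) with ht
  have ht1 : 2 ^ t ≤ 2 * a := Nat.pow_log_le_self 2 (by omega)
  have ht2 : 2 * a < 2 ^ (t + 1) := Nat.lt_pow_succ_log_self (by norm_num) _
  have ht1' : (2 : ℝ) ^ t ≤ 2 * a := by exact_mod_cast ht1
  have ht2' : 2 * (a : ℝ) < 2 ^ (t + 1) := by exact_mod_cast ht2
  have h4t : (4 : ℝ) ^ (s * t) ≤ (4 : ℝ) ^ s * (1 + (a : ℝ) ^ 2) ^ s := by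
    rw [← Real.mul_rpow (by norm_num) (by positivity), mul_comm s, Real.rpow_mul (by norm_num),
      Real.rpow_natCast]
    refine Real.rpow_le_rpow (by positivity) ?_ hs.le
    have : (4 : ℝ) ^ t = (2 ^ t) ^ 2 := by rw [← pow_mul, mul_comm, pow_mul]; norm_num
    rw [this]
    nlinarith [pow_pos (show (0 : ℝ) < 2 by norm_num) t]
  rw [han]
  refine le_trans ?_ (mul_le_mul_of_nonneg_right h4t (by positivity))
  rw [← Real.rpow_natCast, ← Real.rpow_mul (by norm_num), ← Real.rpow_add (by norm_num)]
  rcases le_or_gt j t with hjt | hjt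
  · have hw : freqWeight m j n = 1 := by
      rw [freqWeight, if_neg]
      rw [han, not_lt]
      exact (pow_le_pow_right₀ (by norm_num) hjt).trans ht1'
    rw [hw, mul_one]
    refine Real.rpow_le_rpow_of_exponent_le (by norm_num) ?_
    have : (((j : ℤ) - (t : ℕ)).natAbs : ℝ) = t - j := by
      rw [Nat.cast_natAbs]
      push_cast
      rw [abs_of_nonpos (sub_nonpos.2 (by exact_mod_cast hjt))]
      ring
    rw [this]
    have h5 : (0 : ℝ) ≤ t - j := sub_nonneg.2 (by exact_mod_cast hjt)
    nlinarith [min_le_left s (m - s)]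
  · have hw : freqWeight m j n = ((a : ℝ) / 2 ^ j) ^ (2 * m) := by
      rw [freqWeight, if_pos, han]
      rw [han]
      exact ht2'.trans_le (pow_le_pow_right₀ (by norm_num) hjt)
    have h6 : (((j : ℤ) - (t : ℕ)).natAbs : ℝ) = j - t := by
      rw [Nat.cast_natAbs]
      push_cast
      rw [abs_of_nonneg (sub_nonneg.2 (by exact_mod_cast hjt.le))]
    have h7 : ((a : ℝ) / 2 ^ j) ^ (2 * m) ≤ (4 : ℝ) ^ (-(m : ℝ) * (j - t)) := by
      have h8 : (a : ℝ) / 2 ^ j ≤ (2 : ℝ) ^ ((t : ℝ) - j) := by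
        rw [Real.rpow_sub (by norm_num), Real.rpow_natCast, Real.rpow_natCast]
        gcongr
        rw [pow_succ] at ht2'
        linarith
      calc ((a : ℝ) / 2 ^ j) ^ (2 * m) ≤ ((2 : ℝ) ^ ((t : ℝ) - j)) ^ (2 * m) := by gcongr
        _ = _ := by
          rw [show (4 : ℝ) = 2 ^ (2 : ℝ) by norm_num, ← Real.rpow_natCast,
            ← Real.rpow_mul (by norm_num), ← Real.rpow_mul (by norm_num)]
          congr 1
          push_cast
          ring
    rw [hw]
    calc _ ≤ (4 : ℝ) ^ (s * j) * (4 : ℝ) ^ (-(m : ℝ) * (j - t)) := by gcongr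
      _ = (4 : ℝ) ^ (s * j + -(m : ℝ) * (j - t)) := (Real.rpow_add (by norm_num) _ _).symm
      _ ≤ _ := by
        refine Real.rpow_le_rpow_of_exponent_le (by norm_num) ?_
        rw [h6]
        have h5 : (0 : ℝ) ≤ j - t := sub_nonneg.2 (by exact_mod_cast hjt.le)
        nlinarith [min_le_right s (m - s)]

theorem summable_pow_natAbs {r : ℝ} (h0 : 0 ≤ r) (h1 : r < 1) :
    Summable fun i : ℤ => r ^ i.natAbs := by
  refine Summable.of_nat_of_neg ?_ ?_ <;>
  simpa using summable_geometric_of_lt_one h0 h1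

theorem sum_freqWeight_le {m : ℕ} {s : ℝ} (hs : 0 < s) (hsm : s < m) :
    ∃ C : ℝ, 0 ≤ C ∧ ∀ (n : ℤ) (J : ℕ),
      ∑ j ∈ Finset.range J, (4 : ℝ) ^ (s * j) * freqWeight m j n ≤ C * (1 + |(n : ℝ)| ^ 2) ^ s := by
  set r : ℝ := (4 : ℝ) ^ (-min s (m - s)) with hr
  have hr0 : 0 ≤ r := by positivity
  have hr1 : r < 1 := by
    refine Real.rpow_lt_one_of_one_lt_of_neg (by norm_num) ?_
    have : 0 < min s (m - s) := lt_min hs (sub_pos.2 hsm)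
    linarith
  have hsum := summable_pow_natAbs hr0 hr1
  have hT : 0 ≤ ∑' i : ℤ, r ^ i.natAbs := tsum_nonneg fun _ => by positivity
  refine ⟨(4 : ℝ) ^ s * ∑' i : ℤ, r ^ i.natAbs, by positivity, fun n J => ?_⟩
  by_cases hn : n = 0
  · subst hn
    -- For `m > 0` the zero frequency has weight `0` on every level: the wavelets have mean zero.
    have hm : m ≠ 0 := by
      rintro rfl
      simp only [Nat.cast_zero] at hsm
      linarith
    have : ∀ j, freqWeight m j 0 = 0 := by
      intro j
      simp [freqWeight, hm]
    simp only [this, mul_zero, Finset.sum_const_zero]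
    positivity
  · set t := Nat.log 2 (2 * n.natAbs)
    calc _ ≤ ∑ j ∈ Finset.range J, (4 : ℝ) ^ s * (1 + |(n : ℝ)| ^ 2) ^ s *
          r ^ ((j : ℤ) - (t : ℕ)).natAbs :=
          Finset.sum_le_sum fun j _ => four_rpow_mul_freqWeight_le hs j hn
      _ = (4 : ℝ) ^ s * (1 + |(n : ℝ)| ^ 2) ^ s *
          ∑ j ∈ Finset.range J, r ^ ((j : ℤ) - (t : ℕ)).natAbs := by rw [Finset.mul_sum]
      _ ≤ (4 : ℝ) ^ s * (1 + |(n : ℝ)| ^ 2) ^ s * ∑' i : ℤ, r ^ i.natAbs := by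
          gcongr
          have hinj : Set.InjOn (fun j : ℕ => (j : ℤ) - (t : ℕ)) (Finset.range J) := by
            intro a _ b _ hab
            simp only at hab
            omega
          rw [← Finset.sum_image (f := fun i : ℤ => r ^ i.natAbs) hinj]
          exact hsum.sum_le_tsum _ fun _ _ => by positivity
      _ = _ := by ring

/-- The direct estimate for trigonometric polynomials. -/
theorem exists_direct_estimate {m : ℕ} {s : ℝ} (hs : 0 < s) (hsm : s < m)
    (hψ : MemLp ψ 2 volume) (hsupp : HasCompactSupp ψ) (hmom : HasVanishingMoments ψ m)
    (hR : IsLevelwiseRiesz φ ψ) :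
    ∃ C : ℝ, 0 ≤ C ∧ ∀ (J : ℕ) (K : Finset ℤ) (x : ℤ → ℂ),
      ∑ j ∈ Finset.range J, (4 : ℝ) ^ (s * j) * ∑ k ∈ shifts j,
        ‖inner ℂ (waveletPer φ ψ j k) (∑ n ∈ K, x n • (fourierLp 2 n : L2T))‖ ^ 2 ≤
      C * ∑ n ∈ K, (1 + |(n : ℝ)| ^ 2) ^ s * ‖x n‖ ^ 2 := by
  obtain ⟨S, hS⟩ := exists_nat_support hsupp
  obtain ⟨C₁, hC₁, h1⟩ := sum_inner_level hψ hS hmom hR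
  obtain ⟨C₂, hC₂, h2⟩ := sum_freqWeight_le hs hsm
  refine ⟨C₁ * C₂, by positivity, fun J K x => ?_⟩
  calc _ ≤ ∑ j ∈ Finset.range J, (4 : ℝ) ^ (s * j) *
        (C₁ * ∑ n ∈ K, freqWeight m j n * ‖x n‖ ^ 2) := by
        refine Finset.sum_le_sum fun j _ => ?_
        gcongr
        exact h1 j K x
    _ = C₁ * ∑ n ∈ K, (∑ j ∈ Finset.range J, (4 : ℝ) ^ (s * j) * freqWeight m j n) *
        ‖x n‖ ^ 2 := by
        simp_rw [Finset.mul_sum, Finset.sum_mul]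
        rw [Finset.sum_comm]
        simp_rw [Finset.mul_sum]
        refine Finset.sum_congr rfl fun n _ => Finset.sum_congr rfl fun j _ => by ring
    _ ≤ C₁ * ∑ n ∈ K, (C₂ * (1 + |(n : ℝ)| ^ 2) ^ s) * ‖x n‖ ^ 2 := by
        gcongr with n _
        exact h2 n J
    _ = _ := by
        simp_rw [Finset.mul_sum]
        exact Finset.sum_congr rfl fun n _ => by ring

end HypWavelet

namespace HypWavelet

/-! ### Riesz bounds on the line -/

variable {φ ψ : ℝ → ℝ}

/-- The wavelet `ψ_{j,k}` as an element of `L₂(ℝ)`. -/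
noncomputable def waveletR (φ ψ : ℝ → ℝ) (j : ℕ) (k : ℤ) : L2R :=
  toL2 volume fun x : ℝ => (waveletLine φ ψ j k x : ℂ)

/-- By dilation the norm does not depend on the level `j`. This allows a Riesz bound on one level to
be read off from any other level. -/
theorem norm_sq_sum_waveletR (hψ : MemLp ψ 2 volume) (j : ℕ) (B : Finset ℤ) (c : ℤ → ℂ) :
    ‖∑ k ∈ B, c k • waveletR φ ψ j k‖ ^ 2 = ∫ y : ℝ, ‖∑ k ∈ B, c k * (ψ (y - k) : ℂ)‖ ^ 2 := by
  have hm : ∀ k ∈ B, MemLp (fun x => (waveletLine φ ψ j k x : ℂ)) 2 volume :=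
    fun k _ => memLp_waveletLine hψ j k
  simp only [waveletR]
  rw [← toL2_sum_smul B hm c, norm_sq_toL2 (memLp_sum_smul B hm c)]
  set F : ℝ → ℝ := fun y => ‖∑ k ∈ B, c k * (ψ (y - k) : ℂ)‖ ^ 2
  have h1 : ∀ x : ℝ, ‖∑ k ∈ B, c k * (waveletLine φ ψ j k x : ℂ)‖ ^ 2 = 2 ^ j * F (2 ^ j * x) := by
    intro x
    have : ∑ k ∈ B, c k * (waveletLine φ ψ j k x : ℂ) =
        (((2 : ℝ) ^ ((j : ℝ) / 2) : ℝ) : ℂ) * ∑ k ∈ B, c k * (ψ (2 ^ j * x - k) : ℂ) := by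
      rw [Finset.mul_sum]
      refine Finset.sum_congr rfl fun k _ => ?_
      rw [waveletLine_nat]
      push_cast
      ring
    rw [this, norm_mul, mul_pow, Complex.norm_real, Real.norm_eq_abs, sq_abs, two_rpow_half_sq]
  simp_rw [h1]
  rw [integral_const_mul, Measure.integral_comp_mul_left F, abs_of_pos (by positivity), smul_eq_mul]
  field_simp

/-- The support lies inside the single cell `[-1/2, 1/2)`, so periodization does not fold anything
and is isometric on such functions. -/
theorem periodize_eq_of_support {g : ℝ → ℝ} (hg : ∀ x, g x ≠ 0 → 0 ≤ x ∧ x < 1 / 2)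
    (x : UnitAddCircle) : periodize g x = g (rep 0 x) := by
  rw [periodize_eq_tsum_rep, tsum_eq_single 0]
  intro l hl
  by_contra h
  have h1 := hg _ h
  have h2 := rep_mem l x
  have h3 : (l : ℝ) < 1 := by linarith [h2.1]
  have h4 : (-1 : ℝ) < l := by linarith [h2.2]
  have h5 : l < 1 := by exact_mod_cast h3
  have h6 : -1 < l := by exact_mod_cast h4
  omega

theorem norm_sq_sum_waveletPer {S : ℕ} (hψ : MemLp ψ 2 volume)
    (hS : ∀ x, ψ x ≠ 0 → 0 ≤ x ∧ x ≤ S) (j : ℕ) (B : Finset ℤ) (c : ℤ → ℂ)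
    (hB : ∀ k ∈ B, 0 ≤ k ∧ 2 * (k + S) < 2 ^ j) :
    ‖∑ k ∈ B, c k • waveletPer φ ψ j k‖ ^ 2 = ∫ y : ℝ, ‖∑ k ∈ B, c k * (ψ (y - k) : ℂ)‖ ^ 2 := by
  rw [← norm_sq_sum_waveletR (φ := φ) hψ j]
  have hm : ∀ k ∈ B, MemLp (fun x => (periodize (waveletLine φ ψ j k) x : ℂ)) 2
      (AddCircle.haarAddCircle : Measure UnitAddCircle) :=
    fun k _ => memLp_periodize_waveletLine hψ hS j k
  have hm' : ∀ k ∈ B, MemLp (fun x => (waveletLine φ ψ j k x : ℂ)) 2 volume :=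
    fun k _ => memLp_waveletLine hψ j k
  simp only [waveletR, waveletPer]
  rw [← toL2_sum_smul B hm c, ← toL2_sum_smul B hm' c, norm_sq_toL2 (memLp_sum_smul B hm c),
    norm_sq_toL2 (memLp_sum_smul B hm' c)]
  have hsupp : ∀ k ∈ B, ∀ x, waveletLine φ ψ j k x ≠ 0 → 0 ≤ x ∧ x < 1 / 2 := by
    intro k hk x hx
    obtain ⟨h1, h2⟩ := waveletLine_support hS hx
    obtain ⟨h3, h4⟩ := hB k hk
    have h3' : (0 : ℝ) ≤ k := by exact_mod_cast h3
    have h4' : 2 * ((k : ℝ) + S) < 2 ^ j := by exact_mod_cast h4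
    have h5 : (0 : ℝ) < 2 ^ j := by positivity
    constructor
    · exact nonneg_of_mul_nonneg_right (h3'.trans h1) h5
    · refine lt_of_mul_lt_mul_left (a := (2 : ℝ) ^ j) ?_ h5.le
      linarith
  have h1 : ∀ x : UnitAddCircle, ‖∑ k ∈ B, c k * (periodize (waveletLine φ ψ j k) x : ℂ)‖ ^ 2 =
      ‖∑ k ∈ B, c k * (waveletLine φ ψ j k (rep 0 x) : ℂ)‖ ^ 2 := by
    intro x
    congr 2
    refine Finset.sum_congr rfl fun k hk => ?_
    rw [periodize_eq_of_support (hsupp k hk)]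
  simp_rw [h1]
  rw [integral_comp_rep 0 fun y => ‖∑ k ∈ B, c k * (waveletLine φ ψ j k y : ℂ)‖ ^ 2]
  refine setIntegral_eq_integral_of_forall_compl_eq_zero fun y hy => ?_
  rw [Finset.sum_eq_zero, norm_zero, zero_pow two_ne_zero]
  intro k hk
  have : waveletLine φ ψ j k y = 0 := by
    by_contra h
    obtain ⟨h2, h3⟩ := hsupp k hk y h
    apply hy
    constructor
    · push_cast; linarith
    · push_cast; linarith
  rw [this]; simp

/-- The Riesz bounds of the periodized wavelets on all levels carry over to the line. -/
theorem riesz_line (hψ : MemLp ψ 2 volume) (hsupp : HasCompactSupp ψ) {γ δ : ℝ}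
    (h : ∀ (j : ℕ) (c : ℤ → ℂ),
      γ * ∑ k ∈ shifts j, ‖c k‖ ^ 2 ≤ ‖∑ k ∈ shifts j, c k • waveletPer φ ψ j k‖ ^ 2 ∧
      ‖∑ k ∈ shifts j, c k • waveletPer φ ψ j k‖ ^ 2 ≤ δ * ∑ k ∈ shifts j, ‖c k‖ ^ 2)
    (j : ℕ) (B : Finset ℤ) (c : ℤ → ℂ) :
    γ * ∑ k ∈ B, ‖c k‖ ^ 2 ≤ ‖∑ k ∈ B, c k • waveletR φ ψ j k‖ ^ 2 ∧
      ‖∑ k ∈ B, c k • waveletR φ ψ j k‖ ^ 2 ≤ δ * ∑ k ∈ B, ‖c k‖ ^ 2 := by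
  classical
  obtain ⟨S, hS⟩ := exists_nat_support hsupp
  obtain ⟨a, ha⟩ : ∃ a : ℕ, ∀ k ∈ B, k.natAbs ≤ a :=
    ⟨B.sup Int.natAbs, fun k hk => Finset.le_sup (f := Int.natAbs) hk⟩
  -- Finitely many shifts are translated by `a` to become nonnegative, and the level `J` is taken so
  -- fine that all these wavelets fit into `[0, 1/2)`. There the torus and the line agree, and
  -- translation and dilation do not change the norm.
  set B' : Finset ℤ := B.map (addRightEmbedding (a : ℤ)) with hB'
  set J : ℕ := 2 * (2 * a + S) + 1
  have hJ : 2 * (2 * (a : ℤ) + S) < 2 ^ J := by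
    have : 2 * (2 * a + S) < 2 ^ J := (Nat.lt_succ_self _).trans Nat.lt_two_pow_self
    exact_mod_cast this
  have hmem : ∀ k ∈ B', 0 ≤ k ∧ 2 * (k + S) < 2 ^ J := by
    intro k hk
    obtain ⟨k', hk', rfl⟩ := Finset.mem_map.1 hk
    have := ha k' hk'
    simp only [addRightEmbedding_apply]
    constructor <;> omega
  have hsub : B' ⊆ shifts J := by
    intro k hk
    obtain ⟨h1, h2⟩ := hmem k hk
    rw [shifts_natCast, Finset.mem_Ico]
    push_cast
    constructor <;> omega
  set c' : ℤ → ℂ := fun k => if k ∈ B' then c (k - a) else 0 with hc'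
  have e1 : ∑ k ∈ shifts J, ‖c' k‖ ^ 2 = ∑ k ∈ B, ‖c k‖ ^ 2 := by
    rw [← Finset.sum_subset hsub fun k _ hk => by simp [hc', hk]]
    rw [hB', Finset.sum_map]
    refine Finset.sum_congr rfl fun k hk => ?_
    simp [hc', hB', hk]
  have e2 : ‖∑ k ∈ shifts J, c' k • waveletPer φ ψ J k‖ ^ 2 =
      ‖∑ k ∈ B, c k • waveletR φ ψ j k‖ ^ 2 := by
    rw [← Finset.sum_subset hsub fun k _ hk => by simp [hc', hk],
      norm_sq_sum_waveletPer hψ hS J B' c' hmem, norm_sq_sum_waveletR hψ,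
      ← integral_add_right_eq_self _ (a : ℝ)]
    refine integral_congr_ae (Filter.Eventually.of_forall fun y => ?_)
    simp only
    congr 2
    rw [hB', Finset.sum_map]
    refine Finset.sum_congr rfl fun k hk => ?_
    have hk' : k + a ∈ B' := Finset.mem_map_of_mem (addRightEmbedding (a : ℤ)) hk
    simp only [hc', addRightEmbedding_apply, if_pos hk', add_sub_cancel_right]
    congr 3
    push_cast
    ring
  have := h J c'
  rwa [e1, e2] at this

/-! ### Distance to the scaling space -/

theorem norm_sq_sum_of_pairwise_orthogonal {E ι : Type*} [NormedAddCommGroup E]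
    [InnerProductSpace ℂ E] (s : Finset ι) (x : ι → E)
    (h : ∀ i ∈ s, ∀ j ∈ s, i ≠ j → inner ℂ (x i) (x j) = 0) :
    ‖∑ i ∈ s, x i‖ ^ 2 = ∑ i ∈ s, ‖x i‖ ^ 2 := by
  classical
  induction s using Finset.induction_on with
  | empty => simp
  | insert a s ha ih =>
    rw [Finset.sum_insert ha, Finset.sum_insert ha, ← ih fun i hi j hj =>
      h i (Finset.mem_insert_of_mem hi) j (Finset.mem_insert_of_mem hj), sq, sq, sq]
    refine norm_add_sq_eq_norm_sq_add_norm_sq_of_inner_eq_zero (𝕜 := ℂ) _ _ ?_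
    rw [inner_sum]
    refine Finset.sum_eq_zero fun i hi => h a (Finset.mem_insert_self _ _) i
      (Finset.mem_insert_of_mem hi) ?_
    rintro rfl
    exact ha hi

/-- Different levels are orthogonal on the line, so the squared norm splits and the bounds of the
single levels, which share their constants, add up. -/
theorem riesz_line_levels (hw : IsWavelet φ ψ) (hsupp : HasCompactSupp ψ) {γ δ : ℝ}
    (h : ∀ (j : ℕ) (c : ℤ → ℂ),
      γ * ∑ k ∈ shifts j, ‖c k‖ ^ 2 ≤ ‖∑ k ∈ shifts j, c k • waveletPer φ ψ j k‖ ^ 2 ∧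
      ‖∑ k ∈ shifts j, c k • waveletPer φ ψ j k‖ ^ 2 ≤ δ * ∑ k ∈ shifts j, ‖c k‖ ^ 2)
    (F : Finset (ℕ × ℤ)) (c : ℕ × ℤ → ℂ) :
    γ * ∑ p ∈ F, ‖c p‖ ^ 2 ≤ ‖∑ p ∈ F, c p • waveletR φ ψ p.1 p.2‖ ^ 2 ∧
      ‖∑ p ∈ F, c p • waveletR φ ψ p.1 p.2‖ ^ 2 ≤ δ * ∑ p ∈ F, ‖c p‖ ^ 2 := by
  classical
  set A := F.image Prod.fst
  set B := F.image Prod.snd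
  have hsub : F ⊆ A ×ˢ B := Finset.subset_product
  set c' : ℕ × ℤ → ℂ := fun p => if p ∈ F then c p else 0 with hc'
  have e1 : ∑ p ∈ F, ‖c p‖ ^ 2 = ∑ j ∈ A, ∑ k ∈ B, ‖c' (j, k)‖ ^ 2 := by
    rw [← Finset.sum_product', ← Finset.sum_subset hsub fun p _ hp => by simp [hc', hp]]
    exact Finset.sum_congr rfl fun p hp => by simp [hc', hp]
  have e2 : ∑ p ∈ F, c p • waveletR φ ψ p.1 p.2 =
      ∑ j ∈ A, ∑ k ∈ B, c' (j, k) • waveletR φ ψ j k := by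
    rw [← Finset.sum_product', ← Finset.sum_subset hsub fun p _ hp => by simp [hc', hp]]
    exact Finset.sum_congr rfl fun p hp => by simp [hc', hp]
  rw [e1, e2, norm_sq_sum_of_pairwise_orthogonal, Finset.mul_sum, Finset.mul_sum]
  · exact ⟨Finset.sum_le_sum fun j _ =>
      (riesz_line hw.memLp_wavelet hsupp h j B fun k => c' (j, k)).1,
      Finset.sum_le_sum fun j _ =>
      (riesz_line hw.memLp_wavelet hsupp h j B fun k => c' (j, k)).2⟩
  · intro i _ j _ hij
    simp_rw [sum_inner, inner_sum, inner_smul_left, inner_smul_right]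
    refine Finset.sum_eq_zero fun k _ => Finset.sum_eq_zero fun l _ => ?_
    rw [waveletR, waveletR, inner_waveletLine_of_ne hw hij, mul_zero, mul_zero]

theorem waveletR_orthogonal (hw : IsWavelet φ ψ) (j : ℕ) (k : ℤ) {v : L2R}
    (hv : v ∈ scalingSpace φ 0) : inner ℂ v (waveletR φ ψ j k) = 0 :=
  (waveletLine_mem hw j k).1 v (scalingSpace_mono hw (by positivity : (0 : ℤ) ≤ j) hv)

theorem dense_span (hw : IsWavelet φ ψ) :
    (scalingSpace φ 0 ⊔ Submodule.span ℂ (Set.range fun p : ℕ × ℤ =>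
      waveletR φ ψ p.1 p.2)).topologicalClosure = ⊤ := by
  set Y := scalingSpace φ 0 ⊔ Submodule.span ℂ (Set.range fun p : ℕ × ℤ => waveletR φ ψ p.1 p.2)
  rw [eq_top_iff, ← hw.decomposition]
  refine Submodule.topologicalClosure_minimal _ ?_ Y.isClosed_topologicalClosure
  refine sup_le (le_sup_left.trans Y.le_topologicalClosure) (iSup_le fun j => ?_)
  rw [hw.generates]
  refine Submodule.topologicalClosure_mono (le_trans (Submodule.span_mono ?_) le_sup_right)
  rintro _ ⟨k, rfl⟩
  exact ⟨(j, k), rfl⟩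

/-- The squared distance of `h` to `V_0` is controlled by its wavelet coefficients. -/
theorem exists_near_scalingSpace (hw : IsWavelet φ ψ) (hsupp : HasCompactSupp ψ) {γ δ : ℝ}
    (hγ : 0 < γ) (hR : ∀ (j : ℕ) (c : ℤ → ℂ),
      γ * ∑ k ∈ shifts j, ‖c k‖ ^ 2 ≤ ‖∑ k ∈ shifts j, c k • waveletPer φ ψ j k‖ ^ 2 ∧
      ‖∑ k ∈ shifts j, c k • waveletPer φ ψ j k‖ ^ 2 ≤ δ * ∑ k ∈ shifts j, ‖c k‖ ^ 2)
    {h : L2R} {E : ℝ} (hE : ∀ F : Finset (ℕ × ℤ),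
      ∑ p ∈ F, ‖inner ℂ (waveletR φ ψ p.1 p.2) h‖ ^ 2 ≤ E) :
    ∃ v ∈ scalingSpace φ 0, ‖h - v‖ ^ 2 ≤ E / γ := by
  have hE0 : 0 ≤ E := by simpa using hE ∅
  have : CompleteSpace (scalingSpace φ 0) :=
    (Submodule.isClosed_topologicalClosure _).completeSpace_coe
  set v : L2R := (scalingSpace φ 0).starProjection h
  have hv : v ∈ scalingSpace φ 0 := Submodule.starProjection_apply_mem _ h
  set w : L2R := h - v
  have hwo : w ∈ (scalingSpace φ 0)ᗮ := Submodule.sub_starProjection_mem_orthogonal h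
  refine ⟨v, hv, ?_⟩
  -- The functional `⟨·, w⟩` is estimated on the dense space spanned by `V_0` and the wavelets,
  -- extended by closedness, and finally evaluated at `w` itself. On the dense space only the
  -- wavelet part contributes; Cauchy–Schwarz and the lower Riesz bound apply to it.
  have hclosed : IsClosed {y : L2R | ‖inner ℂ y w‖ ^ 2 ≤ E / γ * ‖y‖ ^ 2} :=
    isClosed_le (by fun_prop) (by fun_prop)
  have hsub : ((scalingSpace φ 0 ⊔ Submodule.span ℂ (Set.range fun p : ℕ × ℤ =>
      waveletR φ ψ p.1 p.2) : Submodule ℂ L2R) : Set L2R) ⊆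
      {y : L2R | ‖inner ℂ y w‖ ^ 2 ≤ E / γ * ‖y‖ ^ 2} := by
    intro y hy
    obtain ⟨v', hv', x, hx, rfl⟩ := Submodule.mem_sup.1 hy
    obtain ⟨c, rfl⟩ := (Finsupp.mem_span_range_iff_exists_finsupp).1 hx
    have hxs : (c.sum fun p a => a • waveletR φ ψ p.1 p.2) =
        ∑ p ∈ c.support, c p • waveletR φ ψ p.1 p.2 := rfl
    rw [hxs]
    set x := ∑ p ∈ c.support, c p • waveletR φ ψ p.1 p.2 with hxdef
    have hvx : inner ℂ v' x = 0 := by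
      rw [hxdef, inner_sum]
      refine Finset.sum_eq_zero fun p _ => ?_
      rw [inner_smul_right, waveletR_orthogonal hw _ _ hv', mul_zero]
    have hnorm : ‖x‖ ^ 2 ≤ ‖v' + x‖ ^ 2 := by
      have := norm_add_sq_eq_norm_sq_add_norm_sq_of_inner_eq_zero v' x hvx
      nlinarith [norm_nonneg v', sq_nonneg ‖v'‖]
    have hinner : inner ℂ (v' + x) w =
        ∑ p ∈ c.support, (starRingEnd ℂ) (c p) * inner ℂ (waveletR φ ψ p.1 p.2) h := by
      rw [inner_add_left, hwo v' hv', zero_add, hxdef, sum_inner]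
      refine Finset.sum_congr rfl fun p _ => ?_
      rw [inner_smul_left, inner_sub_right, ← inner_conj_symm _ v,
        waveletR_orthogonal hw _ _ hv, map_zero, sub_zero]
    have hlow := (riesz_line_levels hw hsupp hR c.support c).1
    rw [← hxdef] at hlow
    simp only [Set.mem_ofPred_eq]
    rw [hinner]
    calc ‖∑ p ∈ c.support, (starRingEnd ℂ) (c p) * inner ℂ (waveletR φ ψ p.1 p.2) h‖ ^ 2
        ≤ (∑ p ∈ c.support, ‖c p‖ * ‖inner ℂ (waveletR φ ψ p.1 p.2) h‖) ^ 2 := by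
          gcongr
          refine (norm_sum_le _ _).trans (le_of_eq ?_)
          refine Finset.sum_congr rfl fun p _ => ?_
          rw [norm_mul, RCLike.norm_conj]
      _ ≤ (∑ p ∈ c.support, ‖c p‖ ^ 2) *
          ∑ p ∈ c.support, ‖inner ℂ (waveletR φ ψ p.1 p.2) h‖ ^ 2 :=
          Finset.sum_mul_sq_le_sq_mul_sq _ _ _
      _ ≤ (‖x‖ ^ 2 / γ) * E := by
          gcongr
          · rw [le_div_iff₀ hγ]; linarith
          · exact hE _
      _ ≤ (‖v' + x‖ ^ 2 / γ) * E := by gcongr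
      _ = _ := by ring
  have hall : ∀ y : L2R, ‖inner ℂ y w‖ ^ 2 ≤ E / γ * ‖y‖ ^ 2 := by
    intro y
    have hy : y ∈ (scalingSpace φ 0 ⊔ Submodule.span ℂ (Set.range fun p : ℕ × ℤ =>
      waveletR φ ψ p.1 p.2)).topologicalClosure := by rw [dense_span hw]; trivial
    exact closure_minimal hsub hclosed hy
  have h1 := hall w
  rw [inner_self_eq_norm_sq_to_K] at h1
  simp only [norm_pow, RCLike.norm_ofReal, abs_norm] at h1
  rcases (sq_nonneg ‖w‖).eq_or_lt with h0 | h0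
  · rw [← h0]; positivity
  · refine le_of_mul_le_mul_right ?_ h0
    linarith

end HypWavelet

namespace HypWavelet

/-! ### Windows of periodic functions -/

variable {φ ψ : ℝ → ℝ}

/-- The periodic function `g` restricted to the cells `[l - 1/2, l + 1/2)`, `l ∈ B`. -/
noncomputable def window (g : L2T) (B : Finset ℤ) (y : ℝ) : ℂ :=
  ∑ l ∈ B, (Set.Ico ((l : ℝ) - 1 / 2) (l + 1 / 2)).indicator
    (fun y : ℝ => g (y : UnitAddCircle)) y

theorem memLp_window (g : L2T) (B : Finset ℤ) : MemLp (window g B) 2 volume :=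
  memLp_finsetSum _ fun l _ => (memLp_indicator_iff_restrict measurableSet_Ico).2
    ((Lp.memLp g).comp_measurePreserving (measurePreserving_coe l))

theorem mem_Ico_half_iff {l l' : ℤ} {y : ℝ} (hy : y ∈ Set.Ico ((l : ℝ) - 1 / 2) (l + 1 / 2)) :
    y ∈ Set.Ico ((l' : ℝ) - 1 / 2) (l' + 1 / 2) ↔ l' = l := by
  refine ⟨fun h => ?_, fun h => h ▸ hy⟩
  by_contra hne
  exact Set.disjoint_left.1 (pairwise_disjoint_Ico_half hne) h hy

open Classical in
theorem window_rep (g : L2T) (B : Finset ℤ) (l : ℤ) (x : UnitAddCircle) :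
    window g B (rep l x) = if l ∈ B then g x else 0 := by
  simp only [window, Set.indicator_apply, mem_Ico_half_iff (rep_mem l x), coe_rep]
  rw [Finset.sum_ite_eq' B l]

open Classical in
theorem norm_sq_window (g : L2T) (B : Finset ℤ) :
    ‖toL2 volume (window g B)‖ ^ 2 = B.card * ‖g‖ ^ 2 := by
  rw [norm_sq_toL2 (memLp_window g B),
    ← (hasSum_integral_rep (integrable_norm_sq (memLp_window g B))).tsum_eq]
  simp_rw [window_rep]
  rw [tsum_eq_sum (s := B)]
  · rw [Finset.sum_congr rfl (g := fun _ => ‖g‖ ^ 2)]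
    · simp
    · intro l hl
      simp only [hl, if_true]
      exact (norm_sq_eq_integral g).symm
  · intro l hl
    simp [hl]

/-- The contribution of the cell `l` to the inner product of `ψ_{j,k}` and a periodic function. -/
noncomputable def cellInner (φ ψ : ℝ → ℝ) (j : ℕ) (k : ℤ) (g : L2T) (l : ℤ) : ℂ :=
  ∫ x, (waveletLine φ ψ j k (rep l x) : ℂ) * g x ∂AddCircle.haarAddCircle

theorem hasSum_cellInner {S : ℕ} (hψ : MemLp ψ 2 volume)
    (hS : ∀ x, ψ x ≠ 0 → 0 ≤ x ∧ x ≤ S) (j : ℕ) (k : ℤ) (g : L2T) :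
    HasSum (cellInner φ ψ j k g) (inner ℂ (waveletPer φ ψ j k) g) := by
  rw [inner_waveletPer hψ hS]
  have h := hasSum_integral_rep
    (integrable_mul_coe (waveletLine_abs_le (φ := φ) (k := k) hS) (memLp_waveletLine hψ j k) g)
  simp only [coe_rep] at h
  exact h

open Classical in
theorem inner_waveletR_window (hψ : MemLp ψ 2 volume) (j : ℕ) (k : ℤ) (g : L2T)
    (B : Finset ℤ) :
    inner ℂ (waveletR φ ψ j k) (toL2 volume (window g B)) = ∑ l ∈ B, cellInner φ ψ j k g l := by
  rw [waveletR, inner_toL2_toL2 (memLp_waveletLine hψ j k) (memLp_window g B)]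
  have hi : Integrable (fun x => (starRingEnd ℂ) (waveletLine φ ψ j k x : ℂ) * window g B x)
      volume :=
    MemLp.integrable_mul (p := 2) (q := 2) (memLp_waveletLine hψ j k).star (memLp_window g B)
  rw [← (hasSum_integral_rep hi).tsum_eq, tsum_eq_sum (s := B)]
  · refine Finset.sum_congr rfl fun l hl => ?_
    simp_rw [window_rep, if_pos hl, Complex.conj_ofReal]
    rfl
  · intro l hl
    simp [window_rep, hl]

/-- The support of `ψ_{j,k}` has length at most `S` because `2 ^ j ≥ 1`, so the cells on which it is
active lie within `S` of each other. -/
theorem cellInner_near {S : ℕ} (hS : ∀ x, ψ x ≠ 0 → 0 ≤ x ∧ x ≤ S) {j : ℕ} {k : ℤ} {g : L2T}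
    {l l' : ℤ} (h : cellInner φ ψ j k g l ≠ 0) (h' : cellInner φ ψ j k g l' ≠ 0) :
    l' ≤ l + S := by
  have hex : ∀ l, cellInner φ ψ j k g l ≠ 0 → ∃ x, waveletLine φ ψ j k (rep l x) ≠ 0 := by
    intro l hl
    by_contra! hx
    apply hl
    simp [cellInner, hx]
  obtain ⟨x, hx⟩ := hex l h
  obtain ⟨x', hx'⟩ := hex l' h'
  have h1 := waveletLine_support hS hx
  have h2 := waveletLine_support hS hx'
  have h3 : (2 : ℝ) ^ j * (rep l' x' - rep l x) ≤ S := by linarith [h1.1, h2.2]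
  have h4 : (1 : ℝ) ≤ 2 ^ j := one_le_pow₀ (by norm_num)
  have h5 : rep l' x' - rep l x ≤ S := by
    by_contra! h6
    have : (0 : ℝ) < rep l' x' - rep l x := lt_of_le_of_lt (Nat.cast_nonneg S) h6
    nlinarith
  have h6 := (rep_mem l x).2
  have h7 := (rep_mem l' x').1
  have h8 : (l' : ℝ) < ((l + S + 1 : ℤ) : ℝ) := by push_cast; linarith
  have h9 : l' < l + S + 1 := by exact_mod_cast h8
  omega

/-- The bound does not depend on the window length `R`. A wavelet active on a cell at distance at
least `S` from the ends sees all of its active cells inside the window, so its coefficient is the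
full periodic one, which vanishes. The remaining wavelets see only the at most `2S` cells near the
ends, and Bessel's inequality applies there. -/
theorem sum_inner_window_le {S : ℕ} (hw : IsWavelet φ ψ)
    (hS : ∀ x, ψ x ≠ 0 → 0 ≤ x ∧ x ≤ S) {γ δ : ℝ} (hδ : 0 ≤ δ)
    (hR : ∀ (j : ℕ) (c : ℤ → ℂ),
      γ * ∑ k ∈ shifts j, ‖c k‖ ^ 2 ≤ ‖∑ k ∈ shifts j, c k • waveletPer φ ψ j k‖ ^ 2 ∧
      ‖∑ k ∈ shifts j, c k • waveletPer φ ψ j k‖ ^ 2 ≤ δ * ∑ k ∈ shifts j, ‖c k‖ ^ 2)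
    {g : L2T} (hg : ∀ (j : ℕ) (k : ℤ), inner ℂ (waveletPer φ ψ j k) g = 0) (R : ℕ)
    (F : Finset (ℕ × ℤ)) :
    ∑ p ∈ F, ‖inner ℂ (waveletR φ ψ p.1 p.2) (toL2 volume (window g (Finset.Ico 0 (R : ℤ))))‖ ^ 2 ≤
      δ * (2 * S * ‖g‖ ^ 2) := by
  classical
  have hsupp : HasCompactSupp ψ := ⟨S, fun x hx => hS x hx⟩
  set B : Finset ℤ := Finset.Ico 0 (R : ℤ)
  -- The cells of the window within `S` of one of its ends.
  set B' : Finset ℤ := B.filter fun l => ¬ ((S : ℤ) ≤ l ∧ l < R - S) with hB'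
  have hcard : (B'.card : ℝ) ≤ 2 * S := by
    have h1 : B' ⊆ Finset.Ico 0 (S : ℤ) ∪ Finset.Ico ((R : ℤ) - S) R := by
      intro l hl
      simp only [hB', B, Finset.mem_filter, Finset.mem_Ico, Finset.mem_union] at hl ⊢
      omega
    have h2 := (Finset.card_le_card h1).trans (Finset.card_union_le _ _)
    simp only [Int.card_Ico] at h2
    have h3 : B'.card ≤ 2 * S := by omega
    exact_mod_cast h3
  have hle : ∀ p : ℕ × ℤ, ‖inner ℂ (waveletR φ ψ p.1 p.2) (toL2 volume (window g B))‖ ≤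
      ‖inner ℂ (waveletR φ ψ p.1 p.2) (toL2 volume (window g B'))‖ := by
    rintro ⟨j, k⟩
    rw [inner_waveletR_window hw.memLp_wavelet, inner_waveletR_window hw.memLp_wavelet]
    by_cases hcase : ∃ l ∈ B, l ∉ B' ∧ cellInner φ ψ j k g l ≠ 0
    · obtain ⟨l, hlB, hlB', hl⟩ := hcase
      have hl2 : (S : ℤ) ≤ l ∧ l < R - S := by
        by_contra h
        exact hlB' (Finset.mem_filter.2 ⟨hlB, h⟩)
      have h1 : ∀ l' ∉ B, cellInner φ ψ j k g l' = 0 := by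
        intro l' hl'
        by_contra h
        have h2 := cellInner_near hS hl h
        have h3 := cellInner_near hS h hl
        apply hl'
        simp only [B, Finset.mem_Ico]
        omega
      have h2 := (hasSum_sum_of_ne_finset_zero h1).unique
        (hasSum_cellInner hw.memLp_wavelet hS j k g)
      rw [h2, hg, norm_zero]
      exact norm_nonneg _
    · push Not at hcase
      rw [← Finset.sum_subset (Finset.filter_subset _ B) hcase]
  calc _ ≤ ∑ p ∈ F, ‖inner ℂ (waveletR φ ψ p.1 p.2) (toL2 volume (window g B'))‖ ^ 2 := by
        gcongr with p _
        exact hle p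
    _ ≤ δ * ‖toL2 volume (window g B')‖ ^ 2 :=
        bessel_of_upper_bound hδ (fun c => (riesz_line_levels hw hsupp hR F c).2) _
    _ ≤ _ := by
        rw [norm_sq_window]
        gcongr

/-! ### Shift-invariant spaces with one generator -/

/-- The slice of `f` over the cell `l`, as a function on the torus. -/
noncomputable def slice (f : ℝ → ℂ) (l : ℤ) : L2T :=
  toL2 AddCircle.haarAddCircle fun x => f (rep l x)

theorem sum_norm_sq_slice_le {f : ℝ → ℂ} (hf : MemLp f 2 volume) (L : Finset ℤ) :
    ∑ l ∈ L, ‖slice f l‖ ^ 2 ≤ ‖toL2 volume f‖ ^ 2 := by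
  rw [norm_sq_toL2 hf]
  refine le_trans (le_of_eq ?_) (sum_le_hasSum L (fun l _ => ?_)
    (hasSum_integral_rep (integrable_norm_sq hf)))
  · refine Finset.sum_congr rfl fun l _ => ?_
    rw [slice, norm_sq_toL2 (memLp_comp_rep hf l)]
  · exact integral_nonneg fun _ => by positivity

open Classical in
theorem slice_window_sub {f : ℝ → ℂ} (hf : MemLp f 2 volume) (e : L2T) (B K : Finset ℤ)
    (a : ℤ → ℂ) (l : ℤ) :
    slice (fun y => window e B y - ∑ k ∈ K, a k * f (y - k)) l =
      (if l ∈ B then e else 0) - ∑ k ∈ K, a k • slice f (l - k) := by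
  unfold slice
  simp only [window_rep]
  have h1 : ∀ k ∈ K, MemLp (fun x => f (rep (l - k) x)) 2
      (AddCircle.haarAddCircle : Measure UnitAddCircle) := fun k _ => memLp_comp_rep hf _
  rw [← toL2_sum_smul K h1]
  have h2 : MemLp (fun x => if l ∈ B then e x else 0) 2
      (AddCircle.haarAddCircle : Measure UnitAddCircle) := by
    split_ifs
    · exact Lp.memLp e
    · exact MemLp.zero
  have h3 : toL2 AddCircle.haarAddCircle (fun x => if l ∈ B then e x else 0) =
      if l ∈ B then e else 0 := by
    split_ifs
    · exact toL2_coeFn e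
    · exact toL2_zero
  rw [← h3, ← toL2_sub h2 (memLp_sum_smul K h1 a)]
  simp only [rep_sub]

/-- A single line `ℂ Φ` cannot approximate two orthogonal directions: the combination with weights
`β` and `-α` eliminates `Φ`, and the claim follows from orthogonality and Cauchy–Schwarz. -/
theorem norm_sq_le_of_parallel {E : Type*} [NormedAddCommGroup E] [InnerProductSpace ℂ E]
    {e₁ e₂ : E} (h1 : ‖e₁‖ = 1) (h2 : ‖e₂‖ = 1) (h12 : inner ℂ e₁ e₂ = 0) (D α β : ℂ) (Φ : E) :
    ‖D‖ ^ 2 ≤ ‖D • e₁ - α • Φ‖ ^ 2 + ‖D • e₂ - β • Φ‖ ^ 2 := by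
  by_cases h0 : ‖α‖ ^ 2 + ‖β‖ ^ 2 = 0
  · have hα : α = 0 := by
      have : ‖α‖ ^ 2 = 0 := by nlinarith [sq_nonneg ‖α‖, sq_nonneg ‖β‖]
      simpa using this
    subst hα
    have : ‖D • e₁ - (0 : ℂ) • Φ‖ = ‖D‖ := by simp [norm_smul, h1]
    rw [this]
    linarith [sq_nonneg ‖D • e₂ - β • Φ‖]
  · have hpos : 0 < ‖α‖ ^ 2 + ‖β‖ ^ 2 := lt_of_le_of_ne (by positivity) (Ne.symm h0)
    set y₁ := D • e₁ - α • Φ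
    set y₂ := D • e₂ - β • Φ
    -- `Φ` cancels here.
    have e : β • y₁ - α • y₂ = (β * D) • e₁ + (-(α * D)) • e₂ := by
      simp only [y₁, y₂]
      module
    have hn : ‖β • y₁ - α • y₂‖ ^ 2 = (‖α‖ ^ 2 + ‖β‖ ^ 2) * ‖D‖ ^ 2 := by
      rw [e, sq, norm_add_sq_eq_norm_sq_add_norm_sq_of_inner_eq_zero (𝕜 := ℂ)]
      · simp only [norm_smul, h1, h2, norm_mul, norm_neg]
        ring
      · rw [inner_smul_left, inner_smul_right, h12]
        simp
    have hle : ‖β • y₁ - α • y₂‖ ≤ ‖β‖ * ‖y₁‖ + ‖α‖ * ‖y₂‖ := by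
      refine (norm_sub_le _ _).trans ?_
      rw [norm_smul, norm_smul]
    have hsq : ‖β • y₁ - α • y₂‖ ^ 2 ≤ (‖β‖ * ‖y₁‖ + ‖α‖ * ‖y₂‖) ^ 2 := by gcongr
    rw [hn] at hsq
    refine le_of_mul_le_mul_left (hsq.trans ?_) hpos
    nlinarith [sq_nonneg (‖β‖ * ‖y₂‖ - ‖α‖ * ‖y₁‖)]

-- The discrete Fourier transform over the cells turns the convolution of the coefficients `a` with
-- the slices of `f` into a product: for each `z`, a scalar times one vector that is independent of
-- `a`. The interval `[-N, N]` is long enough to contain all shifted slices.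
open Classical in
theorem dft_slices {f : ℝ → ℂ} {M N : ℕ} (hfM : ∀ x, f x ≠ 0 → |x| ≤ M)
    (B K : Finset ℤ) (hB : B ⊆ Finset.Icc (-(N : ℤ)) N)
    (hK : ∀ k ∈ K, k.natAbs + (M + 1) ≤ N) (e : L2T) (a : ℤ → ℂ) (z : UnitAddCircle) :
    ∑ l ∈ Finset.Icc (-(N : ℤ)) N, fourier l z •
      ((if l ∈ B then e else 0) - ∑ k ∈ K, a k • slice f (l - k)) =
    (∑ l ∈ B, fourier l z) • e - (∑ k ∈ K, a k * fourier k z) •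
      ∑ l ∈ Finset.Icc (-(M + 1 : ℤ)) (M + 1), fourier l z • slice f l := by
  have hslice : ∀ l ∉ Finset.Icc (-(M + 1 : ℤ)) (M + 1), slice f l = 0 := by
    intro l hl
    have : ∀ x, f (rep l x) = 0 := by
      intro x
      by_contra h
      have h1 := abs_le.1 (hfM _ h)
      have h2 := rep_mem l x
      apply hl
      rw [Finset.mem_Icc]
      constructor
      · have h3 : (-(M + 1 : ℤ) : ℝ) ≤ (l : ℝ) := by push_cast; linarith [h1.1, h2.2]
        exact_mod_cast h3
      · have h3 : (l : ℝ) ≤ ((M + 1 : ℤ) : ℝ) := by push_cast; linarith [h1.2, h2.1]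
        exact_mod_cast h3
    simp only [slice, this]
    exact toL2_zero
  simp_rw [smul_sub]
  rw [Finset.sum_sub_distrib]
  congr 1
  · rw [Finset.sum_smul, ← Finset.sum_subset hB fun l _ hl => by simp [hl]]
    exact Finset.sum_congr rfl fun l hl => by simp [hl]
  · rw [Finset.sum_smul]
    simp_rw [Finset.smul_sum]
    rw [Finset.sum_comm]
    refine Finset.sum_congr rfl fun k hk => ?_
    have hKk := hK k hk
    rw [← Finset.sum_subset
      (s₁ := (Finset.Icc (-(M + 1 : ℤ)) (M + 1)).map (addRightEmbedding k))]
    · rw [Finset.sum_map]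
      refine Finset.sum_congr rfl fun l _ => ?_
      simp only [addRightEmbedding_apply, add_sub_cancel_right, fourier_add, smul_smul]
      congr 1
      ring
    · intro l hl
      obtain ⟨l', hl', rfl⟩ := Finset.mem_map.1 hl
      simp only [addRightEmbedding_apply, Finset.mem_Icc] at hl' ⊢
      omega
    · intro l _ hl
      rw [hslice, smul_zero, smul_zero]
      intro h
      apply hl
      exact Finset.mem_map.2 ⟨l - k, h, by simp⟩

/-- Two orthonormal periodic functions cannot both be close to a space generated by the shifts of
a single function: generator of bounded support. -/
theorem card_le_of_compact_generator {f : ℝ → ℂ} (hf : MemLp f 2 volume) {M : ℕ}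
    (hfM : ∀ x, f x ≠ 0 → |x| ≤ M) {e₁ e₂ : L2T} (h1 : ‖e₁‖ = 1) (h2 : ‖e₂‖ = 1)
    (h12 : inner ℂ e₁ e₂ = 0) (B K : Finset ℤ) (a b : ℤ → ℂ) :
    (B.card : ℝ) ≤
      ‖toL2 volume (window e₁ B) - ∑ k ∈ K, a k • toL2 volume fun y => f (y - k)‖ ^ 2 +
      ‖toL2 volume (window e₂ B) - ∑ k ∈ K, b k • toL2 volume fun y => f (y - k)‖ ^ 2 := by
  classical
  obtain ⟨N₁, hN₁⟩ : ∃ a : ℕ, ∀ k ∈ B, k.natAbs ≤ a :=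
    ⟨B.sup Int.natAbs, fun k hk => Finset.le_sup (f := Int.natAbs) hk⟩
  obtain ⟨N₂, hN₂⟩ : ∃ a : ℕ, ∀ k ∈ K, k.natAbs ≤ a :=
    ⟨K.sup Int.natAbs, fun k hk => Finset.le_sup (f := Int.natAbs) hk⟩
  set N : ℕ := N₁ + N₂ + (M + 1)
  set L : Finset ℤ := Finset.Icc (-(N : ℤ)) N
  have hB : B ⊆ L := by
    intro l hl
    have := hN₁ l hl
    rw [Finset.mem_Icc]
    omega
  have hK : ∀ k ∈ K, k.natAbs + (M + 1) ≤ N := by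
    intro k hk
    have := hN₂ k hk
    omega
  -- With `q` sample points the cells `-N, …, N` are distinct modulo `q`, so the discrete Parseval
  -- identity is exact on `L`.
  set q : ℕ := 2 * N + 1
  have hq : 0 < q := by positivity
  have hq' : (0 : ℝ) < q := by exact_mod_cast hq
  have hL : ∀ n ∈ L, ∀ n' ∈ L, (q : ℤ) ∣ n' - n → n = n' := by
    intro n hn n' hn' hdvd
    rw [Finset.mem_Icc] at hn hn'
    by_contra hne
    have := Int.le_of_dvd (abs_pos.2 (sub_ne_zero.2 (Ne.symm hne))) ((dvd_abs _ _).2 hdvd)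
    have h3 : |n' - n| ≤ 2 * N := abs_le.2 ⟨by omega, by omega⟩
    push_cast [q] at this
    omega
  set Φ : ℤ → L2T := fun t => ∑ l ∈ Finset.Icc (-(M + 1 : ℤ)) (M + 1),
    fourier l (((t : ℝ) / q : ℝ) : UnitAddCircle) • slice f l with hΦ
  -- `D t` is the transform of the indicator of the window and `Φ t` that of the generator; only `D
  -- t` carries the length of the window.
  set D : ℤ → ℂ := fun t => ∑ l ∈ B, fourier l (((t : ℝ) / q : ℝ) : UnitAddCircle) with hD
  have hlow : ∀ (e : L2T) (a : ℤ → ℂ), ∑ t ∈ Finset.Ico (0 : ℤ) q, ‖D t • e -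
      (∑ k ∈ K, a k * fourier k (((t : ℝ) / q : ℝ) : UnitAddCircle)) • Φ t‖ ^ 2 ≤
      q * ‖toL2 volume (window e B) - ∑ k ∈ K, a k • toL2 volume fun y => f (y - k)‖ ^ 2 := by
    intro e a
    have hm : ∀ k ∈ K, MemLp (fun y : ℝ => f (y - k)) 2 volume := fun k _ =>
      hf.comp_measurePreserving (measurePreserving_sub_right volume (k : ℝ))
    rw [← toL2_sum_smul K hm, ← toL2_sub (memLp_window e B) (memLp_sum_smul K hm a)]
    have h3 := sum_norm_sq_slice_le
      (f := fun y => window e B y - ∑ k ∈ K, a k * f (y - k))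
      ((memLp_window e B).sub (memLp_sum_smul K hm a)) L
    refine le_trans ?_ (mul_le_mul_of_nonneg_left h3 hq'.le)
    rw [← sum_norm_sq_dft q hq L hL]
    refine le_of_eq (Finset.sum_congr rfl fun t _ => ?_)
    simp_rw [slice_window_sub hf]
    rw [dft_slices hfM B K hB hK]
  have hDsum : ∑ t ∈ Finset.Ico (0 : ℤ) q, ‖D t‖ ^ 2 = q * B.card := by
    have h3 := sum_norm_sq_dft q hq B (fun n hn n' hn' => hL n (hB hn) n' (hB hn'))
      fun _ => (1 : ℂ)
    simp only [smul_eq_mul, mul_one, norm_one, one_pow, Finset.sum_const, nsmul_eq_mul] at h3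
    exact h3
  -- `norm_sq_le_of_parallel` is applied at every sample point with the common vector `Φ t`.
  have hsum : ∑ t ∈ Finset.Ico (0 : ℤ) q, ‖D t‖ ^ 2 ≤ _ :=
    (Finset.sum_le_sum fun t _ => norm_sq_le_of_parallel h1 h2 h12 (D t)
      (∑ k ∈ K, a k * fourier k (((t : ℝ) / q : ℝ) : UnitAddCircle))
      (∑ k ∈ K, b k * fourier k (((t : ℝ) / q : ℝ) : UnitAddCircle)) (Φ t)).trans_eq
      Finset.sum_add_distrib
  rw [hDsum] at hsum
  have h4 := hsum.trans (add_le_add (hlow e₁ a) (hlow e₂ b))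
  rw [← mul_add] at h4
  exact le_of_mul_le_mul_left h4 hq'

end HypWavelet

/-! ### From generators of bounded support to the closed space `V_0`. -/

namespace HypWavelet

variable {φ ψ : ℝ → ℝ}

theorem norm_toL2_shift_sub {f f' : ℝ → ℂ} (hf : MemLp f 2 volume) (hf' : MemLp f' 2 volume)
    (k : ℝ) : ‖(toL2 volume fun y => f' (y - k)) - toL2 volume fun y => f (y - k)‖ =
      ‖toL2 volume f' - toL2 volume f‖ := by
  have hs : ∀ {f : ℝ → ℂ}, MemLp f 2 volume → MemLp (fun y => f (y - k)) 2 volume := fun h =>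
    h.comp_measurePreserving (measurePreserving_sub_right volume k)
  have h : ‖(toL2 volume fun y => f' (y - k)) - toL2 volume fun y => f (y - k)‖ ^ 2 =
      ‖toL2 volume f' - toL2 volume f‖ ^ 2 := by
    rw [← toL2_sub hf' hf, ← toL2_sub (hs hf') (hs hf), norm_sq_toL2 (g := fun y => f' y - f y) (hf'.sub hf),
      norm_sq_toL2 (g := fun y => f' (y - k) - f (y - k)) ((hs hf').sub (hs hf)),
      ← integral_sub_right_eq_self (fun y => ‖f' y - f y‖ ^ 2) k]
  exact (sq_eq_sq₀ (norm_nonneg _) (norm_nonneg _)).1 h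

theorem exists_bounded_support_approx {f : ℝ → ℂ} (hf : MemLp f 2 volume) {ε : ℝ} (hε : 0 < ε) :
    ∃ (f' : ℝ → ℂ) (M : ℕ), MemLp f' 2 volume ∧ (∀ x, f' x ≠ 0 → |x| ≤ M) ∧
      ‖toL2 volume f' - toL2 volume f‖ ≤ ε := by
  obtain ⟨f', hc, hle, -, hm⟩ := hf.exists_hasCompactSupport_eLpNorm_sub_le (by norm_num)
    (ε := ENNReal.ofReal ε) (by simpa using hε)
  obtain ⟨r, hr⟩ := hc.isCompact.isBounded.subset_closedBall 0
  obtain ⟨M, hM⟩ := exists_nat_ge r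
  refine ⟨f', M, hm, fun x hx => ?_, ?_⟩
  · have := hr (subset_tsupport _ hx)
    rw [Metric.mem_closedBall, dist_zero_right, Real.norm_eq_abs] at this
    exact this.trans hM
  · rw [norm_sub_rev, toL2_eq hf, toL2_eq hm, ← MemLp.toLp_sub, Lp.norm_toLp]
    exact ENNReal.toReal_le_of_le_ofReal hε.le hle

/-- The lower bound for bounded support is uniform in the generator, so for a fixed finite set of
coefficients it survives the approximation of `f` in `L₂`. -/
theorem card_le_of_generator {f : ℝ → ℂ} (hf : MemLp f 2 volume)
    {e₁ e₂ : L2T} (h1 : ‖e₁‖ = 1) (h2 : ‖e₂‖ = 1)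
    (h12 : inner ℂ e₁ e₂ = 0) (B K : Finset ℤ) (a b : ℤ → ℂ) :
    (B.card : ℝ) ≤
      ‖toL2 volume (window e₁ B) - ∑ k ∈ K, a k • toL2 volume fun y => f (y - k)‖ ^ 2 +
      ‖toL2 volume (window e₂ B) - ∑ k ∈ K, b k • toL2 volume fun y => f (y - k)‖ ^ 2 := by
  choose f' M hm hM hle using fun n : ℕ => exists_bounded_support_approx hf
    (Nat.one_div_pos_of_nat (α := ℝ) (n := n))
  have ht : ∀ k : ℤ, Filter.Tendsto (fun n => toL2 volume fun y : ℝ => f' n (y - k)) Filter.atTop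
      (nhds (toL2 volume fun y : ℝ => f (y - k))) := by
    intro k
    rw [tendsto_iff_norm_sub_tendsto_zero]
    refine squeeze_zero (fun _ => norm_nonneg _) (fun n => ?_)
      tendsto_one_div_add_atTop_nhds_zero_nat
    rw [norm_toL2_shift_sub hf (hm n)]
    exact hle n
  have hs : ∀ (e : L2T) (a : ℤ → ℂ), Filter.Tendsto (fun n => ‖toL2 volume (window e B) -
      ∑ k ∈ K, a k • toL2 volume fun y : ℝ => f' n (y - k)‖ ^ 2) Filter.atTop
      (nhds (‖toL2 volume (window e B) -
        ∑ k ∈ K, a k • toL2 volume fun y : ℝ => f (y - k)‖ ^ 2)) := fun e a =>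
    ((tendsto_const_nhds.sub (tendsto_finsetSum K fun k _ => (ht k).const_smul (a k))).norm).pow 2
  exact ge_of_tendsto' ((hs e₁ a).add (hs e₂ b)) fun n =>
    card_le_of_compact_generator (hm n) (hM n) h1 h2 h12 B K a b

theorem scalingSpace_zero : scalingSpace φ 0 =
    (Submodule.span ℂ (Set.range fun k : ℤ =>
      toL2 volume fun x : ℝ => (φ (x - k) : ℂ))).topologicalClosure := by
  simp only [scalingSpace, zpow_zero, one_mul]

theorem card_le_of_mem_span (hφ : MemLp φ 2 volume)
    {e₁ e₂ : L2T} (h1 : ‖e₁‖ = 1) (h2 : ‖e₂‖ = 1)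
    (h12 : inner ℂ e₁ e₂ = 0) (B : Finset ℤ) {v₁ v₂ : L2R}
    (hv₁ : v₁ ∈ Submodule.span ℂ (Set.range fun k : ℤ =>
      toL2 volume fun x : ℝ => (φ (x - k) : ℂ)))
    (hv₂ : v₂ ∈ Submodule.span ℂ (Set.range fun k : ℤ =>
      toL2 volume fun x : ℝ => (φ (x - k) : ℂ))) :
    (B.card : ℝ) ≤ ‖toL2 volume (window e₁ B) - v₁‖ ^ 2 +
      ‖toL2 volume (window e₂ B) - v₂‖ ^ 2 := by
  classical
  obtain ⟨a, rfl⟩ := (Finsupp.mem_span_range_iff_exists_finsupp).1 hv₁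
  obtain ⟨b, rfl⟩ := (Finsupp.mem_span_range_iff_exists_finsupp).1 hv₂
  have hs : ∀ (c : ℤ →₀ ℂ) (s : Finset ℤ), c.support ⊆ s →
      (c.sum fun k z => z • toL2 volume fun x : ℝ => (φ (x - k) : ℂ)) =
      ∑ k ∈ s, c k • toL2 volume fun x : ℝ => (φ (x - k) : ℂ) := fun c s h =>
    Finsupp.sum_of_support_subset c h _ fun _ _ => zero_smul _ _
  rw [hs a _ Finset.subset_union_left, hs b _ Finset.subset_union_right]
  exact card_le_of_generator (f := fun x => (φ x : ℂ)) hφ.ofReal h1 h2 h12 B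
    (a.support ∪ b.support) a b

/-- The bound is also independent of the number and the size of the coefficients, hence passes from
finite combinations to their closure. -/
theorem card_le_of_mem_scalingSpace (hφ : MemLp φ 2 volume)
    {e₁ e₂ : L2T} (h1 : ‖e₁‖ = 1) (h2 : ‖e₂‖ = 1)
    (h12 : inner ℂ e₁ e₂ = 0) (B : Finset ℤ) {v₁ v₂ : L2R} (hv₁ : v₁ ∈ scalingSpace φ 0)
    (hv₂ : v₂ ∈ scalingSpace φ 0) :
    (B.card : ℝ) ≤ ‖toL2 volume (window e₁ B) - v₁‖ ^ 2 +
      ‖toL2 volume (window e₂ B) - v₂‖ ^ 2 := by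
  rw [scalingSpace_zero] at hv₁ hv₂
  have hv₁' := mem_closure_iff_seq_limit.1 hv₁
  have hv₂' := mem_closure_iff_seq_limit.1 hv₂
  obtain ⟨x, hx, hxt⟩ := hv₁'
  obtain ⟨y, hy, hyt⟩ := hv₂'
  exact ge_of_tendsto' (((tendsto_const_nhds.sub hxt).norm.pow 2).add
    ((tendsto_const_nhds.sub hyt).norm.pow 2)) fun n =>
    card_le_of_mem_span hφ h1 h2 h12 B (hx n) (hy n)

/-! ### Completeness of the periodized wavelets -/

theorem inner_waveletPer_eq_zero_of_shifts {g : L2T}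
    (hg : ∀ (j : ℕ), ∀ k ∈ shifts j, inner ℂ (waveletPer φ ψ j k) g = 0) (j : ℕ) (k : ℤ) :
    inner ℂ (waveletPer φ ψ j k) g = 0 := by
  obtain ⟨k', hk', h⟩ := exists_shift (φ := φ) (ψ := ψ) j k
  rw [h, hg j k' hk']

/-- Totality of the periodized system. If `g ≠ 0`, the constant `1` and the normalized `g` are
orthonormal, and their windows of length `R` would both stay within a bounded distance of `V_0`,
against the lower bound `R` for the sum of the squared distances. -/
theorem eq_zero_of_orthogonal_waveletPer (hw : IsWavelet φ ψ) (hsupp : HasCompactSupp ψ)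
    (h0 : ∫ x, ψ x = 0) (hR : IsLevelwiseRiesz φ ψ) {g : L2T}
    (hg0 : inner ℂ (waveletPer φ ψ (-1) 0) g = 0)
    (hg : ∀ (j : ℕ), ∀ k ∈ shifts j, inner ℂ (waveletPer φ ψ j k) g = 0) : g = 0 := by
  by_contra hne
  obtain ⟨S, hS⟩ := exists_nat_support hsupp
  obtain ⟨γ, δ', hγ, hR'⟩ := hR
  set δ := max δ' 0
  have hδ : 0 ≤ δ := le_max_right _ _
  have hR : ∀ (j : ℕ) (c : ℤ → ℂ),
      γ * ∑ k ∈ shifts j, ‖c k‖ ^ 2 ≤ ‖∑ k ∈ shifts j, c k • waveletPer φ ψ j k‖ ^ 2 ∧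
      ‖∑ k ∈ shifts j, c k • waveletPer φ ψ j k‖ ^ 2 ≤ δ * ∑ k ∈ shifts j, ‖c k‖ ^ 2 := by
    refine fun j c => ⟨(hR' j c).1, (hR' j c).2.trans ?_⟩
    gcongr
    exact le_max_left _ _
  set e₁ : L2T := waveletPer φ ψ (-1) 0 with he₁
  set e₂ : L2T := ((‖g‖⁻¹ : ℝ) : ℂ) • g with he₂
  have h1 : ‖e₁‖ = 1 := by
    rw [he₁, waveletPer_neg_one_fourier hw]
    exact orthonormal_fourier.1 0
  have h2 : ‖e₂‖ = 1 := by
    rw [he₂, norm_smul, Complex.norm_real, norm_inv, norm_norm,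
      inv_mul_cancel₀ (norm_ne_zero_iff.2 hne)]
  have h12 : inner ℂ e₁ e₂ = 0 := by rw [he₂, inner_smul_right, hg0, mul_zero]
  have ho1 : ∀ (j : ℕ) (k : ℤ), inner ℂ (waveletPer φ ψ j k) e₁ = 0 :=
    inner_waveletPer_neg_one hw hsupp h0
  have ho2 : ∀ (j : ℕ) (k : ℤ), inner ℂ (waveletPer φ ψ j k) e₂ = 0 := by
    intro j k
    rw [he₂, inner_smul_right, inner_waveletPer_eq_zero_of_shifts hg, mul_zero]
  -- `R` exceeds the sum of the two bounds on the squared distances to `V_0`, each of which is `2 S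
  -- δ / γ`.
  obtain ⟨R, hRlarge⟩ := exists_nat_gt (δ * (2 * S * 1 ^ 2) / γ + δ * (2 * S * 1 ^ 2) / γ)
  obtain ⟨v₁, hv₁, hd₁⟩ := exists_near_scalingSpace hw hsupp hγ hR
    (sum_inner_window_le hw hS hδ hR ho1 R)
  obtain ⟨v₂, hv₂, hd₂⟩ := exists_near_scalingSpace hw hsupp hγ hR
    (sum_inner_window_le hw hS hδ hR ho2 R)
  rw [h1] at hd₁
  rw [h2] at hd₂
  have h3 := card_le_of_mem_scalingSpace hw.memLp_scaling h1 h2 h12 (Finset.Ico 0 (R : ℤ)) hv₁ hv₂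
  rw [Int.card_Ico, sub_zero, Int.toNat_natCast] at h3
  linarith

end HypWavelet

namespace HypWavelet

/-! ### An orthonormal basis adapted to the levels -/

variable {φ ψ : ℝ → ℝ}

/-- The span of the periodized wavelets of level `j`. -/
noncomputable def levelSpace (φ ψ : ℝ → ℝ) (j : ℤ) : Submodule ℂ L2T :=
  Submodule.span ℂ (waveletPer φ ψ j '' (shifts j : Set ℤ))

instance (φ ψ : ℝ → ℝ) (j : ℤ) : FiniteDimensional ℂ (levelSpace φ ψ j) :=
  FiniteDimensional.span_of_finite ℂ ((shifts j).finite_toSet.image _)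

theorem waveletPer_mem_levelSpace {j k : ℤ} (hk : k ∈ shifts j) :
    waveletPer φ ψ j k ∈ levelSpace φ ψ j :=
  Submodule.subset_span ⟨k, hk, rfl⟩

theorem mem_levelSpace {j : ℤ} {y : L2T} (hy : y ∈ levelSpace φ ψ j) :
    ∃ c : ℤ → ℂ, y = ∑ k ∈ shifts j, c k • waveletPer φ ψ j k := by
  obtain ⟨c, hc⟩ := (Submodule.mem_span_image_finset_iff_exists_fun ℂ).1 hy
  refine ⟨fun k => if h : k ∈ shifts j then c ⟨k, h⟩ else 0, ?_⟩
  rw [← hc, ← Finset.sum_coe_sort (shifts j)]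
  refine Finset.sum_congr rfl fun k _ => ?_
  simp only [k.2, dif_pos]

theorem inner_waveletPer_levels (hw : IsWavelet φ ψ) (hsupp : HasCompactSupp ψ)
    (h0 : ∫ x, ψ x = 0) {i j : ℤ} (hi : -1 ≤ i) (hj : -1 ≤ j) (hij : i ≠ j) {k l : ℤ}
    (hk : k ∈ shifts i) (hl : l ∈ shifts j) :
    inner ℂ (waveletPer φ ψ i k) (waveletPer φ ψ j l) = 0 := by
  rcases eq_or_lt_of_le hi with rfl | hi'
  · have hk0 : k = 0 := by simpa [shifts] using hk
    obtain ⟨j, rfl⟩ := Int.eq_ofNat_of_zero_le (by omega : 0 ≤ j)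
    rw [hk0, ← inner_conj_symm, inner_waveletPer_neg_one hw hsupp h0, map_zero]
  · obtain ⟨i, rfl⟩ := Int.eq_ofNat_of_zero_le (by omega : 0 ≤ i)
    rcases eq_or_lt_of_le hj with rfl | hj'
    · have hl0 : l = 0 := by simpa [shifts] using hl
      rw [hl0, inner_waveletPer_neg_one hw hsupp h0]
    · obtain ⟨j, rfl⟩ := Int.eq_ofNat_of_zero_le (by omega : 0 ≤ j)
      exact inner_waveletPer_of_ne hw hsupp (by exact_mod_cast hij) k l

theorem levelSpace_isOrtho (hw : IsWavelet φ ψ) (hsupp : HasCompactSupp ψ)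
    (h0 : ∫ x, ψ x = 0) {i j : ℤ} (hi : -1 ≤ i) (hj : -1 ≤ j) (hij : i ≠ j) :
    levelSpace φ ψ i ⟂ levelSpace φ ψ j := by
  refine Submodule.isOrtho_span.2 ?_
  rintro _ ⟨k, hk, rfl⟩ _ ⟨l, hl, rfl⟩
  exact inner_waveletPer_levels hw hsupp h0 hi hj hij hk hl

/-- The index set of the adapted basis: level `p.1 - 1` and an index within this level. -/
abbrev BasisIndex (φ ψ : ℝ → ℝ) : Type :=
  Σ l : ℕ, Fin (Module.finrank ℂ (levelSpace φ ψ ((l : ℤ) - 1)))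

/-- The level of a basis index. -/
def BasisIndex.level (p : BasisIndex φ ψ) : ℤ := (p.1 : ℤ) - 1

theorem BasisIndex.neg_one_le_level (p : BasisIndex φ ψ) : -1 ≤ p.level := by
  unfold BasisIndex.level; omega

/-- An orthonormal system of `L₂(𝕋)` adapted to the levels. -/
noncomputable def adaptedBasis (φ ψ : ℝ → ℝ) (p : BasisIndex φ ψ) : L2T :=
  (stdOrthonormalBasis ℂ (levelSpace φ ψ ((p.1 : ℤ) - 1)) p.2 : L2T)

theorem adaptedBasis_mem (p : BasisIndex φ ψ) : adaptedBasis φ ψ p ∈ levelSpace φ ψ p.level :=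
  (stdOrthonormalBasis ℂ (levelSpace φ ψ ((p.1 : ℤ) - 1)) p.2).2

theorem orthonormal_adaptedBasis (hw : IsWavelet φ ψ) (hsupp : HasCompactSupp ψ)
    (h0 : ∫ x, ψ x = 0) : Orthonormal ℂ (adaptedBasis φ ψ) := by
  constructor
  · rintro ⟨l, i⟩
    exact (stdOrthonormalBasis ℂ (levelSpace φ ψ ((l : ℤ) - 1))).orthonormal.1 i
  · rintro ⟨l, i⟩ ⟨l', i'⟩ hne
    by_cases hl : l = l'
    · subst hl
      have hi : i ≠ i' := by
        rintro rfl
        exact hne rfl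
      exact (stdOrthonormalBasis ℂ (levelSpace φ ψ ((l : ℤ) - 1))).orthonormal.2 hi
    · exact Submodule.isOrtho_iff_inner_eq.1
        (levelSpace_isOrtho hw hsupp h0 (BasisIndex.neg_one_le_level _)
          (BasisIndex.neg_one_le_level _) (by simp only [BasisIndex.level]; omega)) _
        (adaptedBasis_mem ⟨l, i⟩) _ (adaptedBasis_mem ⟨l', i'⟩)

theorem inner_eq_zero_of_adaptedBasis {g : L2T} (hg : ∀ p, inner ℂ (adaptedBasis φ ψ p) g = 0)
    (l : ℕ) {y : L2T} (hy : y ∈ levelSpace φ ψ ((l : ℤ) - 1)) : inner ℂ y g = 0 := by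
  have h := (stdOrthonormalBasis ℂ (levelSpace φ ψ ((l : ℤ) - 1))).sum_repr ⟨y, hy⟩
  have h' := congrArg (Subtype.val) h
  simp only [Submodule.coe_sum, Submodule.coe_smul] at h'
  rw [← h', sum_inner]
  refine Finset.sum_eq_zero fun i _ => ?_
  rw [inner_smul_left]
  have := hg ⟨l, i⟩
  rw [adaptedBasis] at this
  rw [this, mul_zero]

/-- A vector orthogonal to the basis is orthogonal to every level space, so totality of the
periodized wavelets applies. -/
theorem dense_adaptedBasis (hw : IsWavelet φ ψ) (hsupp : HasCompactSupp ψ)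
    (h0 : ∫ x, ψ x = 0) (hR : IsLevelwiseRiesz φ ψ) :
    (Submodule.span ℂ (Set.range (adaptedBasis φ ψ))).topologicalClosure = ⊤ := by
  rw [Submodule.topologicalClosure_eq_top_iff, Submodule.eq_bot_iff]
  intro g hg
  have hg' : ∀ p, inner ℂ (adaptedBasis φ ψ p) g = 0 := fun p =>
    hg _ (Submodule.subset_span ⟨p, rfl⟩)
  refine eq_zero_of_orthogonal_waveletPer hw hsupp h0 hR ?_ fun j k hk => ?_
  · refine inner_eq_zero_of_adaptedBasis hg' 0 ?_
    simpa using waveletPer_mem_levelSpace (φ := φ) (ψ := ψ) (j := -1) (k := 0) (by simp [shifts])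
  · refine inner_eq_zero_of_adaptedBasis hg' (j + 1) ?_
    simpa using waveletPer_mem_levelSpace (φ := φ) (ψ := ψ) hk

/-- For the projection `y` of `f` onto the span of the `b i`, `‖y‖² = ⟨y, f⟩`. Expanding `y` in the
`v k` and using Cauchy–Schwarz, the lower Riesz bound controls the expansion coefficients by `‖y‖`.
This exchanges an orthonormal basis of a level for its wavelets. -/
theorem sum_inner_sq_le_of_riesz {E ι κ : Type*} [NormedAddCommGroup E] [InnerProductSpace ℂ E]
    {s : Finset κ} {v : κ → E} {γ : ℝ} (hγ : 0 < γ)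
    (hlow : ∀ c : κ → ℂ, γ * ∑ k ∈ s, ‖c k‖ ^ 2 ≤ ‖∑ k ∈ s, c k • v k‖ ^ 2)
    {b : ι → E} (hb : Orthonormal ℂ b) (F : Finset ι)
    (hF : ∀ i ∈ F, ∃ c : κ → ℂ, b i = ∑ k ∈ s, c k • v k) (f : E) :
    ∑ i ∈ F, ‖inner ℂ (b i) f‖ ^ 2 ≤ γ⁻¹ * ∑ k ∈ s, ‖inner ℂ (v k) f‖ ^ 2 := by
  classical
  choose! c hc using hF
  set y : E := ∑ i ∈ F, inner ℂ (b i) f • b i with hy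
  have hyn : ‖y‖ ^ 2 = ∑ i ∈ F, ‖inner ℂ (b i) f‖ ^ 2 :=
    norm_sq_sum_of_orthonormal hb F fun i => inner ℂ (b i) f
  set c' : κ → ℂ := fun k => ∑ i ∈ F, inner ℂ (b i) f * c i k
  have hyc : y = ∑ k ∈ s, c' k • v k := by
    simp only [c', Finset.sum_smul]
    rw [Finset.sum_comm, hy]
    refine Finset.sum_congr rfl fun i hi => ?_
    simp only [mul_smul]
    rw [← Finset.smul_sum, ← hc i hi]
  have hyf : inner ℂ y f = ((‖y‖ ^ 2 : ℝ) : ℂ) := by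
    rw [hyn, hy, sum_inner]
    push_cast
    refine Finset.sum_congr rfl fun i _ => ?_
    rw [inner_smul_left, Complex.conj_mul']
  have hyf' : inner ℂ y f = ∑ k ∈ s, (starRingEnd ℂ) (c' k) * inner ℂ (v k) f := by
    rw [hyc, sum_inner]
    simp only [inner_smul_left]
  have h1 : (‖y‖ ^ 2) ^ 2 ≤ (γ⁻¹ * ‖y‖ ^ 2) * ∑ k ∈ s, ‖inner ℂ (v k) f‖ ^ 2 := by
    have h2 : ‖inner ℂ y f‖ = ‖y‖ ^ 2 := by
      rw [hyf, Complex.norm_real, Real.norm_of_nonneg (by positivity)]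
    rw [← h2, hyf']
    calc ‖∑ k ∈ s, (starRingEnd ℂ) (c' k) * inner ℂ (v k) f‖ ^ 2
        ≤ (∑ k ∈ s, ‖c' k‖ * ‖inner ℂ (v k) f‖) ^ 2 := by
          gcongr
          refine (norm_sum_le _ _).trans (le_of_eq ?_)
          refine Finset.sum_congr rfl fun k _ => ?_
          rw [norm_mul, RCLike.norm_conj]
      _ ≤ (∑ k ∈ s, ‖c' k‖ ^ 2) * ∑ k ∈ s, ‖inner ℂ (v k) f‖ ^ 2 :=
          Finset.sum_mul_sq_le_sq_mul_sq _ _ _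
      _ ≤ _ := by
          rw [← hyf', h2]
          gcongr
          have := hlow c'
          rw [← hyc] at this
          rwa [inv_mul_eq_div, le_div_iff₀ hγ, mul_comm]
  rw [← hyn]
  have hA : 0 ≤ ∑ k ∈ s, ‖inner ℂ (v k) f‖ ^ 2 := Finset.sum_nonneg fun _ _ => by positivity
  rcases (sq_nonneg ‖y‖).eq_or_lt with h0 | h0
  · rw [← h0]; positivity
  · refine le_of_mul_le_mul_right ?_ h0
    linarith

/-- The direct estimate in terms of the adapted basis. -/
theorem exists_direct_estimate_adaptedBasis {m : ℕ} {s : ℝ} (hs : 0 < s) (hsm : s < m)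
    (hw : IsWavelet φ ψ) (hsupp : HasCompactSupp ψ) (h0 : ∫ x, ψ x = 0)
    (hmom : HasVanishingMoments ψ m) (hR : IsLevelwiseRiesz φ ψ) :
    ∃ C : ℝ, 0 ≤ C ∧ ∀ (F : Finset (BasisIndex φ ψ)) (K : Finset ℤ) (x : ℤ → ℂ),
      ∑ p ∈ F, (4 : ℝ) ^ (s * (max p.level 0 : ℤ)) *
        ‖inner ℂ (adaptedBasis φ ψ p) (∑ n ∈ K, x n • (fourierLp 2 n : L2T))‖ ^ 2 ≤
      C * ∑ n ∈ K, (1 + |(n : ℝ)| ^ 2) ^ s * ‖x n‖ ^ 2 := by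
  classical
  obtain ⟨C, hC, hest⟩ := exists_direct_estimate hs hsm hw.memLp_wavelet hsupp hmom hR
  obtain ⟨γ, δ, hγ, hR⟩ := hR
  have hb := orthonormal_adaptedBasis hw hsupp h0
  refine ⟨1 + γ⁻¹ * C, by positivity, fun F K x => ?_⟩
  set f : L2T := ∑ n ∈ K, x n • (fourierLp 2 n : L2T) with hf
  set X := ∑ n ∈ K, (1 + |(n : ℝ)| ^ 2) ^ s * ‖x n‖ ^ 2
  have hfX : ‖f‖ ^ 2 ≤ X := by
    rw [hf, norm_sq_sum_fourierLp]
    refine Finset.sum_le_sum fun n _ => le_mul_of_one_le_left (by positivity) ?_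
    exact Real.one_le_rpow (by nlinarith [sq_nonneg |(n : ℝ)|]) hs.le
  set J : ℕ := F.sup fun p => p.1
  have hmaps : ∀ p ∈ F, p.1 ∈ Finset.range (J + 1) := fun p hp =>
    Finset.mem_range.2 (Nat.lt_succ_of_le (Finset.le_sup (f := fun p : BasisIndex φ ψ => p.1) hp))
  rw [← Finset.sum_fiberwise_of_maps_to hmaps, Finset.sum_range_succ']
  -- Index `0` is level `-1`, whose weight is `1`; Bessel's inequality and `(1 + |n|²)^s ≥ 1`
  -- suffice.
  have hzero : ∑ p ∈ F with p.1 = 0, (4 : ℝ) ^ (s * (max p.level 0 : ℤ)) *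
      ‖inner ℂ (adaptedBasis φ ψ p) f‖ ^ 2 ≤ X := by
    refine le_trans (le_of_eq ?_) ((hb.sum_inner_products_le f
      (s := F.filter fun p => p.1 = 0)).trans hfX)
    refine Finset.sum_congr rfl fun p hp => ?_
    have : max p.level 0 = 0 := by
      rw [BasisIndex.level, (Finset.mem_filter.1 hp).2]; rfl
    rw [this]
    simp
  -- Index `j + 1` is level `j`.
  have hpos : ∀ j ∈ Finset.range J, ∑ p ∈ F with p.1 = j + 1,
      (4 : ℝ) ^ (s * (max p.level 0 : ℤ)) * ‖inner ℂ (adaptedBasis φ ψ p) f‖ ^ 2 ≤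
      γ⁻¹ * ((4 : ℝ) ^ (s * j) * ∑ k ∈ shifts j, ‖inner ℂ (waveletPer φ ψ j k) f‖ ^ 2) := by
    intro j _
    have hlev : ∀ p ∈ F.filter (fun p => p.1 = j + 1), p.level = j := by
      intro p hp
      rw [BasisIndex.level, (Finset.mem_filter.1 hp).2]
      push_cast
      ring
    have h1 : ∑ p ∈ F with p.1 = j + 1,
        (4 : ℝ) ^ (s * (max p.level 0 : ℤ)) * ‖inner ℂ (adaptedBasis φ ψ p) f‖ ^ 2 =
        (4 : ℝ) ^ (s * j) * ∑ p ∈ F with p.1 = j + 1, ‖inner ℂ (adaptedBasis φ ψ p) f‖ ^ 2 := by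
      rw [Finset.mul_sum]
      refine Finset.sum_congr rfl fun p hp => ?_
      rw [hlev p hp, max_eq_left (by positivity)]
      push_cast
      rfl
    rw [h1, mul_left_comm]
    refine mul_le_mul_of_nonneg_left ?_ (by positivity)
    refine sum_inner_sq_le_of_riesz hγ (fun c => (hR j c).1) hb _ (fun p hp => ?_) f
    have := adaptedBasis_mem p
    rw [hlev p hp] at this
    exact mem_levelSpace this
  have hsum := (Finset.sum_le_sum hpos).trans_eq (Finset.mul_sum _ _ _).symm
  have hlast := mul_le_mul_of_nonneg_left (hest J K x) (inv_nonneg.2 hγ.le)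
  linarith

end HypWavelet

namespace HypWavelet

/-! ### Tensor products -/

variable {d : ℕ}

theorem memLp_tensor (u : Fin d → L2T) :
    MemLp (fun x : UnitAddTorus (Fin d) => ∏ i, u i (x i)) 2 (torusMeasure d) := by
  have hm : AEStronglyMeasurable (fun x : UnitAddTorus (Fin d) => ∏ i, u i (x i))
      (torusMeasure d) :=
    Finset.aestronglyMeasurable_fun_prod _ fun i _ =>
      (Lp.memLp (u i)).1.comp_quasiMeasurePreserving (Measure.quasiMeasurePreserving_eval _ i)
  rw [memLp_two_iff_integrable_sq_norm hm]
  have h := Integrable.fintype_prod (μ := fun _ : Fin d => AddCircle.haarAddCircle)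
    (f := fun i (x : UnitAddCircle) => ‖u i x‖ ^ 2)
    (fun i => integrable_norm_sq (Lp.memLp (u i)))
  simpa only [norm_prod, Finset.prod_pow] using h

theorem tensor_ae_eq {u : Fin d → L2T} {v : Fin d → UnitAddCircle → ℂ}
    (h : ∀ i, u i =ᵐ[AddCircle.haarAddCircle] v i) :
    (fun x : UnitAddTorus (Fin d) => ∏ i, u i (x i)) =ᵐ[torusMeasure d]
      fun x => ∏ i, v i (x i) := by
  have h1 : ∀ᵐ x : UnitAddTorus (Fin d) ∂torusMeasure d, ∀ i, u i (x i) = v i (x i) :=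
    ae_all_iff.2 fun i => (Measure.quasiMeasurePreserving_eval
      (fun _ : Fin d => AddCircle.haarAddCircle) i).ae (h i)
  filter_upwards [h1] with x hx
  exact Finset.prod_congr rfl fun i _ => hx i

theorem inner_tensorL2 (u v : Fin d → L2T) :
    inner ℂ (tensorL2 u) (tensorL2 v) = ∏ i, inner ℂ (u i) (v i) := by
  unfold tensorL2
  rw [inner_toL2_toL2 (memLp_tensor u) (memLp_tensor v)]
  have h := integral_fintype_prod_eq_prod (𝕜 := ℂ)
    (μ := fun _ : Fin d => (AddCircle.haarAddCircle : Measure UnitAddCircle))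
    (fun i (x : UnitAddCircle) => (starRingEnd ℂ) (u i x) * v i x)
  have h2 : ∀ i, inner ℂ (u i) (v i) =
      ∫ x, (starRingEnd ℂ) (u i x) * v i x ∂AddCircle.haarAddCircle := by
    intro i
    rw [← inner_toL2 (Lp.memLp (u i)), toL2_coeFn]
  simp_rw [h2]
  rw [← h]
  simp only [map_prod, Finset.prod_mul_distrib]

theorem tensorL2_sum {κ : Type*} [DecidableEq κ] (s : Fin d → Finset κ) (c : Fin d → κ → ℂ)
    (v : Fin d → κ → L2T) :
    tensorL2 (fun i => ∑ k ∈ s i, c i k • v i k) =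
      ∑ k ∈ Fintype.piFinset s, (∏ i, c i (k i)) • tensorL2 fun i => v i (k i) := by
  unfold tensorL2
  rw [← toL2_sum_smul _ fun k _ => memLp_tensor fun i => v i (k i)]
  refine toL2_congr ?_
  have h : ∀ i, (∑ k ∈ s i, c i k • v i k : L2T) =ᵐ[AddCircle.haarAddCircle]
      fun x => ∑ k ∈ s i, c i k * v i k x := by
    intro i
    have h1 : (∑ k ∈ s i, c i k • v i k : L2T) =
        toL2 AddCircle.haarAddCircle fun x => ∑ k ∈ s i, c i k * v i k x := by
      rw [toL2_sum_smul _ fun k _ => Lp.memLp (v i k)]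
      simp only [toL2_coeFn]
    rw [h1]
    exact coeFn_toL2 (memLp_sum_smul _ (fun k _ => Lp.memLp (v i k)) _)
  refine (tensor_ae_eq h).trans (Filter.Eventually.of_forall fun x => ?_)
  simp only [Finset.prod_univ_sum, Finset.prod_mul_distrib]

theorem tensor_fourierLp (n : Fin d → ℤ) :
    tensorL2 (fun i => fourierLp 2 (n i)) =
      toL2 (torusMeasure d) fun x => UnitAddTorus.mFourier n x :=
  toL2_congr (tensor_ae_eq fun i => coeFn_fourierLp 2 (n i))

theorem mFourierLp_eq (n : Fin d → ℤ) :
    (UnitAddTorus.mFourierLp 2 n : L2Td d) = tensorL2 fun i => fourierLp 2 (n i) := by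
  rw [tensor_fourierLp]
  have h : (UnitAddTorus.mFourierLp 2 n : L2Td d) =ᵐ[torusMeasure d] UnitAddTorus.mFourier n :=
    UnitAddTorus.coeFn_mFourierLp 2 n
  conv_lhs => rw [← toL2_coeFn (UnitAddTorus.mFourierLp 2 n : L2Td d)]
  exact toL2_congr h

theorem hasSum_mFourierCoeff_tensor (f : L2Td d) :
    HasSum (fun n => UnitAddTorus.mFourierCoeff f n • tensorL2 fun i => fourierLp 2 (n i)) f := by
  simp_rw [← mFourierLp_eq]
  exact UnitAddTorus.hasSum_mFourier_series_L2 (d := Fin d) f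

theorem dense_tensor_fourier :
    (Submodule.span ℂ (Set.range fun n : Fin d → ℤ =>
      tensorL2 fun i => fourierLp 2 (n i))).topologicalClosure = ⊤ := by
  simp_rw [← mFourierLp_eq]
  exact UnitAddTorus.span_mFourierLp_closure_eq_top (d := Fin d) (p := 2) (by simp)

/-! ### Tensor products of orthonormal bases -/

section Basis

variable {ι : Type*} {b : ι → L2T}

theorem orthonormal_tensor (hb : Orthonormal ℂ b) :
    Orthonormal ℂ fun I : Fin d → ι => tensorL2 fun i => b (I i) := by
  classical
  rw [orthonormal_iff_ite] at hb ⊢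
  intro I I'
  rw [inner_tensorL2]
  simp only [hb]
  split_ifs with h
  · subst h; simp
  · obtain ⟨i, hi⟩ := Function.ne_iff.1 h
    exact Finset.prod_eq_zero (Finset.mem_univ i) (if_neg hi)

theorem hasSum_norm_sq_inner (hb : Orthonormal ℂ b)
    (hd : (Submodule.span ℂ (Set.range b)).topologicalClosure = ⊤) (f : L2T) :
    HasSum (fun i => ‖inner ℂ (b i) f‖ ^ 2) (‖f‖ ^ 2) := by
  have h := (HilbertBasis.mk hb hd.ge).hasSum_inner_mul_inner f f
  have h2 := RCLike.hasSum_re ℂ h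
  simp only [HilbertBasis.coe_mk] at h2
  rw [inner_self_eq_norm_sq] at h2
  refine h2.congr_fun fun i => ?_
  rw [← inner_conj_symm f, Complex.conj_mul']
  norm_cast

theorem norm_sub_sum_inner_sq {E κ : Type*} [NormedAddCommGroup E] [InnerProductSpace ℂ E]
    {v : κ → E} (hv : Orthonormal ℂ v) (F : Finset κ) (f : E) :
    ‖f - ∑ i ∈ F, inner ℂ (v i) f • v i‖ ^ 2 = ‖f‖ ^ 2 - ∑ i ∈ F, ‖inner ℂ (v i) f‖ ^ 2 := by
  classical
  have h1 := norm_sq_sum_of_orthonormal hv F fun i => inner ℂ (v i) f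
  set y := ∑ i ∈ F, inner ℂ (v i) f • v i with hy
  have h2 : inner ℂ y f = ((‖y‖ ^ 2 : ℝ) : ℂ) := by
    rw [h1, hy, sum_inner]
    push_cast
    refine Finset.sum_congr rfl fun i _ => ?_
    rw [inner_smul_left, Complex.conj_mul']
  have h3 : inner ℂ y (f - y) = 0 := by
    rw [inner_sub_right, h2, inner_self_eq_norm_sq_to_K]
    push_cast
    exact sub_self _
  have h4 := norm_add_sq_eq_norm_sq_add_norm_sq_of_inner_eq_zero y (f - y) h3
  rw [add_sub_cancel] at h4
  rw [← h1]
  nlinarith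

/-- It suffices to approximate a tensor product of characters. Over the boxes `F^d` the squared
error of its orthonormal expansion is one minus a product of one-variable partial Parseval sums,
each of which tends to `1`. -/
theorem dense_tensor (hb : Orthonormal ℂ b)
    (hd : (Submodule.span ℂ (Set.range b)).topologicalClosure = ⊤) :
    (Submodule.span ℂ (Set.range fun I : Fin d → ι =>
      tensorL2 fun i => b (I i))).topologicalClosure = ⊤ := by
  classical
  set Y := Submodule.span ℂ (Set.range fun I : Fin d → ι => tensorL2 fun i => b (I i))
  rw [eq_top_iff, ← dense_tensor_fourier]
  refine Submodule.topologicalClosure_minimal _ ?_ Y.isClosed_topologicalClosure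
  rw [Submodule.span_le]
  rintro _ ⟨n, rfl⟩
  set e : L2Td d := tensorL2 fun i => fourierLp 2 (n i) with he
  have hnorm : ‖e‖ ^ 2 = 1 := by
    have h1 : inner ℂ e e = 1 := by
      rw [he, inner_tensorL2]
      refine Finset.prod_eq_one fun i _ => ?_
      rw [inner_self_eq_norm_sq_to_K, orthonormal_fourier.1]
      simp
    have h2 : inner ℂ e e = ((‖e‖ ^ 2 : ℝ) : ℂ) := by
      rw [inner_self_eq_norm_sq_to_K]; norm_cast
    rw [h2] at h1
    exact_mod_cast h1
  set y : Finset ι → L2Td d := fun F => ∑ I ∈ Fintype.piFinset (fun _ : Fin d => F),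
    inner ℂ (tensorL2 fun i => b (I i)) e • tensorL2 fun i => b (I i) with hy
  have hyY : ∀ F, y F ∈ Y := fun F => Submodule.sum_mem _ fun I _ =>
    Submodule.smul_mem _ _ (Submodule.subset_span ⟨I, rfl⟩)
  have hdist : ∀ F, ‖e - y F‖ ^ 2 =
      1 - ∏ i, ∑ p ∈ F, ‖inner ℂ (b p) (fourierLp 2 (n i) : L2T)‖ ^ 2 := by
    intro F
    rw [hy, norm_sub_sum_inner_sq (orthonormal_tensor hb), hnorm, Finset.prod_univ_sum]
    congr 1
    refine Finset.sum_congr rfl fun I _ => ?_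
    rw [he, inner_tensorL2, norm_prod, Finset.prod_pow]
  have hlim : Filter.Tendsto (fun F => ‖e - y F‖ ^ 2) Filter.atTop (nhds 0) := by
    simp_rw [hdist]
    have h1 : Filter.Tendsto (fun F : Finset ι =>
        ∏ i, ∑ p ∈ F, ‖inner ℂ (b p) (fourierLp 2 (n i) : L2T)‖ ^ 2) Filter.atTop
        (nhds (∏ i : Fin d, ‖(fourierLp 2 (n i) : L2T)‖ ^ 2)) :=
      tendsto_finsetProd _ fun i _ => hasSum_norm_sq_inner hb hd (fourierLp 2 (n i))
    have h2 : (∏ i : Fin d, ‖(fourierLp 2 (n i) : L2T)‖ ^ 2) = 1 :=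
      Finset.prod_eq_one fun i _ => by rw [orthonormal_fourier.1, one_pow]
    rw [h2] at h1
    simpa using h1.const_sub 1
  have hlim' : Filter.Tendsto (fun F => ‖y F - e‖) Filter.atTop (nhds 0) := by
    have := hlim.sqrt
    simpa [norm_sub_rev] using this
  exact mem_closure_of_tendsto (tendsto_iff_norm_sub_tendsto_zero.2 hlim')
    (Filter.Eventually.of_forall hyY)

end Basis

/-! ### Tensor powers of bounded matrices -/

theorem sum_piFinset_succ {κ E : Type*} [DecidableEq κ] [AddCommMonoid E] (F : Finset κ)
    (g : (Fin (d + 1) → κ) → E) :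
    ∑ I ∈ Fintype.piFinset (fun _ : Fin (d + 1) => F), g I =
      ∑ a ∈ F, ∑ I ∈ Fintype.piFinset (fun _ : Fin d => F), g (Fin.cons a I) := by
  rw [← Finset.sum_product']
  refine Finset.sum_nbij' (fun I => (I 0, Fin.tail I)) (fun p => Fin.cons p.1 p.2) ?_ ?_ ?_ ?_ ?_
  · intro I hI
    rw [Fintype.mem_piFinset] at hI
    rw [Finset.mem_product, Fintype.mem_piFinset]
    exact ⟨hI 0, fun i => hI i.succ⟩
  · intro p hp
    rw [Finset.mem_product, Fintype.mem_piFinset] at hp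
    rw [Fintype.mem_piFinset]
    intro i
    refine Fin.cases ?_ (fun i => ?_) i
    · simpa using hp.1
    · simpa using hp.2 i
  · intro I _
    exact Fin.cons_self_tail I
  · intro p _
    simp
  · intro I _
    simp [Fin.cons_self_tail]

/-- A matrix bounded between weighted `ℓ²` spaces with squared norm at most `C` has a `d`-fold
tensor power with squared norm at most `C ^ d`: the hypothesis is applied in one variable with the
others frozen, then the induction hypothesis. -/
theorem tensor_power_bound {ι κ : Type*} [DecidableEq ι] [DecidableEq κ] {M : ι → κ → ℂ}
    {w : ι → ℝ} {D : κ → ℝ} {C : ℝ} (hC : 0 ≤ C) (hw : ∀ i, 0 ≤ w i) (hD : ∀ k, 0 ≤ D k)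
    (F : Finset ι) (K : Finset κ)
    (H : ∀ x : κ → ℂ, ∑ i ∈ F, w i * ‖∑ k ∈ K, x k * M i k‖ ^ 2 ≤
      C * ∑ k ∈ K, D k * ‖x k‖ ^ 2) :
    ∀ (d : ℕ) (x : (Fin d → κ) → ℂ),
      ∑ I ∈ Fintype.piFinset (fun _ : Fin d => F), (∏ r, w (I r)) *
        ‖∑ k ∈ Fintype.piFinset (fun _ : Fin d => K), x k * ∏ r, M (I r) (k r)‖ ^ 2 ≤
      C ^ d * ∑ k ∈ Fintype.piFinset (fun _ : Fin d => K), (∏ r, D (k r)) * ‖x k‖ ^ 2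
  | 0, x => by simp
  | d + 1, x => by
    have ih := tensor_power_bound hC hw hD F K H d
    simp_rw [sum_piFinset_succ]
    simp only [Fin.prod_univ_succ, Fin.cons_zero, Fin.cons_succ]
    set y : κ → (Fin d → ι) → ℂ := fun a I =>
      ∑ k ∈ Fintype.piFinset (fun _ : Fin d => K), x (Fin.cons a k) * ∏ r, M (I r) (k r) with hy
    have e1 : ∀ (i : ι) (I : Fin d → ι), ∑ a ∈ K, ∑ k ∈ Fintype.piFinset (fun _ : Fin d => K),
        x (Fin.cons a k) * (M i a * ∏ r, M (I r) (k r)) = ∑ a ∈ K, y a I * M i a := by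
      intro i I
      refine Finset.sum_congr rfl fun a _ => ?_
      rw [hy, Finset.sum_mul]
      exact Finset.sum_congr rfl fun k _ => by ring
    simp_rw [e1]
    rw [Finset.sum_comm]
    calc ∑ I ∈ Fintype.piFinset (fun _ : Fin d => F), ∑ i ∈ F,
          (w i * ∏ r, w (I r)) * ‖∑ a ∈ K, y a I * M i a‖ ^ 2
        = ∑ I ∈ Fintype.piFinset (fun _ : Fin d => F), (∏ r, w (I r)) *
            ∑ i ∈ F, w i * ‖∑ a ∈ K, y a I * M i a‖ ^ 2 := by
          refine Finset.sum_congr rfl fun I _ => ?_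
          rw [Finset.mul_sum]
          exact Finset.sum_congr rfl fun i _ => by ring
      _ ≤ ∑ I ∈ Fintype.piFinset (fun _ : Fin d => F), (∏ r, w (I r)) *
            (C * ∑ a ∈ K, D a * ‖y a I‖ ^ 2) := by
          refine Finset.sum_le_sum fun I _ => ?_
          exact mul_le_mul_of_nonneg_left (H fun a => y a I) (Finset.prod_nonneg fun _ _ => hw _)
      _ = C * ∑ a ∈ K, D a * ∑ I ∈ Fintype.piFinset (fun _ : Fin d => F), (∏ r, w (I r)) *
            ‖y a I‖ ^ 2 := by
          simp_rw [Finset.mul_sum]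
          rw [Finset.sum_comm]
          exact Finset.sum_congr rfl fun a _ => Finset.sum_congr rfl fun I _ => by ring
      _ ≤ C * ∑ a ∈ K, D a * (C ^ d * ∑ k ∈ Fintype.piFinset (fun _ : Fin d => K),
            (∏ r, D (k r)) * ‖x (Fin.cons a k)‖ ^ 2) := by
          refine mul_le_mul_of_nonneg_left (Finset.sum_le_sum fun a _ => ?_) hC
          exact mul_le_mul_of_nonneg_left (ih fun k => x (Fin.cons a k)) (hD a)
      _ = _ := by
          simp_rw [Finset.mul_sum]
          exact Finset.sum_congr rfl fun a _ => Finset.sum_congr rfl fun k _ => by ring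

end HypWavelet

namespace HypWavelet

/-! ### The error of the hyperbolic wavelet projection -/

variable {φ ψ : ℝ → ℝ} {d : ℕ}

/-- The tensor products of the adapted basis. -/
noncomputable def tensorBasis (φ ψ : ℝ → ℝ) (I : Fin d → BasisIndex φ ψ) : L2Td d :=
  tensorL2 fun i => adaptedBasis φ ψ (I i)

theorem tendsto_piFinset_Icc :
    Filter.Tendsto (fun N : ℕ => Fintype.piFinset fun _ : Fin d => Finset.Icc (-(N : ℤ)) N)
      Filter.atTop Filter.atTop := by
  classical
  refine Filter.tendsto_atTop_finset_of_monotone (fun N N' h => ?_) fun k => ?_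
  · refine Fintype.piFinset_subset _ _ fun _ => Finset.Icc_subset_Icc ?_ ?_ <;> omega
  · refine ⟨Finset.univ.sup fun i => (k i).natAbs, ?_⟩
    rw [Fintype.mem_piFinset]
    intro i
    have := Finset.le_sup (f := fun i => (k i).natAbs) (Finset.mem_univ i)
    rw [Finset.mem_Icc]
    omega

theorem normHmix_sq {s : ℝ} {f : L2Td d} : normHmix s f ^ 2 = ∑' k, mixTerm s f k := by
  rw [normHmix, Real.sq_sqrt]
  exact tsum_nonneg fun k => by unfold mixTerm; positivity

/-- The matrix of inner products between the tensor basis and the multivariate characters is a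
tensor power of the one-variable matrix. The bound is obtained on finite boxes of basis indices and
frequencies; the frequency box then grows to all of `ℤ^d`. -/
theorem exists_weighted_bound {m : ℕ} {s : ℝ} (hs : 0 < s) (hsm : s < m)
    (hw : IsWavelet φ ψ) (hsupp : HasCompactSupp ψ) (h0 : ∫ x, ψ x = 0)
    (hmom : HasVanishingMoments ψ m) (hR : IsLevelwiseRiesz φ ψ) (d : ℕ) :
    ∃ C : ℝ, 0 ≤ C ∧ ∀ (f : L2Td d), MemHmix s f → ∀ G : Finset (Fin d → BasisIndex φ ψ),
      ∑ I ∈ G, (4 : ℝ) ^ (s * (∑ i, max (I i).level 0 : ℤ)) *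
        ‖inner ℂ (tensorBasis φ ψ I) f‖ ^ 2 ≤ C * normHmix s f ^ 2 := by
  classical
  obtain ⟨C, hC, hest⟩ := exists_direct_estimate_adaptedBasis hs hsm hw hsupp h0 hmom hR
  refine ⟨C ^ d, by positivity, fun f hf G => ?_⟩
  set F : Finset (BasisIndex φ ψ) := G.biUnion fun I => Finset.univ.image I with hF
  have hGF : G ⊆ Fintype.piFinset fun _ : Fin d => F := by
    intro I hI
    rw [Fintype.mem_piFinset]
    intro i
    exact Finset.mem_biUnion.2 ⟨I, hI, Finset.mem_image_of_mem _ (Finset.mem_univ i)⟩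
  refine (Finset.sum_le_sum_of_subset_of_nonneg hGF fun _ _ _ => by positivity).trans ?_
  set c : (Fin d → ℤ) → ℂ := fun k => UnitAddTorus.mFourierCoeff f k with hc
  set K : ℕ → Finset ℤ := fun N => Finset.Icc (-(N : ℤ)) N
  have hlim : ∀ I : Fin d → BasisIndex φ ψ, Filter.Tendsto (fun N : ℕ =>
      ∑ k ∈ Fintype.piFinset (fun _ : Fin d => K N),
        c k * ∏ r, inner ℂ (adaptedBasis φ ψ (I r)) (fourierLp 2 (k r) : L2T))
      Filter.atTop (nhds (inner ℂ (tensorBasis φ ψ I) f)) := by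
    intro I
    have h1 := (hasSum_mFourierCoeff_tensor f).mapL (innerSL ℂ (tensorBasis φ ψ I))
    simp only [innerSL_apply_apply, inner_smul_right, tensorBasis, inner_tensorL2] at h1
    exact h1.comp tendsto_piFinset_Icc
  have hlim' := tendsto_finsetSum (Fintype.piFinset fun _ : Fin d => F) fun I _ =>
    ((hlim I).norm.pow 2).const_mul ((4 : ℝ) ^ (s * (∑ i, max (I i).level 0 : ℤ)))
  refine le_of_tendsto' hlim' fun N => ?_
  have hw4 : ∀ I : Fin d → BasisIndex φ ψ, (4 : ℝ) ^ (s * (∑ i, max (I i).level 0 : ℤ)) =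
      ∏ i, (4 : ℝ) ^ (s * (max (I i).level 0 : ℤ)) := by
    intro I
    rw [← Real.rpow_sum_of_pos (by norm_num), ← Finset.mul_sum]
    push_cast
    rfl
  simp_rw [hw4]
  have H : ∀ x : ℤ → ℂ, ∑ p ∈ F, (4 : ℝ) ^ (s * (max p.level 0 : ℤ)) *
      ‖∑ k ∈ K N, x k * inner ℂ (adaptedBasis φ ψ p) (fourierLp 2 k : L2T)‖ ^ 2 ≤
      C * ∑ k ∈ K N, (1 + |(k : ℝ)| ^ 2) ^ s * ‖x k‖ ^ 2 := by
    intro x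
    have h1 := hest F (K N) x
    simp only [inner_sum, inner_smul_right] at h1
    exact h1
  refine (tensor_power_bound hC (fun p => by positivity) (fun k => by positivity) F (K N) H d
    c).trans ?_
  rw [normHmix_sq]
  refine mul_le_mul_of_nonneg_left ?_ (by positivity)
  refine le_trans (le_of_eq ?_) (Summable.sum_le_tsum
    (Fintype.piFinset fun _ : Fin d => K N) (fun k _ => by unfold mixTerm; positivity) hf)
  refine Finset.sum_congr rfl fun k _ => ?_
  rw [mixTerm, mul_comm]

theorem inner_dual_level {ψs : ℤ → ℤ → L2T} (hdual : IsDualSystem φ ψ ψs) {l : ℤ} (hl : -1 ≤ l)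
    (c : ℤ → ℂ) {j k : ℤ} (hj : -1 ≤ j) (hk : k ∈ shifts j) :
    inner ℂ (ψs j k) (∑ k' ∈ shifts l, c k' • waveletPer φ ψ l k') =
      if l = j then c k else 0 := by
  rw [inner_sum]
  simp only [inner_smul_right]
  rw [Finset.sum_congr rfl fun k' hk' => by rw [hdual l hl k' hk' j hj k hk]]
  split_ifs with h
  · subst h
    simp [hk]
  · simp [h]

/-- The dual system reads off the coefficients of `u` in its own level and vanishes on all other
levels. So the operator is diagonal with entries `0` and `1`, and no norm bound on the dual system
is needed. -/
theorem hypProj_tensor {ψs : ℤ → ℤ → L2T} (hdual : IsDualSystem φ ψ ψs) (n : ℕ)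
    {l : Fin d → ℤ} (hl : ∀ i, -1 ≤ l i) {u : Fin d → L2T}
    (hu : ∀ i, u i ∈ levelSpace φ ψ (l i)) :
    hypProj φ ψ ψs d n (tensorL2 u) =
      if ∑ i, max (l i) 0 ≤ (n : ℤ) then tensorL2 u else 0 := by
  classical
  choose c hc using fun i => mem_levelSpace (hu i)
  have hinner : ∀ j ∈ levels d n, ∀ k ∈ shiftsMulti j,
      inner ℂ (tensorL2 fun i => ψs (j i) (k i)) (tensorL2 u) =
        if l = j then ∏ i, c i (k i) else 0 := by
    intro j hj k hk
    have hj' := (mem_levels.1 hj).1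
    have hk' := Fintype.mem_piFinset.1 hk
    rw [inner_tensorL2]
    have h1 : ∀ i, inner ℂ (ψs (j i) (k i)) (u i) = if l i = j i then c i (k i) else 0 := by
      intro i
      rw [hc i]
      exact inner_dual_level hdual (hl i) (c i) (hj' i) (hk' i)
    simp only [h1]
    split_ifs with h
    · subst h; simp
    · obtain ⟨i, hi⟩ := Function.ne_iff.1 h
      exact Finset.prod_eq_zero (Finset.mem_univ i) (if_neg hi)
  have hu' : tensorL2 u = ∑ k ∈ shiftsMulti l, (∏ i, c i (k i)) •
      tensorL2 fun i => waveletPer φ ψ (l i) (k i) := by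
    have h1 : u = fun i => ∑ k ∈ shifts (l i), c i k • waveletPer φ ψ (l i) k := funext hc
    conv_lhs => rw [h1]
    rw [tensorL2_sum (fun i => shifts (l i)) c fun i k => waveletPer φ ψ (l i) k]
    rfl
  rw [hypProj_apply, Finset.sum_congr rfl fun j hj => Finset.sum_congr rfl fun k hk => by
    rw [hinner j hj k hk]]
  by_cases hn : ∑ i, max (l i) 0 ≤ (n : ℤ)
  · rw [if_pos hn, Finset.sum_eq_single l]
    · simp only [if_true]
      exact hu'.symm
    · intro j _ hj
      simp [hj.symm]
    · intro h
      exact absurd (mem_levels.2 ⟨hl, hn⟩) h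
  · rw [if_neg hn]
    refine Finset.sum_eq_zero fun j hj => ?_
    have hne : l ≠ j := by
      rintro rfl
      exact hn (mem_levels.1 hj).2
    simp [hne]

/-- The error estimate in terms of `2^{-ns}`. -/
theorem exists_error_bound {m : ℕ} {s : ℝ} (hs : 0 < s) (hsm : s < m)
    (hw : IsWavelet φ ψ) (hsupp : HasCompactSupp ψ) (hmom : HasVanishingMoments ψ m)
    (hR : IsLevelwiseRiesz φ ψ) {ψs : ℤ → ℤ → L2T} (hdual : IsDualSystem φ ψ ψs) (d : ℕ) :
    ∃ C : ℝ, 0 ≤ C ∧ ∀ (n : ℕ) (f : L2Td d), MemHmix s f →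
      ‖f - hypProj φ ψ ψs d n f‖ ≤ C * (2 : ℝ) ^ (-(s * n)) * normHmix s f := by
  classical
  -- `0 < s < m` forces `m ≥ 1`, so the zeroth moment is among the vanishing ones.
  have hm : 0 < m := by
    have : (0 : ℝ) < m := hs.trans hsm
    exact_mod_cast this
  have h0 : ∫ x, ψ x = 0 := by simpa using hmom 0 hm
  obtain ⟨C, hC, hest⟩ := exists_weighted_bound hs hsm hw hsupp h0 hmom hR d
  refine ⟨Real.sqrt C, Real.sqrt_nonneg _, fun n f hf => ?_⟩
  have hb := orthonormal_adaptedBasis hw hsupp h0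
  have hd := dense_adaptedBasis hw hsupp h0 hR
  have hB : Orthonormal ℂ (tensorBasis (d := d) φ ψ) := orthonormal_tensor hb
  have hD : (Submodule.span ℂ (Set.range (tensorBasis (d := d) φ ψ))).topologicalClosure = ⊤ :=
    dense_tensor hb hd
  have hsum : HasSum (fun I => inner ℂ (tensorBasis φ ψ I) f • tensorBasis φ ψ I) f := by
    have h := (HilbertBasis.mk hB hD.ge).hasSum_repr f
    simpa only [HilbertBasis.repr_apply_apply, HilbertBasis.coe_mk] using h
  have hcont : Continuous fun g : L2Td d => ‖g - hypProj φ ψ ψs d n g‖ ^ 2 := by fun_prop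
  have hlim := (hcont.tendsto f).comp hsum
  -- The bound is shown for finite partial sums, where the error consists exactly of the terms with
  -- `|j|₁ > n`, whose weight is at least `4 ^ (s n)`; continuity of `hypProj` gives it for `f`.
  have hsq : ‖f - hypProj φ ψ ψs d n f‖ ^ 2 ≤ (4 : ℝ) ^ (-(s * n)) * (C * normHmix s f ^ 2) := by
    refine le_of_tendsto' hlim fun G => ?_
    have hP : ∀ I : Fin d → BasisIndex φ ψ, hypProj φ ψ ψs d n (tensorBasis φ ψ I) =
        if ∑ i, max (I i).level 0 ≤ (n : ℤ) then tensorBasis φ ψ I else 0 := fun I =>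
      hypProj_tensor hdual n (fun i => (I i).neg_one_le_level) fun i => adaptedBasis_mem (I i)
    have e1 : (∑ I ∈ G, inner ℂ (tensorBasis φ ψ I) f • tensorBasis φ ψ I) -
        hypProj φ ψ ψs d n (∑ I ∈ G, inner ℂ (tensorBasis φ ψ I) f • tensorBasis φ ψ I) =
        ∑ I ∈ G with ¬ ∑ i, max (I i).level 0 ≤ (n : ℤ),
          inner ℂ (tensorBasis φ ψ I) f • tensorBasis φ ψ I := by
      rw [map_sum, ← Finset.sum_sub_distrib, Finset.sum_filter]
      refine Finset.sum_congr rfl fun I _ => ?_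
      rw [map_smul, hP]
      split_ifs <;> simp
    simp only [Function.comp_apply]
    rw [e1, norm_sq_sum_of_orthonormal hB, Real.rpow_neg (by norm_num), ← div_eq_inv_mul,
      le_div_iff₀ (by positivity), Finset.sum_mul]
    refine le_trans (Finset.sum_le_sum fun I hI => ?_)
      (hest f hf (G.filter fun I => ¬ ∑ i, max (I i).level 0 ≤ (n : ℤ)))
    rw [mul_comm]
    refine mul_le_mul_of_nonneg_right ?_ (by positivity)
    refine Real.rpow_le_rpow_of_exponent_le (by norm_num) (mul_le_mul_of_nonneg_left ?_ hs.le)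
    have h1 := not_le.1 (Finset.mem_filter.1 hI).2
    have h2 : ((n : ℤ) : ℝ) ≤ (∑ i, max (I i).level 0 : ℤ) := by exact_mod_cast h1.le
    simpa using h2
  have hN : 0 ≤ normHmix s f := Real.sqrt_nonneg _
  refine (sq_le_sq₀ (norm_nonneg _) (by positivity)).1 (hsq.trans (le_of_eq ?_))
  rw [mul_pow, mul_pow, Real.sq_sqrt hC, ← Real.rpow_natCast ((2 : ℝ) ^ (-(s * (n : ℝ)))),
    ← Real.rpow_mul (by norm_num), show (4 : ℝ) = 2 ^ (2 : ℝ) by norm_num,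
    ← Real.rpow_mul (by norm_num)]
  rw [show (2 : ℝ) * -(s * n) = -(s * n) * ((2 : ℕ) : ℝ) by push_cast; ring]
  ring

end HypWavelet

namespace HypWavelet

/-! ### The rank of the hyperbolic wavelet projection -/

variable {φ ψ : ℝ → ℝ} {d : ℕ}

theorem card_shifts {j : ℤ} (hj : -1 ≤ j) : (shifts j).card = 2 ^ j.toNat := by
  rcases eq_or_lt_of_le hj with rfl | hj'
  · simp [shifts]
  · obtain ⟨j, rfl⟩ := Int.eq_ofNat_of_zero_le (by omega : 0 ≤ j)
    rw [shifts_natCast, Int.card_Ico, sub_zero, Int.toNat_natCast, Int.toNat_natCast]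

/-- The index set of the hyperbolic wavelet projection. -/
noncomputable def hypIndex (d n : ℕ) : Finset (Σ _ : Fin d → ℤ, Fin d → ℤ) :=
  (levels d n).sigma shiftsMulti

theorem card_hypIndex (d n : ℕ) :
    (hypIndex d n).card = ∑ j ∈ levels d n, 2 ^ ∑ i, (j i).toNat := by
  rw [hypIndex, Finset.card_sigma]
  refine Finset.sum_congr rfl fun j hj => ?_
  rw [shiftsMulti, Fintype.card_piFinset, ← Finset.prod_pow_eq_pow_sum]
  exact Finset.prod_congr rfl fun i _ => card_shifts ((mem_levels.1 hj).1 i)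

theorem mem_levels_iff_toNat {n : ℕ} {j : Fin d → ℤ} :
    j ∈ levels d n ↔ (∀ i, -1 ≤ j i) ∧ ∑ i, (j i).toNat ≤ n := by
  rw [mem_levels]
  have h : ∑ i, max (j i) 0 = ((∑ i, (j i).toNat : ℕ) : ℤ) := by
    push_cast
    exact Finset.sum_congr rfl fun i _ => by omega
  rw [h]
  norm_cast

/-- Levels `-1` and `0` have the same size, so the geometric sum `2 ^ (n + 1) - 2 ^ r` over the
nonnegative levels is increased by exactly `2 ^ r`. -/
theorem sum_two_pow_le (n r : ℕ) :
    ∑ a ∈ Finset.Icc (-1 : ℤ) n with a.toNat + r ≤ n, 2 ^ (a.toNat + r) ≤ 2 ^ (n + 1) := by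
  by_cases hr : r ≤ n
  · have hsub : ((Finset.Icc (-1 : ℤ) n).filter fun a => a.toNat + r ≤ n) ⊆
        insert (-1 : ℤ) ((Finset.range (n - r + 1)).map Nat.castEmbedding) := by
      intro a ha
      simp only [Finset.mem_filter, Finset.mem_Icc] at ha
      rw [Finset.mem_insert, Finset.mem_map]
      by_cases h : a = -1
      · exact Or.inl h
      · refine Or.inr ⟨a.toNat, ?_, ?_⟩
        · rw [Finset.mem_range]; omega
        · simp only [Nat.castEmbedding_apply]; omega
    refine (Finset.sum_le_sum_of_subset hsub).trans ?_
    rw [Finset.sum_insert (by simp), Finset.sum_map]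
    simp only [Nat.castEmbedding_apply, Int.toNat_natCast, pow_add]
    rw [← Finset.sum_mul]
    have h1 := Nat.geomSum_eq (le_refl 2) (n - r + 1)
    simp only [Nat.add_one_sub_one, Nat.div_one] at h1
    have h2 : 1 ≤ 2 ^ (n - r + 1) := Nat.one_le_two_pow
    have h3 : 2 ^ n * 2 ^ 1 = 2 ^ (n - r + 1) * 2 ^ r := by
      rw [← pow_add, ← pow_add]; congr 1; omega
    rw [h1, h3]
    rw [show Int.toNat (-1) = 0 from rfl, pow_zero, one_mul]
    rw [Nat.sub_mul, one_mul]
    have h4 : 2 ^ r ≤ 2 ^ (n - r + 1) * 2 ^ r := Nat.le_mul_of_pos_left _ h2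
    omega
  · rw [Finset.filter_false_of_mem fun a _ => by omega]
    simp

/-- All coordinates but the first range over at most `n + 2` values each; for fixed values of these
the sum over the first coordinate is geometric. -/
theorem card_hypIndex_le (d n : ℕ) :
    (hypIndex (d + 1) n).card ≤ (n + 2) ^ d * 2 ^ (n + 1) := by
  classical
  rw [card_hypIndex]
  have hsub : levels (d + 1) n ⊆ (Fintype.piFinset fun _ : Fin (d + 1) =>
      Finset.Icc (-1 : ℤ) n).filter fun j => ∑ i, (j i).toNat ≤ n := by
    intro j hj
    exact Finset.mem_filter.2 ⟨(Finset.mem_filter.1 hj).1, (mem_levels_iff_toNat.1 hj).2⟩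
  refine (Finset.sum_le_sum_of_subset hsub).trans ?_
  rw [Finset.sum_filter, sum_piFinset_succ, Finset.sum_comm]
  simp only [Fin.sum_univ_succ, Fin.cons_zero, Fin.cons_succ]
  refine (Finset.sum_le_card_nsmul _ _ (2 ^ (n + 1)) fun J _ => ?_).trans ?_
  · rw [← Finset.sum_filter]
    exact sum_two_pow_le n (∑ i, (J i).toNat)
  · rw [Fintype.card_piFinset]
    simp only [Int.card_Icc, Finset.prod_const, Finset.card_univ, Fintype.card_fin, smul_eq_mul]
    rw [show ((n : ℤ) + 1 - -1).toNat = n + 2 by omega]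

/-- Two multi-indices suffice: `(n, -1, …, -1)` and `(-1, …, -1)`. The extra `1` keeps the count at
least `2` for `n = 0`, so that its logarithm is positive. -/
theorem le_card_hypIndex (d n : ℕ) : 2 ^ n + 1 ≤ (hypIndex (d + 1) n).card := by
  classical
  rw [card_hypIndex]
  set j₁ : Fin (d + 1) → ℤ := Fin.cons (n : ℤ) fun _ => -1
  set j₂ : Fin (d + 1) → ℤ := fun _ => -1
  have h1 : ∑ i, (j₁ i).toNat = n := by simp [j₁, Fin.sum_univ_succ]
  have h2 : ∑ i, (j₂ i).toNat = 0 := by simp [j₂]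
  have hne : j₁ ≠ j₂ := by
    intro h
    have := congrFun h 0
    simp only [j₁, j₂, Fin.cons_zero] at this
    omega
  have hsub : {j₁, j₂} ⊆ levels (d + 1) n := by
    intro j hj
    rw [Finset.mem_insert, Finset.mem_singleton] at hj
    rw [mem_levels_iff_toNat]
    rcases hj with rfl | rfl
    · refine ⟨fun i => ?_, h1.le⟩
      refine Fin.cases ?_ (fun i => ?_) i
      · simp only [j₁, Fin.cons_zero]; omega
      · simp only [j₁, Fin.cons_succ]; omega
    · exact ⟨fun i => le_refl _, by rw [h2]; omega⟩
  refine le_trans (le_of_eq ?_) (Finset.sum_le_sum_of_subset hsub)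
  rw [Finset.sum_pair hne, h1, h2, pow_zero]

/-- The tensor wavelets in the sum span the range, being fixed by the operator, and biorthogonality
makes them linearly independent. -/
theorem hypRank_eq {ψs : ℤ → ℤ → L2T} (hdual : IsDualSystem φ ψ ψs) (d n : ℕ) :
    hypRank φ ψ ψs d n = (hypIndex d n).card := by
  classical
  set v : (Σ _ : Fin d → ℤ, Fin d → ℤ) → L2Td d := fun p =>
    tensorL2 fun i => waveletPer φ ψ (p.1 i) (p.2 i)
  set v' : (Σ _ : Fin d → ℤ, Fin d → ℤ) → L2Td d := fun p =>
    tensorL2 fun i => ψs (p.1 i) (p.2 i)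
  have hmem : ∀ p ∈ hypIndex d n, p.1 ∈ levels d n ∧ (∀ i, -1 ≤ p.1 i) ∧
      ∀ i, p.2 i ∈ shifts (p.1 i) := by
    intro p hp
    obtain ⟨h1, h2⟩ := Finset.mem_sigma.1 hp
    exact ⟨h1, (mem_levels.1 h1).1, Fintype.mem_piFinset.1 h2⟩
  have hbi : ∀ p ∈ hypIndex d n, ∀ q ∈ hypIndex d n,
      inner ℂ (v' q) (v p) = if p = q then 1 else 0 := by
    rintro ⟨j, k⟩ hp ⟨i, l⟩ hq
    obtain ⟨-, hp1, hp2⟩ := hmem _ hp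
    obtain ⟨-, hq1, hq2⟩ := hmem _ hq
    simp only [v, v', inner_tensorL2]
    rw [Finset.prod_congr rfl fun r _ => hdual (j r) (hp1 r) (k r) (hp2 r) (i r) (hq1 r) (l r)
      (hq2 r)]
    split_ifs with h
    · cases h; simp
    · have : ∃ r, ¬ (j r = i r ∧ k r = l r) := by
        by_contra! hall
        apply h
        have e1 : j = i := funext fun r => (hall r).1
        have e2 : k = l := funext fun r => (hall r).2
        rw [e1, e2]
      obtain ⟨r, hr⟩ := this
      exact Finset.prod_eq_zero (Finset.mem_univ r) (if_neg hr)
  have hrange : LinearMap.range (hypProj φ ψ ψs d n : L2Td d →ₗ[ℂ] L2Td d) =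
      Submodule.span ℂ (Set.range fun p : hypIndex d n => v p) := by
    apply le_antisymm
    · rintro _ ⟨f, rfl⟩
      rw [ContinuousLinearMap.coe_coe, hypProj_apply]
      refine Submodule.sum_mem _ fun j hj => Submodule.sum_mem _ fun k hk =>
        Submodule.smul_mem _ _ (Submodule.subset_span ?_)
      exact ⟨⟨⟨j, k⟩, Finset.mem_sigma.2 ⟨hj, hk⟩⟩, rfl⟩
    · rw [Submodule.span_le]
      rintro _ ⟨⟨p, hp⟩, rfl⟩
      obtain ⟨h1, h2, h3⟩ := hmem p hp
      refine ⟨v p, ?_⟩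
      rw [ContinuousLinearMap.coe_coe]
      simp only [v]
      rw [hypProj_tensor hdual n h2 fun i => waveletPer_mem_levelSpace (h3 i),
        if_pos (mem_levels.1 h1).2]
  have hli : LinearIndependent ℂ fun p : hypIndex d n => v p := by
    rw [linearIndependent_iff']
    intro s g hg p hp
    have h1 := congrArg (fun y => inner ℂ (v' p) y) hg
    simp only [inner_sum, inner_smul_right, inner_zero_right] at h1
    rw [Finset.sum_eq_single p] at h1
    · rw [hbi p p.2 p p.2] at h1
      simpa using h1
    · intro q _ hq
      rw [hbi q q.2 p p.2, if_neg fun h => hq (Subtype.ext h), mul_zero]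
    · intro h
      exact absurd hp h
  rw [hypRank, hrange, finrank_span_eq_card hli, Fintype.card_coe]

/-- From `(2^n + 1)² ≥ 2^(n+1)` the lower bound on `N` gives `n + 2 ≤ (4 / log 2) log N`. Inserting
this in the upper bound and solving for `2^{-n}` gives the case `s = 1`; then the power `s` is
taken. -/
theorem two_rpow_neg_le {d n N : ℕ} {s : ℝ} (hs : 0 < s) (h1 : 2 ^ n + 1 ≤ N)
    (h2 : N ≤ (n + 2) ^ d * 2 ^ (n + 1)) :
    (2 : ℝ) ^ (-(s * n)) ≤ (2 * (4 / Real.log 2) ^ d) ^ s * (N : ℝ) ^ (-s) *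
      Real.log N ^ (s * d) := by
  have hlog2 : 0 < Real.log 2 := Real.log_pos (by norm_num)
  have hN : (0 : ℝ) < N := by
    have : 0 < N := (Nat.succ_pos _).trans_le h1
    exact_mod_cast this
  have h1' : (2 : ℝ) ^ n + 1 ≤ N := by exact_mod_cast h1
  have h2' : (N : ℝ) ≤ (n + 2) ^ d * 2 ^ (n + 1) := by exact_mod_cast h2
  have hlog : (n + 1) * Real.log 2 ≤ 2 * Real.log N := by
    have h3 : (2 : ℝ) ^ (n + 1) ≤ (N : ℝ) ^ 2 := by
      have h4 : ((2 : ℝ) ^ n + 1) ^ 2 ≤ (N : ℝ) ^ 2 := by gcongr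
      have h5 : (0 : ℝ) < 2 ^ n := by positivity
      rw [pow_succ]
      nlinarith
    have h4 := Real.log_le_log (by positivity) h3
    rw [Real.log_pow, Real.log_pow] at h4
    push_cast at h4
    exact h4
  have hlogN : 0 ≤ Real.log N := by
    have : 0 ≤ ((n : ℝ) + 1) * Real.log 2 := by positivity
    linarith
  have hn : (n : ℝ) + 2 ≤ 4 / Real.log 2 * Real.log N := by
    rw [div_mul_eq_mul_div, le_div_iff₀ hlog2]
    nlinarith
  have hmain : ((2 : ℝ) ^ n)⁻¹ ≤ 2 * (4 / Real.log 2) ^ d * (N : ℝ)⁻¹ * Real.log N ^ d := by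
    have h3 : (N : ℝ) ≤ (4 / Real.log 2 * Real.log N) ^ d * 2 ^ (n + 1) :=
      h2'.trans (by gcongr)
    rw [mul_pow, pow_succ] at h3
    rw [inv_le_iff_one_le_mul₀ (by positivity)]
    have h4 : 2 * (4 / Real.log 2) ^ d * (N : ℝ)⁻¹ * Real.log N ^ d * 2 ^ n =
        ((4 / Real.log 2) ^ d * Real.log N ^ d * (2 ^ n * 2)) / N := by
      field_simp
    rw [h4, le_div_iff₀ hN, one_mul]
    exact h3
  have hpow := Real.rpow_le_rpow (by positivity) hmain hs.le
  rw [Real.mul_rpow (by positivity) (by positivity), Real.mul_rpow (by positivity) (by positivity),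
    Real.inv_rpow hN.le, ← Real.rpow_neg hN.le, ← Real.rpow_natCast (Real.log N),
    ← Real.rpow_mul hlogN, mul_comm (d : ℝ) s, Real.inv_rpow (by positivity),
    ← Real.rpow_natCast, ← Real.rpow_mul (by norm_num), ← Real.rpow_neg (by norm_num),
    mul_comm (n : ℝ) s] at hpow
  exact hpow

end HypWavelet

/-! ### The error estimate in terms of the rank. -/

theorem mainTheorem6 (d : ℕ) (hd : 1 ≤ d) (m : ℕ) (s : ℝ) (hs : 0 < s) (hsm : s < m)
    (φ ψ : ℝ → ℝ) (hψ : HypWavelet.IsWavelet φ ψ)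
    (hsupp : HypWavelet.HasCompactSupp ψ)
    (hmom : HypWavelet.HasVanishingMoments ψ m)
    (hRiesz : HypWavelet.IsLevelwiseRiesz φ ψ)
    (ψs : ℤ → ℤ → HypWavelet.L2T) (hdual : HypWavelet.IsDualSystem φ ψ ψs) :
    ∃ C : ℝ, ∀ (n : ℕ) (f : HypWavelet.L2Td d), HypWavelet.MemHmix s f →
      ‖f - HypWavelet.hypProj φ ψ ψs d n f‖ ≤
        C * (HypWavelet.hypRank φ ψ ψs d n : ℝ) ^ (-s) *
          Real.log (HypWavelet.hypRank φ ψ ψs d n) ^ (s * ((d : ℝ) - 1)) *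
          HypWavelet.normHmix s f := by
  -- From here `d` stands for the dimension minus one, the exponent of the logarithm in the count.
  obtain ⟨d, rfl⟩ := Nat.exists_eq_add_of_le' hd
  obtain ⟨C, hC, h⟩ :=
    HypWavelet.exists_error_bound hs hsm hψ hsupp hmom hRiesz hdual (d + 1)
  refine ⟨C * (2 * (4 / Real.log 2) ^ d) ^ s, fun n f hf => (h n f hf).trans ?_⟩
  have hN : 0 ≤ HypWavelet.normHmix s f := Real.sqrt_nonneg _
  refine mul_le_mul_of_nonneg_right ?_ hN
  rw [HypWavelet.hypRank_eq hdual, mul_assoc C, mul_assoc C]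
  refine mul_le_mul_of_nonneg_left ?_ hC
  have := HypWavelet.two_rpow_neg_le hs (HypWavelet.le_card_hypIndex d n)
    (HypWavelet.card_hypIndex_le d n)
  simpa using this
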